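/- Theorem 7. $L\ge 1$ download threads serve $N$ read requests ($1\le N\le\infty$). Request $i$ arrives at the deterministic time $a_i$, where $0=a_1\le a_2\le\cdots$ (and $a_i\to\infty$ if $N=\infty$), and asks for a file stored with an $(n_i,k_i)$ MDS code, $1\le k_i\le n_i$: it is completed, at a time $c_i$, as soon as $k_i$ of its $n_i$ chunks have been downloaded. Each thread downloads one chunk at a time, and no chunk is assigned to two threads. An online non-preemptive policy decides, at any time, which chunks of unfinished requests that have arrived are assigned to idle threads (threads may be left idle), using only the parameters $(a_i,k_i,n_i)$ of the requests that have arrived, and the past starts and completions of downloads; a download that has been started goes on until it is completed, except that all downloads of a request are terminated immediately when that request is completed. For a policy $\pi$ let $$\overline D_\pi=\frac1N\sum_{i=1}^N\big(\mathbb E\{c_{i,\pi}\}-a_i\big)\in[0,\infty],$$ with $\limsup_{m\to\infty}\frac1m\sum_{i=1}^m(\mathbb E\{c_{i,\pi}\}-a_i)$ in its place if $N=\infty$, and let $t_{j,\pi}$ be the completion time of the $j$-th downloaded chunk of all files ($c_{i,\pi}$ and $t_{j,\pi}$ are $\infty$ if the event never happens). Non-preemptive SEDPT-R is any online policy that, whenever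 a thread is idle and some chunk can be assigned to it, immediately assigns it to a chunk (neither downloaded nor being downloaded) of an unfinished request with the smallest $\alpha-\delta$ among those that have such a chunk, where $\alpha$ is the number of chunks still to be downloaded for the request and $\delta$ is the number of threads now assigned to it; ties are broken arbitrarily. Suppose that (i) $d_{\min}=\min_i(n_i-k_i+1)\ge L$, (ii) $k_i=1$ for all $i$ (repetition codes), (iii) preemption is not allowed, and (iv) the chunk downloading times are i.i.d. with a New-Shorter-than-Used (New-Worse-than-Used) distribution on $[0,\infty)$, i.e. $\mathbb P(X>t)\le\mathbb P(X>t+\tau\mid X>\tau)$ for all $t,\tau\ge0$ with $\mathbb P(X>\tau)>0$. Then, for any given $N$ and $(a_i,k_i=1,n_i)_{i=1}^N$, non-preemptive SEDPT-R is delay-optimal: $\overline D_{\text{SEDPT-R}}\le\overline D_\pi$ for every online non-preemptive policy $\pi$ (if $N=\infty$, for SEDPT-R that breaks ties in the order of arrival). Moreover, with any rule for ties, its chunk departure times are stochastically smallest: for every finite $m\le N$ and every measurable upper set $U\subseteq[0,\infty]^m$, $\mathbb P\big((t_1,\dots,t_m)_{\text{SEDPT-R}}\in U\big)\le\mathbb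 P\big((t_1,\dots,t_m)_\pi\in U\big)$. -/

import Mathlib

open MeasureTheory ProbabilityTheory Filter
open scoped ENNReal NNReal

namespace StorageCloud

noncomputable section

/-- A read request: arrival time `a`, and the `(n, k)` MDS code of the requested file
(any `k` of its `n` coded chunks restore the file). -/
structure Request where
  a : ℝ≥0
  k : ℕ
  n : ℕ

/-- The Hamming distance `n - k + 1` of the `(n, k)` MDS code of a request. -/
def Request.distance (r : Request) : ℕ := r.n - r.k + 1

/-- The request parameters: the number `N` of requests (finite or infinite), and the requests
`req i`, `i < N` (values `req i` with `N ≤ i` are never used). -/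
structure Arrivals where
  N : ℕ∞
  req : ℕ → Request

/-- Standing assumptions: there is a request, `0 = a₁ ≤ a₂ ≤ ⋯`, `1 ≤ kᵢ ≤ nᵢ`, and an infinite
arrival sequence has finitely many arrivals in bounded time. -/
structure Arrivals.Valid (R : Arrivals) : Prop where
  pos : 1 ≤ R.N
  first : (R.req 0).a = 0
  mono : ∀ i j : ℕ, i ≤ j → (j : ℕ∞) < R.N → (R.req i).a ≤ (R.req j).a
  code : ∀ i : ℕ, (i : ℕ∞) < R.N → 1 ≤ (R.req i).k ∧ (R.req i).k ≤ (R.req i).n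
  locallyFinite : R.N = ⊤ → Tendsto (fun i => (R.req i).a) atTop atTop

/-- The minimum distance among all storage codes. -/
def Arrivals.dMin (R : Arrivals) : ℕ∞ :=
  ⨅ i : ℕ, ⨅ _ : (i : ℕ∞) < R.N, ((R.req i).distance : ℕ∞)

/-- The chunk `(i, q)` is the `q`-th coded chunk of the file of request `i`, `q < nᵢ`. -/
abbrev Chunk := ℕ × ℕ

/-- What is known of the requests at some time: the parameters of the requests that have arrived,
and nothing about the others. -/
abbrev View := ℕ → Option Request

open Classical in
/-- The requests known at time `t`. -/
def Arrivals.view (R : Arrivals) (t : ℝ≥0) : View :=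
  fun i => if (i : ℕ∞) < R.N ∧ (R.req i).a ≤ t then some (R.req i) else none

/-- The record of the past: the present time, the time at which the download of each chunk was
started (`⊤` if it was not), and the time at which it was accomplished (`⊤` if it was not). -/
@[ext]
structure Record where
  now : ℝ≥0
  start : Chunk → ℝ≥0∞
  fin : Chunk → ℝ≥0∞

instance : MeasurableSpace Record :=
  MeasurableSpace.comap (fun s : Record => (s.now, s.start, s.fin)) inferInstance

/-- Before time `0` nothing has happened. -/
def Record.init : Record := ⟨0, fun _ => ⊤, fun _ => ⊤⟩

open Classical in
/-- The number of chunks of request `i` (with parameters `r`) that have been downloaded. -/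
def downloaded (s : Record) (i : ℕ) (r : Request) : ℕ :=
  ((Finset.range r.n).filter fun q => s.fin (i, q) ≠ ⊤).card

/-- Request `i` has arrived and is not completed. -/
def Unfinished (v : View) (s : Record) (i : ℕ) : Prop :=
  ∃ r, v i = some r ∧ downloaded s i r < r.k

/-- The chunk `c` is under service: its download was started, is not accomplished, and has not been
terminated. It is terminated at once when its request is completed, and for no other reason. -/
def InService (v : View) (s : Record) (c : Chunk) : Prop :=
  Unfinished v s c.1 ∧ s.start c ≠ ⊤ ∧ s.fin c = ⊤

/-- A thread can be assigned to the chunk `c`: fewer than `L` threads are busy, the request of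
`c` is unfinished, and `c` is one of its chunks that is neither downloaded nor under service. -/
def Startable (L : ℕ) (v : View) (s : Record) (c : Chunk) : Prop :=
  Set.encard {c' | InService v s c'} < L ∧ Unfinished v s c.1 ∧
    (∃ r, v c.1 = some r ∧ c.2 < r.n) ∧ s.start c = ⊤

/-- An online non-preemptive policy. On the basis of the known requests and of the record of the
past it plans the next start of a download: `(plan v s).2` is the chunk to be started, at
`(plan v s).1` units of time from now (`⊤`: never), unless a request arrives or a download is
accomplished until then; after each of these events, and after each start, it plans anew.
Threads may stay idle. -/
structure OnlinePolicy where
  plan : View → Record → ℝ≥0∞ × Chunk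
  measurable_plan : ∀ v, Measurable (plan v)

/-- The time of the first arrival after the present. -/
def nextArrival (R : Arrivals) (s : Record) : ℝ≥0∞ :=
  ⨅ i : ℕ, ⨅ _ : (i : ℕ∞) < R.N ∧ s.now < (R.req i).a, ((R.req i).a : ℝ≥0∞)

/-- The time of the first accomplishment of one of the downloads under service, when `x c` is the
downloading time of chunk `c`. -/
def nextDone (x : Chunk → ℝ≥0) (v : View) (s : Record) : ℝ≥0∞ :=
  ⨅ c : Chunk, ⨅ _ : InService v s c, s.start c + x c

/-- Of the downloads under service, that of `c` is the first to be accomplished; simultaneous ones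
are taken one after the other, in the order of an enumeration of the chunks. -/
def IsNextDone (x : Chunk → ℝ≥0) (v : View) (s : Record) (c : Chunk) : Prop :=
  InService v s c ∧ ∀ c', InService v s c' → s.start c + x c < s.start c' + x c' ∨
    (s.start c + x c = s.start c' + x c' ∧ Encodable.encode c ≤ Encodable.encode c')

open Classical in
/-- The system goes on to the next arrival, accomplished download, or start of a download.
What the policy plans for the very moment of an arrival or an accomplishment is reconsidered. A
plan that cannot be carried out is ignored until then. -/
def step (L : ℕ) (R : Arrivals) (π : OnlinePolicy) (x : Chunk → ℝ≥0) (s : Record) : Record :=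
  let v := R.view s.now
  let c₀ := (π.plan v s).2
  let S : ℝ≥0∞ := if Startable L v s c₀ then s.now + (π.plan v s).1 else ⊤
  let T : ℝ≥0∞ := min (nextArrival R s) (nextDone x v s)
  if T ≤ S then
    if T = ⊤ then s
    else ⟨T.toNNReal, s.start,
      fun c => if IsNextDone x v s c ∧ s.start c + x c = T then T else s.fin c⟩
  else ⟨S.toNNReal, Function.update s.start c₀ S, s.fin⟩

/-- The record after `m` steps. -/
def run (L : ℕ) (R : Arrivals) (π : OnlinePolicy) (x : Chunk → ℝ≥0) (m : ℕ) : Record :=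
  (step L R π x)^[m] Record.init

/-- The completion time of request `i`: the time at which `kᵢ` of its chunks have been downloaded
(`⊤` if that never happens). -/
def completion (L : ℕ) (R : Arrivals) (π : OnlinePolicy) (x : Chunk → ℝ≥0) (i : ℕ) : ℝ≥0∞ :=
  ⨅ m : ℕ, ⨅ _ : (R.req i).k ≤ downloaded (run L R π x m) i (R.req i),
    ((run L R π x m).now : ℝ≥0∞)

/-- The chunk departure times: `departure L R π x j` is the completion time of the `(j + 1)`-st
downloaded chunk of all files (`⊤` if there is none). -/
def departure (L : ℕ) (R : Arrivals) (π : OnlinePolicy) (x : Chunk → ℝ≥0) (j : ℕ) : ℝ≥0∞ :=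
  ⨅ m : ℕ, ⨅ _ : ((j + 1 : ℕ) : ℕ∞) ≤ Set.encard {c | (run L R π x m).fin c ≠ ⊤},
    ((run L R π x m).now : ℝ≥0∞)

/-- The average flow time of the first `m` requests, when the downloading time of chunk `c` is the
random variable `X c`. -/
def avgFlowOfFirst {Ω : Type*} [MeasurableSpace Ω] (P : Measure Ω) (X : Chunk → Ω → ℝ≥0)
    (L : ℕ) (R : Arrivals) (π : OnlinePolicy) (m : ℕ) : ℝ≥0∞ :=
  (∑ i ∈ Finset.range m,
    ((∫⁻ ω, completion L R π (fun c => X c ω) i ∂P) - ((R.req i).a : ℝ≥0∞))) / m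

open Classical in
/-- The average flow time of all requests; an upper limit if there are infinitely many. -/
def avgFlow {Ω : Type*} [MeasurableSpace Ω] (P : Measure Ω) (X : Chunk → Ω → ℝ≥0)
    (L : ℕ) (R : Arrivals) (π : OnlinePolicy) : ℝ≥0∞ :=
  if R.N = ⊤ then limsup (avgFlowOfFirst P X L R π) atTop
  else avgFlowOfFirst P X L R π R.N.toNat

open Classical in
/-- The difference `α - δ` of the number `α` of chunks of request `i` that still need to be
downloaded and the number `δ` of threads that are assigned to request `i`. -/
def differential (v : View) (s : Record) (i : ℕ) : ℤ :=
  match v i with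
  | none => 0
  | some r => ((r.k : ℤ) - downloaded s i r) -
      ((Finset.range r.n).filter fun q => InService v s (i, q)).card

/-- Non-preemptive SEDPT-R with `L` threads: whenever a thread is idle and there is a chunk that
it can be assigned to, it is assigned at once to such a chunk whose request has the smallest
`α - δ`. Ties are broken arbitrarily. -/
def IsSEDPTR (L : ℕ) (π : OnlinePolicy) : Prop :=
  ∀ (v : View) (s : Record), {i | v i ≠ none}.Finite → (∃ c, Startable L v s c) →
    (π.plan v s).1 = 0 ∧ Startable L v s (π.plan v s).2 ∧
      ∀ c, Startable L v s c →
        differential v s (π.plan v s).2.1 ≤ differential v s c.1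

/-- Of several requests with the same `α - δ` to which an idle thread can be assigned, the policy
prefers the one that arrived first. -/
def BreaksTiesByArrival (L : ℕ) (π : OnlinePolicy) : Prop :=
  ∀ (v : View) (s : Record), {i | v i ≠ none}.Finite → (∃ c, Startable L v s c) →
    ∀ c, Startable L v s c → differential v s c.1 = differential v s (π.plan v s).2.1 →
      (π.plan v s).2.1 ≤ c.1

/-- New-Shorter-than-Used (New-Worse-than-Used) distributions on `[0, ∞)`. -/
def IsNSU (μ : Measure ℝ≥0) : Prop :=
  ∀ t τ : ℝ≥0, 0 < μ (Set.Ioi τ) → μ (Set.Ioi t) ≤ cond μ (Set.Ioi τ) (Set.Ioi (t + τ))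

/-- The multivariate stochastic order `Y ≤_st Z` of random vectors. -/
def StochLE {Ω : Type*} [MeasurableSpace Ω] (P : Measure Ω) {m : ℕ}
    (Y Z : Ω → Fin m → ℝ≥0∞) : Prop :=
  ∀ U : Set (Fin m → ℝ≥0∞), IsUpperSet U → MeasurableSet U → P (Y ⁻¹' U) ≤ P (Z ⁻¹' U)

end

end StorageCloud

open StorageCloud

/-! One downloaded chunk completes a request, so each departure completes one request and withdraws
its other replicas. The yardstick is a single-server queue with departures `D_{j+1} = max(D_j,
a_{j+1}) + Y`, where `Y` is a fresh minimum of `L` independent downloading times (`minLaw`).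

SEDPT-R is at least as fast as this queue. A request with a replica under service has `α - δ ≤ 0`,
any other one has `1`, and `n_i ≥ L` replicas suffice for all threads. Hence all threads serve the
same request, all are free after each departure, and the next departure comes no later than the
first of `L` new downloads, all started as soon as a request is waiting (`sedptr_cover`).

No policy is faster than this queue. Between departures no thread is released, so up to a given time
at most `L` downloads can cause the next departure (`exists_cover`). Those not yet started begin no
earlier than `max(D_j, a_{j+1})`; those already running have, by the NSU property, residual lives
stochastically no shorter than new ones (`policy_next_departure`).

These one-departure estimates are chained by backward induction along `value`, the expectation for
the queue (`value_le_lintegral_future`). What the past reveals about the downloading times is always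
that they lie in a box (`Fits`), so that conditioning amounts to integrating over boxes. Both
estimates are lower bounds, for monotone functions under any policy and for antitone ones under
SEDPT-R. Applied to the indicators of an upper set and of its complement, whose values for the queue
add up to one, they give the stochastic order (`departures_upperSet_le`).

For flow times, the first `m` completion times of any policy sum to at least the first `m` departure
times. For SEDPT-R the reverse holds when `m = N`, or when requests are served in order of arrival.
-/

namespace StorageCloud

open Set Function

/-! ### Stochastic order through tails, and the NSU inequality. -/

section Tails

/-- Tonelli's theorem for the area below the graph of `f`. -/
theorem lintegral_eq_lintegral_tail {γ : Type*} [MeasurableSpace γ] {m : Measure γ}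
    [SFinite m] {f : γ → ℝ≥0∞}
    (key : ∀ t : ℝ≥0∞, t = ∫⁻ v in Ioi (0 : ℝ),
      {v : ℝ | ENNReal.ofReal v < t}.indicator 1 v)
    (hf : Measurable f) :
    ∫⁻ a, f a ∂m = ∫⁻ v in Ioi (0 : ℝ), m {a | ENNReal.ofReal v < f a} := by
  calc ∫⁻ a, f a ∂m
      = ∫⁻ a, (∫⁻ v in Ioi (0 : ℝ), {v : ℝ | ENNReal.ofReal v < f a}.indicator 1 v) ∂m := by
        simp_rw [← key]
    _ = ∫⁻ v in Ioi (0 : ℝ), (∫⁻ a, {v : ℝ | ENNReal.ofReal v < f a}.indicator 1 v ∂m) := by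
        rw [lintegral_lintegral_swap]
        refine Measurable.aemeasurable ?_
        have : (uncurry fun (a : γ) (v : ℝ) =>
            {v : ℝ | ENNReal.ofReal v < f a}.indicator (1 : ℝ → ℝ≥0∞) v)
            = {p : γ × ℝ | ENNReal.ofReal p.2 < f p.1}.indicator 1 := by
          ext p
          simp only [indicator, uncurry, mem_ofPred_eq]
          rfl
        rw [this]
        exact measurable_one.indicator
          (measurableSet_lt (ENNReal.measurable_ofReal.comp measurable_snd)
            (hf.comp measurable_fst))
    _ = _ := by
        refine lintegral_congr fun v => ?_
        rw [← lintegral_indicator_one (measurableSet_lt measurable_const hf)]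
        refine lintegral_congr fun a => ?_
        simp only [indicator, mem_ofPred_eq]
        rfl

/-- Comparison of integrals by comparison of the tails of the integrands. -/
theorem lintegral_le_of_tails {α β : Type*} [MeasurableSpace α] [MeasurableSpace β]
    {m₁ : Measure α} {m₂ : Measure β} [SFinite m₁] [SFinite m₂]
    {f₁ : α → ℝ≥0∞} {f₂ : β → ℝ≥0∞}
    (hf₁ : Measurable f₁) (hf₂ : Measurable f₂)
    (h : ∀ v : ℝ≥0, m₁ {a | (v : ℝ≥0∞) < f₁ a} ≤ m₂ {b | (v : ℝ≥0∞) < f₂ b}) :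
    ∫⁻ a, f₁ a ∂m₁ ≤ ∫⁻ b, f₂ b ∂m₂ := by
  have key : ∀ t : ℝ≥0∞, t = ∫⁻ v in Ioi (0 : ℝ),
      {v : ℝ | ENNReal.ofReal v < t}.indicator 1 v := by
    intro t
    rw [lintegral_indicator_one (measurableSet_lt ENNReal.measurable_ofReal measurable_const),
      Measure.restrict_apply
        (measurableSet_lt ENNReal.measurable_ofReal measurable_const)]
    induction t with
    | top => simp
    | coe t =>
      have : {v : ℝ | ENNReal.ofReal v < (t : ℝ≥0∞)} ∩ Ioi 0 = Ioo 0 (t : ℝ) := by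
        ext v
        simp only [mem_inter_iff, mem_ofPred_eq, mem_Ioi, mem_Ioo]
        rw [and_comm]
        refine and_congr_right fun hv => ?_
        rw [ENNReal.ofReal_lt_iff_lt_toReal hv.le ENNReal.coe_ne_top]
        simp
      rw [this]
      simp
  have tonelli₁ : ∫⁻ a, f₁ a ∂m₁ = ∫⁻ v in Ioi (0 : ℝ), m₁ {a | ENNReal.ofReal v < f₁ a} :=
    lintegral_eq_lintegral_tail key hf₁
  have tonelli₂ : ∫⁻ a, f₂ a ∂m₂ = ∫⁻ v in Ioi (0 : ℝ), m₂ {a | ENNReal.ofReal v < f₂ a} :=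
    lintegral_eq_lintegral_tail key hf₂
  rw [tonelli₁, tonelli₂]
  exact lintegral_mono fun v => h v.toNNReal

/-- Stochastic order on `[0, ∞]`: comparison of the tails gives comparison on upper sets. -/
theorem measure_upperSet_le_of_tails {m₁ m₂ : Measure ℝ≥0∞} [IsFiniteMeasure m₁]
    [IsFiniteMeasure m₂] (h : ∀ u : ℝ≥0, m₁ (Ioi (u : ℝ≥0∞)) ≤ m₂ (Ioi (u : ℝ≥0∞)))
    (huniv : m₁ univ ≤ m₂ univ) {U : Set ℝ≥0∞} (hU : IsUpperSet U) : m₁ U ≤ m₂ U := by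
  rcases U.eq_empty_or_nonempty with rfl | hne
  · simp
  -- An upper set of a linear order is a half-line. An open one is a tail. A closed one is a
  -- decreasing intersection of tails, unless it starts at `0`, where the total masses are compared.
  by_cases ha : sInf U ∈ U
  · have hUI : U = Ici (sInf U) :=
      Subset.antisymm (fun x hx => sInf_le hx) (fun x hx => hU hx ha)
    rcases eq_or_ne (sInf U) 0 with h0 | h0
    · rw [hUI, h0]
      simpa using huniv
    · obtain ⟨b, hbm, hb, hlim⟩ := exists_seq_strictMono_tendsto' (pos_iff_ne_zero.2 h0)
      have hI : Ici (sInf U) = ⋂ n, Ioi (b n) := by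
        ext x
        simp only [mem_Ici, mem_iInter, mem_Ioi]
        exact ⟨fun hx n => (hb n).2.trans_le hx,
          fun hx => le_of_tendsto' hlim fun n => (hx n).le⟩
      have hbt : ∀ n, b n ≠ ⊤ := fun n => ((hb n).2.trans_le le_top).ne
      rw [hUI]
      nth_rewrite 2 [hI]
      have hanti : Antitone fun n => Ioi (b n) := by
        refine antitone_nat_of_succ_le fun n => ?_
        exact Ioi_subset_Ioi (hbm (Nat.lt_succ_self n)).le
      rw [hanti.measure_iInter (fun n => measurableSet_Ioi.nullMeasurableSet)
        ⟨0, measure_ne_top _ _⟩]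
      refine le_iInf fun n => ?_
      calc m₁ (Ici (sInf U)) ≤ m₁ (Ioi (b n)) := measure_mono fun x hx => (hb n).2.trans_le hx
        _ ≤ _ := by
          have := h (b n).toNNReal
          rwa [ENNReal.coe_toNNReal (hbt n)] at this
  · have hUI : U = Ioi (sInf U) := by
      refine Subset.antisymm (fun x hx => lt_of_le_of_ne (sInf_le hx) ?_) fun x hx => ?_
      · rintro rfl; exact ha hx
      · obtain ⟨y, hy, hyx⟩ := sInf_lt_iff.1 (mem_Ioi.1 hx)
        exact hU hyx.le hy
    have hat : sInf U ≠ ⊤ := by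
      intro hat
      rw [hat] at hUI
      simp [hUI] at hne
    rw [hUI]
    have := h (sInf U).toNNReal
    rwa [ENNReal.coe_toNNReal hat] at this

/-- The superlevel sets of a monotone function are upper sets, so no continuity of `G` is needed. -/
theorem lintegral_monotone_le_of_tails {m₁ m₂ : Measure ℝ≥0∞} [IsFiniteMeasure m₁]
    [IsFiniteMeasure m₂] (h : ∀ u : ℝ≥0, m₁ (Ioi (u : ℝ≥0∞)) ≤ m₂ (Ioi (u : ℝ≥0∞)))
    (huniv : m₁ univ ≤ m₂ univ) {G : ℝ≥0∞ → ℝ≥0∞} (hG : Monotone G) :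
    ∫⁻ t, G t ∂m₁ ≤ ∫⁻ t, G t ∂m₂ :=
  lintegral_le_of_tails hG.measurable hG.measurable fun _ =>
    measure_upperSet_le_of_tails h huniv fun _ _ hab ha => lt_of_lt_of_le ha (hG hab)

/-- For an NSU law, the residual life at age `τ` exceeds the life of a new item, also when it is
only known that the life is at least `τ`. -/
theorem IsNSU.mul_le {μ : Measure ℝ≥0} [IsProbabilityMeasure μ] (h : IsNSU μ) (t τ : ℝ≥0) :
    μ (Ici τ) * μ (Ioi t) ≤ μ (Ioi (t + τ)) := by
  have key : ∀ t τ : ℝ≥0, μ (Ioi τ) * μ (Ioi t) ≤ μ (Ioi (t + τ)) := by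
    intro t τ
    rcases eq_or_ne (μ (Ioi τ)) 0 with h0 | h0
    · simp [h0]
    · have := h t τ (pos_iff_ne_zero.2 h0)
      rw [cond_apply measurableSet_Ioi,
        inter_eq_self_of_subset_right (Ioi_subset_Ioi le_add_self)] at this
      calc μ (Ioi τ) * μ (Ioi t) ≤ μ (Ioi τ) * ((μ (Ioi τ))⁻¹ * μ (Ioi (t + τ))) := by gcongr
        _ = _ := by
          rw [← mul_assoc, ENNReal.mul_inv_cancel h0 (measure_ne_top _ _), one_mul]
  rcases eq_or_ne τ 0 with rfl | hτ
  · calc _ ≤ 1 * μ (Ioi t) := by gcongr; exact prob_le_one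
      _ = _ := by simp
  -- To allow age exactly `τ`, the age is lowered to `τ - τ / (n + 1)`, so that `Ici τ` lies in the
  -- open tail, and `t` is raised by the same amount; the sum remains `t + τ`.
  have hU : Ioi t = ⋃ n : ℕ, Ioi (t + τ / (n + 1)) := by
    ext x
    simp only [mem_Ioi, mem_iUnion]
    constructor
    · intro hx
      obtain ⟨n, hn⟩ := exists_nat_gt (τ / (x - t))
      refine ⟨n, ?_⟩
      have hpos : 0 < x - t := tsub_pos_of_lt hx
      have h1 : τ < (n + 1) * (x - t) := by
        rw [div_lt_iff₀ hpos] at hn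
        exact hn.trans_le (by gcongr; simp)
      have h2 : τ / (n + 1) < x - t := by
        rw [div_lt_iff₀ (by positivity)]
        rwa [mul_comm] at h1
      have := add_lt_add_right h2 t
      rwa [add_tsub_cancel_of_le hx.le] at this
    · rintro ⟨n, hn⟩
      exact lt_of_le_of_lt le_self_add hn
  have hmono : Monotone fun n : ℕ => Ioi (t + τ / (n + 1) : ℝ≥0) := by
    intro m n hmn
    refine Ioi_subset_Ioi ?_
    gcongr
  rw [hU, hmono.measure_iUnion, ENNReal.mul_iSup]
  refine iSup_le fun n => ?_
  have hlt : τ - τ / (n + 1) < τ :=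
    tsub_lt_self (pos_iff_ne_zero.2 hτ) (div_pos (pos_iff_ne_zero.2 hτ) (by positivity))
  have hle : τ / (n + 1) ≤ τ := div_le_self (zero_le) (by simp)
  calc μ (Ici τ) * μ (Ioi (t + τ / (n + 1)))
      ≤ μ (Ioi (τ - τ / (n + 1))) * μ (Ioi (t + τ / (n + 1))) := by
        gcongr
    _ ≤ _ := key _ _
    _ = _ := by rw [add_assoc, add_tsub_cancel_of_le hle]

end Tails

/-! ### Infinite products: resampling a coordinate, and boxes. -/

section Product

variable {ι : Type*} [DecidableEq ι]

/-- Resampling one coordinate of an i.i.d. family does not change its law. -/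
theorem measurePreserving_update (μ : Measure ℝ≥0) [IsProbabilityMeasure μ] (c : ι) :
    MeasurePreserving (fun p : (ι → ℝ≥0) × ℝ≥0 => update p.1 c p.2)
      ((Measure.infinitePi fun _ : ι => μ).prod μ) (Measure.infinitePi fun _ : ι => μ) := by
  have hm : Measurable (fun p : (ι → ℝ≥0) × ℝ≥0 => update p.1 c p.2) := by
    refine measurable_pi_iff.2 fun d => ?_
    by_cases h : d = c
    · subst h; simpa using measurable_snd
    · simp only [update_of_ne h]; fun_prop
  refine ⟨hm, Measure.eq_infinitePi _ fun s t ht => ?_⟩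
  rw [Measure.map_apply hm (.pi s.countable_toSet fun _ _ => ht _)]
  have hpre : (fun p : (ι → ℝ≥0) × ℝ≥0 => update p.1 c p.2) ⁻¹' (s : Set ι).pi t
      = ((s.erase c : Finset ι) : Set ι).pi t ×ˢ (if c ∈ s then t c else univ) := by
    ext p
    simp only [mem_preimage, Set.mem_pi, Finset.mem_coe, mem_prod, Finset.mem_erase]
    constructor
    · intro h
      refine ⟨fun d hd => by simpa [update_of_ne hd.1] using h d hd.2, ?_⟩
      split_ifs with hc
      · simpa using h c hc
      · trivial
    · rintro ⟨h1, h2⟩ d hd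
      by_cases hdc : d = c
      · subst hdc; simpa [hd] using h2
      · simpa [update_of_ne hdc] using h1 d ⟨hdc, hd⟩
  rw [hpre, Measure.prod_prod, Measure.infinitePi_pi _ fun i _ => ht i]
  split_ifs with hc
  · rw [Finset.prod_erase_mul _ _ hc]
  · simp [Finset.erase_eq_of_notMem hc]

/-- The measure of a box all but finitely many sides of which are full. -/
theorem infinitePi_box (μ : Measure ℝ≥0) [IsProbabilityMeasure μ] {A : ι → Set ℝ≥0}
    (hA : ∀ c, MeasurableSet (A c)) (s : Finset ι) (hs : ∀ c, c ∉ s → A c = univ) :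
    (Measure.infinitePi fun _ : ι => μ) (univ.pi A) = ∏ c ∈ s, μ (A c) := by
  have : univ.pi A = (s : Set ι).pi A := by
    ext x
    simp only [Set.mem_pi, mem_univ, true_imp_iff, Finset.mem_coe]
    refine ⟨fun h c _ => h c, fun h c => ?_⟩
    by_cases hc : c ∈ s
    · exact h c hc
    · rw [hs c hc]; trivial
  rw [this, Measure.infinitePi_pi _ fun i _ => hA i]

end Product

/-! ### Repetition codes and the arrival sequence. -/

/-- Repetition codes with at least `L` replicas of each file. -/
structure Repetition (L : ℕ) (R : Arrivals) : Prop where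
  valid : R.Valid
  k_eq : ∀ i : ℕ, (i : ℕ∞) < R.N → (R.req i).k = 1
  le_n : ∀ i : ℕ, (i : ℕ∞) < R.N → L ≤ (R.req i).n

theorem Repetition.of_dMin {L : ℕ} {R : Arrivals} (hR : R.Valid) (hd : (L : ℕ∞) ≤ R.dMin)
    (hk : ∀ i : ℕ, (i : ℕ∞) < R.N → (R.req i).k = 1) : Repetition L R := by
  refine ⟨hR, hk, fun i hi => ?_⟩
  have h1 : (L : ℕ∞) ≤ ((R.req i).distance : ℕ∞) := hd.trans (iInf₂_le i hi)
  have h2 := Nat.cast_le.1 h1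
  have h3 := hR.code i hi
  have h4 := hk i hi
  unfold Request.distance at h2
  omega

section Arrivals

variable {R : Arrivals}

/-- In bounded time there are finitely many arrivals. -/
theorem Arrivals.Valid.finite_arrived (hR : R.Valid) (u : ℝ≥0) :
    {i : ℕ | (i : ℕ∞) < R.N ∧ (R.req i).a ≤ u}.Finite := by
  rcases eq_or_ne R.N ⊤ with h | h
  · have := (hR.locallyFinite h).eventually_gt_atTop u
    obtain ⟨n, hn⟩ := eventually_atTop.1 this
    refine (finite_lt_nat n).subset fun i hi => ?_
    by_contra hc
    exact absurd (hn i (not_lt.1 hc)) (not_lt.2 hi.2)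
  · refine (finite_lt_nat R.N.toNat).subset fun i hi => ?_
    have := hi.1
    rw [← ENat.natCast_toNat h] at this
    exact Nat.cast_lt.1 this

theorem Arrivals.Valid.finite_window (hR : R.Valid) (s u : ℝ≥0) :
    {i : ℕ | (i : ℕ∞) < R.N ∧ s < (R.req i).a ∧ (R.req i).a ≤ u}.Finite :=
  (hR.finite_arrived u).subset fun _ hi => ⟨hi.1, hi.2.2⟩

/-- The next arrival is the arrival of a request, unless there is none. -/
theorem Arrivals.Valid.nextArrival_spec (hR : R.Valid) (s : Record) (h : nextArrival R s ≠ ⊤) :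
    ∃ i : ℕ, (i : ℕ∞) < R.N ∧ s.now < (R.req i).a ∧ nextArrival R s = (R.req i).a := by
  obtain ⟨i, hi⟩ : ∃ i : ℕ, (i : ℕ∞) < R.N ∧ s.now < (R.req i).a := by
    by_contra hc
    refine h (iInf_eq_top.2 fun i => iInf_eq_top.2 fun hi => absurd ⟨i, hi⟩ hc)
  -- Only the finitely many arrivals up to that of `i` compete, so the infimum is attained.
  obtain ⟨k, hk, hkmin⟩ := (hR.finite_window s.now (R.req i).a).exists_minimalFor
    (fun i => (R.req i).a) _ ⟨i, hi.1, hi.2, le_rfl⟩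
  refine ⟨k, hk.1, hk.2.1, le_antisymm (iInf₂_le k ⟨hk.1, hk.2.1⟩) (le_iInf₂ fun l hl => ?_)⟩
  rw [ENNReal.coe_le_coe]
  rcases le_total (R.req l).a (R.req i).a with hli | hli
  · rcases le_total (R.req k).a (R.req l).a with h' | h'
    · exact h'
    · exact hkmin ⟨hl.1, hl.2, hli⟩ h'
  · exact hk.2.2.trans hli

/-- The strict inequality lets a start planned for the present moment take precedence over the next
arrival. -/
theorem Arrivals.Valid.now_lt_nextArrival (hR : R.Valid) (s : Record) :
    (s.now : ℝ≥0∞) < nextArrival R s := by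
  rcases eq_or_ne (nextArrival R s) ⊤ with h | h
  · rw [h]; exact ENNReal.coe_lt_top
  · obtain ⟨i, -, hi, he⟩ := hR.nextArrival_spec s h
    rw [he]; exact ENNReal.coe_lt_coe.2 hi

end Arrivals

/-! ### Invariants of records. -/

/-- The chunk `c` is being downloaded, when one chunk per request is enough. -/
def busy (s : Record) (c : Chunk) : Prop := s.start c ≠ ⊤ ∧ ∀ q, s.fin (c.1, q) = ⊤

/-- The facts on records that hold throughout a run. -/
structure Record.Valid (L : ℕ) (R : Arrivals) (s : Record) : Prop where
  started : ∀ c, s.start c ≠ ⊤ → s.start c ≤ s.now ∧ (c.1 : ℕ∞) < R.N ∧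
    (R.req c.1).a ≤ s.now ∧ c.2 < (R.req c.1).n
  finished : ∀ c, s.fin c ≠ ⊤ → s.start c ≠ ⊤
  unique : ∀ i q q', s.fin (i, q) ≠ ⊤ → s.fin (i, q') ≠ ⊤ → q = q'
  cap : {c | busy s c}.encard ≤ L

section Valid

variable {L : ℕ} {R : Arrivals} {s : Record}

theorem Record.valid_init : Record.init.Valid L R where
  started c h := absurd rfl h
  finished c h := absurd rfl h
  unique i q q' h := absurd rfl h
  cap := by simp [busy, Record.init]

theorem Record.Valid.finite_busy (hs : s.Valid L R) : {c | busy s c}.Finite :=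
  finite_of_encard_le_coe hs.cap

/-- As one chunk is enough, a request is unfinished exactly if none of its chunks is downloaded.
This and the next two lemmas remove views from the argument. -/
theorem unfinished_iff (hR : Repetition L R) (hs : s.Valid L R) {i : ℕ} :
    Unfinished (R.view s.now) s i ↔
      (i : ℕ∞) < R.N ∧ (R.req i).a ≤ s.now ∧ ∀ q, s.fin (i, q) = ⊤ := by
  unfold Unfinished Arrivals.view
  constructor
  · rintro ⟨r, hr, hd⟩
    split_ifs at hr with h
    cases hr
    refine ⟨h.1, h.2, fun q => ?_⟩
    by_contra hq
    rw [hR.k_eq i h.1] at hd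
    have := Nat.lt_one_iff.1 hd
    unfold downloaded at this
    rw [Finset.card_eq_zero, Finset.filter_eq_empty_iff] at this
    exact this (Finset.mem_range.2 (hs.started _ (hs.finished _ hq)).2.2.2) hq
  · rintro ⟨h1, h2, h3⟩
    refine ⟨R.req i, by simp [h1, h2], ?_⟩
    rw [hR.k_eq i h1]
    simp [downloaded, h3]

theorem inService_iff (hR : Repetition L R) (hs : s.Valid L R) {c : Chunk} :
    InService (R.view s.now) s c ↔ busy s c := by
  unfold InService busy
  rw [unfinished_iff hR hs]
  constructor
  · rintro ⟨⟨-, -, h⟩, h1, -⟩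
    exact ⟨h1, h⟩
  · rintro ⟨h1, h2⟩
    have := hs.started c h1
    exact ⟨⟨this.2.1, this.2.2.1, h2⟩, h1, h2 c.2⟩

theorem startable_iff (hR : Repetition L R) (hs : s.Valid L R) {c : Chunk} :
    Startable L (R.view s.now) s c ↔ {c | busy s c}.encard < L ∧ (c.1 : ℕ∞) < R.N ∧
      (R.req c.1).a ≤ s.now ∧ (∀ q, s.fin (c.1, q) = ⊤) ∧ c.2 < (R.req c.1).n ∧
      s.start c = ⊤ := by
  unfold Startable
  simp only [inService_iff hR hs, unfinished_iff hR hs]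
  constructor
  · rintro ⟨h1, ⟨h2, h3, h4⟩, ⟨r, hr, h5⟩, h6⟩
    simp only [Arrivals.view, h2, h3, and_self, if_true] at hr
    cases hr
    exact ⟨h1, h2, h3, h4, h5, h6⟩
  · rintro ⟨h1, h2, h3, h4, h5, h6⟩
    exact ⟨h1, ⟨h2, h3, h4⟩, ⟨R.req c.1, by simp [Arrivals.view, h2, h3], h5⟩, h6⟩

/-- The number of downloaded chunks. -/
noncomputable def count (s : Record) : ℕ∞ := {c | s.fin c ≠ ⊤}.encard

/-- If an arrived request is unfinished, then the request with the next departure has arrived. -/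
theorem Record.Valid.arrived_of_unfinished (hR : Repetition L R) (hs : s.Valid L R) {j i : ℕ}
    (hj : count s = j) (hi : (i : ℕ∞) < R.N) (ha : (R.req i).a ≤ s.now)
    (hf : ∀ q, s.fin (i, q) = ⊤) : (R.req j).a ≤ s.now := by
  -- No request has two downloaded chunks, so `j` downloads belong to `j` different requests.
  -- Together with `i` these are `j + 1` arrived requests, one of which has index at least `j`.
  have hinj : InjOn Prod.fst {c | s.fin c ≠ ⊤} := by
    rintro ⟨a, b⟩ hab ⟨a', b'⟩ hab' h
    obtain rfl : a = a' := h
    rw [hs.unique a b b' hab hab']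
  have hcard : (Prod.fst '' {c | s.fin c ≠ ⊤}).encard = j := by rw [hinj.encard_image]; exact hj
  have hni : i ∉ Prod.fst '' {c | s.fin c ≠ ⊤} := by
    rintro ⟨⟨a, b⟩, hab, rfl⟩
    exact hab (hf b)
  have h2 : (insert i (Prod.fst '' {c | s.fin c ≠ ⊤})).encard = (j + 1 : ℕ) := by
    rw [encard_insert_of_notMem hni, hcard]; rfl
  have : ∃ l ∈ insert i (Prod.fst '' {c | s.fin c ≠ ⊤}), j ≤ l := by
    by_contra! hc
    have h3 : insert i (Prod.fst '' {c | s.fin c ≠ ⊤}) ⊆ (Finset.range j : Set ℕ) := by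
      intro l hl; simpa using hc l hl
    have h4 := encard_le_encard h3
    rw [h2, encard_coe_eq_coe_finsetCard, Finset.card_range] at h4
    have := Nat.cast_le.1 h4
    omega
  obtain ⟨l, hl, hjl⟩ := this
  have h5 : (l : ℕ∞) < R.N ∧ (R.req l).a ≤ s.now := by
    rcases hl with rfl | ⟨c, hc, rfl⟩
    · exact ⟨hi, ha⟩
    · have := hs.started c (hs.finished c hc)
      exact ⟨this.2.1, this.2.2.1⟩
  exact (hR.valid.mono j l hjl h5.1).trans h5.2

theorem Record.Valid.arrived_of_busy (hR : Repetition L R) (hs : s.Valid L R) {j : ℕ} {c : Chunk}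
    (hj : count s = j) (hc : busy s c) : (R.req j).a ≤ s.now := by
  have := hs.started c hc.1
  exact hs.arrived_of_unfinished hR hj this.2.1 this.2.2.1 hc.2

/-- If the request `j` has arrived, and at most `j` requests are finished, then some arrived
request is unfinished. -/
theorem Record.Valid.exists_unfinished (hR : Repetition L R) {j : ℕ}
    (hj : count s = j) (hjN : (j : ℕ∞) < R.N) (ha : (R.req j).a ≤ s.now) :
    ∃ i : ℕ, (i : ℕ∞) < R.N ∧ (R.req i).a ≤ s.now ∧ ∀ q, s.fin (i, q) = ⊤ := by
  by_contra! hc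
  have hsub : (Finset.range (j + 1) : Set ℕ) ⊆ Prod.fst '' {c | s.fin c ≠ ⊤} := by
    intro i hi
    have hij : i ≤ j := by simpa [Nat.lt_succ_iff] using hi
    obtain ⟨q, hq⟩ := hc i ((Nat.cast_le.2 hij).trans_lt hjN) ((hR.valid.mono i j hij hjN).trans ha)
    exact ⟨(i, q), hq, rfl⟩
  have h1 := (encard_le_encard hsub).trans (encard_image_le _ _)
  change _ ≤ count s at h1
  rw [hj, encard_coe_eq_coe_finsetCard, Finset.card_range] at h1
  have := Nat.cast_le.1 h1
  omega

end Valid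

/-! ### The two kinds of steps: an accomplishment, or an arrival or start. -/

section Step

variable (L : ℕ) (R : Arrivals) (π : OnlinePolicy)

open Classical in
/-- The time of the next start of a download, if nothing happens before. -/
noncomputable def startTime (s : Record) : ℝ≥0∞ :=
  if Startable L (R.view s.now) s (π.plan (R.view s.now) s).2 then
    s.now + (π.plan (R.view s.now) s).1 else ⊤

/-- The time of the next event, if no download is accomplished before. -/
noncomputable def idleTime (s : Record) : ℝ≥0∞ := min (nextArrival R s) (startTime L R π s)

open Classical in
/-- The record after the next event, if no download is accomplished before. -/
noncomputable def idle (s : Record) : Record :=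
  if nextArrival R s ≤ startTime L R π s then
    if nextArrival R s = ⊤ then s else ⟨(nextArrival R s).toNNReal, s.start, s.fin⟩
  else ⟨(startTime L R π s).toNNReal,
    update s.start (π.plan (R.view s.now) s).2 (startTime L R π s), s.fin⟩

/-- The record after the download of `c` is accomplished at time `t`. -/
def done (s : Record) (c : Chunk) (t : ℝ≥0) : Record := ⟨t, s.start, update s.fin c t⟩

/-- Of the chunks being downloaded, `c` is accomplished first. -/
def First (x : Chunk → ℝ≥0) (s : Record) (c : Chunk) : Prop :=
  busy s c ∧ ∀ c', busy s c' → s.start c + x c < s.start c' + x c' ∨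
    (s.start c + x c = s.start c' + x c' ∧ Encodable.encode c ≤ Encodable.encode c')

variable {L R π} {s : Record} {x : Chunk → ℝ≥0}

theorem First.le {c c' : Chunk} (h : First x s c) (hc' : busy s c') :
    s.start c + x c ≤ s.start c' + x c' := by
  rcases h.2 c' hc' with h | h
  · exact h.le
  · exact h.1.le

theorem First.unique {c c' : Chunk} (h : First x s c) (h' : First x s c') : c = c' := by
  have h1 := h.2 c' h'.1
  have h2 := h'.2 c h.1
  rcases h1 with h1 | h1
  · rcases h2 with h2 | h2
    · exact absurd h1 h2.not_gt
    · exact absurd h2.1 h1.ne'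
  · rcases h2 with h2 | h2
    · exact absurd h1.1 h2.ne'
    · exact Encodable.encode_injective (le_antisymm h1.2 h2.2)

theorem Record.Valid.exists_first (hs : s.Valid L R) (x : Chunk → ℝ≥0) {c₁ : Chunk}
    (hc : busy s c₁) : ∃ c, First x s c := by
  obtain ⟨c, hc, hmin⟩ := hs.finite_busy.exists_minimalFor
    (fun c => toLex (s.start c + x c, Encodable.encode c)) _ ⟨c₁, hc⟩
  refine ⟨c, hc, fun c' hc' => ?_⟩
  rcases le_total (toLex (s.start c + x c, Encodable.encode c))
    (toLex (s.start c' + x c', Encodable.encode c')) with h | h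
  · simpa [Prod.Lex.toLex_le_toLex] using h
  · simpa [Prod.Lex.toLex_le_toLex] using hmin hc' h

theorem isNextDone_iff (hR : Repetition L R) (hs : s.Valid L R) {c : Chunk} :
    IsNextDone x (R.view s.now) s c ↔ First x s c := by
  simp only [IsNextDone, First, inService_iff hR hs]

theorem nextDone_eq (hR : Repetition L R) (hs : s.Valid L R) :
    nextDone x (R.view s.now) s = ⨅ c : Chunk, ⨅ _ : busy s c, s.start c + x c := by
  simp only [nextDone, inService_iff hR hs]

theorem First.nextDone_eq (hR : Repetition L R) (hs : s.Valid L R) {c : Chunk}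
    (h : First x s c) : nextDone x (R.view s.now) s = s.start c + x c := by
  rw [StorageCloud.nextDone_eq hR hs]
  exact le_antisymm (iInf₂_le c h.1) (le_iInf₂ fun c' hc' => h.le hc')

/-- A step in which a download is accomplished. -/
theorem step_of_first (hR : Repetition L R) (hs : s.Valid L R) {c : Chunk} (h : First x s c)
    (hle : s.start c + x c ≤ idleTime L R π s) :
    step L R π x s = done s c (s.start c + x c).toNNReal := by
  have hD := h.nextDone_eq hR hs
  have hfin : s.start c + (x c : ℝ≥0∞) ≠ ⊤ := ENNReal.add_ne_top.2 ⟨h.1.1, ENNReal.coe_ne_top⟩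
  have hT : min (nextArrival R s) (nextDone x (R.view s.now) s) = s.start c + x c := by
    rw [hD]; exact min_eq_right (hle.trans (min_le_left _ _))
  have hS : s.start c + (x c : ℝ≥0∞) ≤ startTime L R π s := hle.trans (min_le_right _ _)
  unfold startTime at hS
  unfold step
  simp only [hT, hS, hfin, if_true, if_false]
  unfold done
  congr 1
  funext c'
  by_cases hcc : c' = c
  · subst hcc
    rw [if_pos ⟨(isNextDone_iff hR hs).2 h, hT.symm⟩, update_self, ENNReal.coe_toNNReal hfin]
  · rw [update_of_ne hcc, if_neg]
    rintro ⟨h1, -⟩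
    exact hcc (((isNextDone_iff hR hs).1 h1).unique h)

/-- A step in which no download is accomplished. -/
theorem step_of_idle (hR : Repetition L R) (hs : s.Valid L R)
    (h : ∀ c, busy s c → idleTime L R π s < s.start c + x c) :
    step L R π x s = idle L R π s := by
  by_cases hb : ∃ c, busy s c
  · obtain ⟨c₁, hc₁⟩ := hb
    obtain ⟨c, hc⟩ := hs.exists_first x hc₁
    have hD := hc.nextDone_eq hR hs
    have hlt := h c hc.1
    have hne : idleTime L R π s ≠ ⊤ := (hlt.trans_le le_top).ne
    unfold step idle
    change (if min (nextArrival R s) (nextDone x (R.view s.now) s) ≤ startTime L R π s then _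
      else _) = _
    rw [hD]
    by_cases hAS : nextArrival R s ≤ startTime L R π s
    · have hidle : idleTime L R π s = nextArrival R s := min_eq_left hAS
      rw [hidle] at hlt hne
      have hmin : min (nextArrival R s) (s.start c + x c) = nextArrival R s := min_eq_left hlt.le
      simp only [hmin, hAS, if_true, hne, if_false]
      congr 1
      funext c'
      rw [if_neg]
      rintro ⟨h1, h2⟩
      rw [((isNextDone_iff hR hs).1 h1).unique hc] at h2
      exact hlt.ne' (h2.trans hmin)
    · have hidle : idleTime L R π s = startTime L R π s := min_eq_right (not_le.1 hAS).le
      rw [hidle] at hlt hne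
      rw [if_neg, if_neg hAS]
      · rfl
      · rw [not_le, lt_min_iff]
        exact ⟨not_le.1 hAS, hlt⟩
  · have hD : nextDone x (R.view s.now) s = ⊤ := by
      rw [nextDone_eq hR hs]
      exact iInf₂_eq_top.2 fun c hc => absurd ⟨c, hc⟩ hb
    unfold step idle
    change (if min (nextArrival R s) (nextDone x (R.view s.now) s) ≤ startTime L R π s then _
      else _) = _
    rw [hD]
    simp only [min_top_right]
    by_cases hAS : nextArrival R s ≤ startTime L R π s
    · simp only [hAS, if_true]
      split_ifs with h1
      · rfl
      · congr 1
        funext c'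
        rw [if_neg]
        rintro ⟨h2, -⟩
        exact hb ⟨c', (isNextDone_iff hR hs).1 h2 |>.1⟩
    · rw [if_neg hAS, if_neg hAS]
      rfl

theorem now_le_idleTime (hR : R.Valid) : (s.now : ℝ≥0∞) ≤ idleTime L R π s := by
  refine le_min (hR.now_lt_nextArrival s).le ?_
  unfold startTime
  split_ifs
  · exact le_self_add
  · exact le_top

theorem idle_of_top (h : idleTime L R π s = ⊤) : idle L R π s = s := by
  have := min_eq_top.1 h
  simp [idle, this.1, this.2]

theorem idle_now (h : idleTime L R π s ≠ ⊤) : ((idle L R π s).now : ℝ≥0∞) = idleTime L R π s := by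
  unfold idle
  by_cases hAS : nextArrival R s ≤ startTime L R π s
  · have : idleTime L R π s = nextArrival R s := min_eq_left hAS
    rw [this] at h
    simp [hAS, h, this]
  · have : idleTime L R π s = startTime L R π s := min_eq_right (not_le.1 hAS).le
    rw [this] at h
    simp [hAS, h, this]

theorem now_le_idle_now (hR : R.Valid) : s.now ≤ (idle L R π s).now := by
  by_cases h : idleTime L R π s = ⊤
  · rw [idle_of_top h]
  · rw [← ENNReal.coe_le_coe, idle_now h]; exact now_le_idleTime hR

theorem idle_fin : (idle L R π s).fin = s.fin := by
  unfold idle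
  split_ifs <;> rfl

/-- The effect of an event without accomplishment on the starts of downloads. -/
theorem idle_start :
    ((idle L R π s).start = s.start ∧ idleTime L R π s = nextArrival R s) ∨
    (∃ c, c = (π.plan (R.view s.now) s).2 ∧ Startable L (R.view s.now) s c ∧
      idleTime L R π s = s.now + (π.plan (R.view s.now) s).1 ∧ idleTime L R π s ≠ ⊤ ∧
      (idle L R π s).start = update s.start c (idleTime L R π s)) := by
  by_cases hAS : nextArrival R s ≤ startTime L R π s
  · left
    refine ⟨?_, min_eq_left hAS⟩
    unfold idle
    rw [if_pos hAS]
    split_ifs <;> rfl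
  · right
    have h1 : idleTime L R π s = startTime L R π s := min_eq_right (not_le.1 hAS).le
    have hne : idleTime L R π s ≠ ⊤ := by rw [h1]; exact ((not_le.1 hAS).trans_le le_top).ne
    have hst : Startable L (R.view s.now) s (π.plan (R.view s.now) s).2 := by
      by_contra hc
      rw [h1] at hne
      simp [startTime, hc] at hne
    refine ⟨_, rfl, hst, ?_, hne, ?_⟩
    · rw [h1, startTime, if_pos hst]
    · unfold idle
      rw [if_neg hAS, h1]

theorem busy_idle_iff (hR : Repetition L R) (hs : s.Valid L R) (c : Chunk) :
    busy (idle L R π s) c ↔ busy s c ∨ (s.start c = ⊤ ∧ (idle L R π s).start c ≠ ⊤) := by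
  unfold busy
  rw [idle_fin]
  rcases idle_start (L := L) (R := R) (π := π) (s := s) with ⟨h, -⟩ | ⟨c₀, -, hc₀, -, hne, h⟩
  · rw [h]; tauto
  · rw [h]
    have hst := (startable_iff hR hs).1 hc₀
    by_cases hc : c = c₀
    · subst hc
      simp [hne, hst.2.2.2.2.2, hst.2.2.2.1]
    · simp only [update_of_ne hc]; tauto

/-- A chunk whose download was started before is not started again. -/
theorem idle_start_of_ne_top (hR : Repetition L R) (hs : s.Valid L R) {c : Chunk}
    (hc : s.start c ≠ ⊤) : (idle L R π s).start c = s.start c := by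
  rcases idle_start (L := L) (R := R) (π := π) (s := s) with ⟨h, -⟩ | ⟨c₀, -, hc₀, -, hne, h⟩
  · rw [h]
  · rw [h, update_of_ne]
    rintro rfl
    exact hc ((startable_iff hR hs).1 hc₀).2.2.2.2.2

theorem idle_start_of_new {c : Chunk}
    (hc : s.start c = ⊤) (hc' : (idle L R π s).start c ≠ ⊤) :
    (idle L R π s).start c = idleTime L R π s ∧ idleTime L R π s ≠ ⊤ ∧
      c = (π.plan (R.view s.now) s).2 ∧ Startable L (R.view s.now) s c := by
  rcases idle_start (L := L) (R := R) (π := π) (s := s) with ⟨h, -⟩ | ⟨c₀, hc₀', hc₀, -, hne, h⟩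
  · rw [h] at hc'; exact absurd hc hc'
  · by_cases hcc : c = c₀
    · subst hcc
      refine ⟨by rw [h]; simp, hne, hc₀', hc₀⟩
    · rw [h, update_of_ne hcc] at hc'
      exact absurd hc hc'

theorem Record.Valid.idle (hR : Repetition L R) (hs : s.Valid L R) :
    (idle L R π s).Valid L R := by
  have hnow := now_le_idle_now (L := L) (π := π) (s := s) hR.valid
  refine ⟨fun c hc => ?_, fun c hc => ?_, ?_, ?_⟩
  · by_cases hsc : s.start c = ⊤
    · obtain ⟨h1, h2, -, h3⟩ := idle_start_of_new hsc hc
      have h4 := (startable_iff hR hs).1 h3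
      rw [h1, idle_now h2]
      exact ⟨le_rfl, h4.2.1, h4.2.2.1.trans hnow, h4.2.2.2.2.1⟩
    · rw [idle_start_of_ne_top hR hs hsc]
      have h4 := hs.started c hsc
      exact ⟨h4.1.trans (ENNReal.coe_le_coe.2 hnow), h4.2.1, h4.2.2.1.trans hnow, h4.2.2.2⟩
  · rw [idle_fin] at hc
    have := hs.finished c hc
    rwa [idle_start_of_ne_top hR hs this]
  · rw [idle_fin]; exact hs.unique
  · simp only [busy_idle_iff hR hs]
    rcases idle_start (L := L) (R := R) (π := π) (s := s) with ⟨h, -⟩ | ⟨c₀, -, hc₀, -, hne, h⟩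
    · rw [h]
      refine (encard_le_encard fun c hc => ?_).trans hs.cap
      exact hc.elim id fun h => absurd h.1 h.2
    · have hst := (startable_iff hR hs).1 hc₀
      have : {c | busy s c ∨ (s.start c = ⊤ ∧ (StorageCloud.idle L R π s).start c ≠ ⊤)}
          ⊆ insert c₀ {c | busy s c} := by
        rintro c (hc | ⟨hc1, hc2⟩)
        · exact Or.inr hc
        · left
          by_contra hcc
          rw [h, update_of_ne hcc] at hc2
          exact hc2 hc1
      refine (encard_le_encard this).trans ((encard_insert_le _ _).trans ?_)
      exact Order.add_one_le_of_lt hst.1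

/-- The accomplishment of `c` completes its request, which takes all its replicas out of service at
once. -/
theorem busy_done_iff (c c' : Chunk) (t : ℝ≥0) :
    busy (done s c t) c' ↔ busy s c' ∧ c'.1 ≠ c.1 := by
  unfold busy done
  simp only
  constructor
  · rintro ⟨h1, h2⟩
    have hne : c'.1 ≠ c.1 := by
      intro h
      have := h2 c.2
      rw [h] at this
      simp at this
    refine ⟨⟨h1, fun q => ?_⟩, hne⟩
    have := h2 q
    rwa [update_of_ne] at this
    rintro rfl; exact hne rfl
  · rintro ⟨⟨h1, h2⟩, hne⟩
    refine ⟨h1, fun q => ?_⟩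
    rw [update_of_ne]
    · exact h2 q
    · rintro rfl; exact hne rfl

theorem Record.Valid.done (hs : s.Valid L R) {c : Chunk} (hc : busy s c) {t : ℝ≥0}
    (ht : s.now ≤ t) : (done s c t).Valid L R := by
  refine ⟨fun c' hc' => ?_, fun c' hc' => ?_, fun i q q' h h' => ?_, ?_⟩
  · have h4 := hs.started c' hc'
    exact ⟨h4.1.trans (ENNReal.coe_le_coe.2 ht), h4.2.1, h4.2.2.1.trans ht, h4.2.2.2⟩
  · by_cases hcc : c' = c
    · rw [hcc]; exact hc.1
    · simp only [StorageCloud.done, update_of_ne hcc] at hc'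
      exact hs.finished c' hc'
  · simp only [StorageCloud.done] at h h'
    by_cases hi : i = c.1
    · subst hi
      have aux : ∀ q, update s.fin c t (c.1, q) ≠ ⊤ → q = c.2 := by
        intro q hq
        by_contra hne
        rw [update_of_ne (fun h => hne (by rw [← h]))] at hq
        exact hq (hc.2 q)
      rw [aux q h, aux q' h']
    · rw [update_of_ne (fun h => hi (by rw [← h]))] at h h'
      exact hs.unique i q q' h h'
  · simp only [busy_done_iff]
    exact (encard_le_encard fun c' hc' => hc'.1).trans hs.cap

theorem count_idle : count (idle L R π s) = count s := by unfold count; rw [idle_fin]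

theorem count_done {c : Chunk} (hc : busy s c) (t : ℝ≥0) : count (done s c t) = count s + 1 := by
  unfold count
  rw [← encard_insert_of_notMem (a := c) (by simpa using hc.2 c.2)]
  congr 1
  ext c'
  by_cases hcc : c' = c
  · subst hcc; simp [done]
  · simp [done, hcc]

/-- `x` is consistent with the past: no chunk under service should be downloaded already. -/
def Consistent (x : Chunk → ℝ≥0) (s : Record) : Prop :=
  ∀ c, busy s c → (s.now : ℝ≥0∞) ≤ s.start c + x c

/-- The two kinds of steps. -/
theorem step_cases (hR : Repetition L R) (hs : s.Valid L R) (x : Chunk → ℝ≥0) :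
    (∃ c, First x s c ∧ s.start c + x c ≤ idleTime L R π s ∧
      step L R π x s = done s c (s.start c + x c).toNNReal) ∨
    ((∀ c, busy s c → idleTime L R π s < s.start c + x c) ∧ step L R π x s = idle L R π s) := by
  by_cases h : ∀ c, busy s c → idleTime L R π s < s.start c + x c
  · exact Or.inr ⟨h, step_of_idle hR hs h⟩
  · push Not at h
    obtain ⟨c₁, hc₁, hle⟩ := h
    obtain ⟨c, hc⟩ := hs.exists_first x hc₁
    have := (hc.le hc₁).trans hle
    exact Or.inl ⟨c, hc, this, step_of_first hR hs hc this⟩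

theorem First.coe_toNNReal {c : Chunk} (h : First x s c) :
    ((s.start c + x c).toNNReal : ℝ≥0∞) = s.start c + x c :=
  ENNReal.coe_toNNReal (ENNReal.add_ne_top.2 ⟨h.1.1, ENNReal.coe_ne_top⟩)

theorem First.now_le {c : Chunk} (h : First x s c) (hx : Consistent x s) :
    s.now ≤ (s.start c + x c).toNNReal := by
  rw [← ENNReal.coe_le_coe, h.coe_toNNReal]
  exact hx c h.1

theorem Record.Valid.step (hR : Repetition L R) (hs : s.Valid L R) (hx : Consistent x s) :
    (step L R π x s).Valid L R := by
  rcases step_cases (π := π) hR hs x with ⟨c, hc, -, h⟩ | ⟨-, h⟩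
  · rw [h]; exact hs.done hc.1 (hc.now_le hx)
  · rw [h]; exact hs.idle hR

theorem Consistent.idle (hR : Repetition L R) (hs : s.Valid L R) (hx : Consistent x s)
    (h : ∀ c, busy s c → idleTime L R π s < s.start c + x c) : Consistent x (idle L R π s) := by
  intro c hc
  by_cases htop : idleTime L R π s = ⊤
  · rw [idle_of_top htop] at hc ⊢; exact hx c hc
  rw [idle_now htop]
  by_cases hsc : s.start c = ⊤
  · rw [(idle_start_of_new hsc hc.1).1]; exact le_self_add
  · rw [idle_start_of_ne_top hR hs hsc]
    refine (h c ?_).le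
    rcases (busy_idle_iff hR hs c).1 hc with h | h
    · exact h
    · exact absurd h.1 hsc

theorem Consistent.done {c : Chunk} (hc : First x s c) :
    Consistent x (done s c (s.start c + x c).toNNReal) := by
  intro c' hc'
  rw [busy_done_iff] at hc'
  change ((s.start c + x c).toNNReal : ℝ≥0∞) ≤ _
  rw [hc.coe_toNNReal]
  exact hc.le hc'.1

theorem Consistent.step (hR : Repetition L R) (hs : s.Valid L R) (hx : Consistent x s) :
    Consistent x (step L R π x s) := by
  rcases step_cases (π := π) hR hs x with ⟨c, hc, -, h⟩ | ⟨h', h⟩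
  · rw [h]; exact Consistent.done hc
  · rw [h]; exact hx.idle hR hs h'

theorem now_le_step (hR : Repetition L R) (hs : s.Valid L R) (hx : Consistent x s) :
    s.now ≤ (step L R π x s).now := by
  rcases step_cases (π := π) hR hs x with ⟨c, hc, -, h⟩ | ⟨h', h⟩
  · rw [h]; exact hc.now_le hx
  · rw [h]; exact now_le_idle_now hR.valid

theorem fin_step_ne_top (hR : Repetition L R) (hs : s.Valid L R) {c : Chunk} (hc : s.fin c ≠ ⊤) :
    (step L R π x s).fin c ≠ ⊤ := by
  rcases step_cases (π := π) hR hs x with ⟨c', -, -, h⟩ | ⟨-, h⟩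
  · rw [h]
    by_cases hcc : c = c'
    · subst hcc; simp [done]
    · simpa [done, update_of_ne hcc] using hc
  · rwa [h, idle_fin]

/-- The record reached after `m` steps from the record `s`. -/
noncomputable def runFrom (L : ℕ) (R : Arrivals) (π : OnlinePolicy) (x : Chunk → ℝ≥0) (s : Record)
    (m : ℕ) : Record := (step L R π x)^[m] s

theorem runFrom_succ (m : ℕ) :
    runFrom L R π x s (m + 1) = runFrom L R π x (step L R π x s) m := rfl

theorem runFrom_succ' (m : ℕ) :
    runFrom L R π x s (m + 1) = step L R π x (runFrom L R π x s m) := iterate_succ_apply' _ _ _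

theorem runFrom_inv (hR : Repetition L R) (hs : s.Valid L R) (hx : Consistent x s) (m : ℕ) :
    (runFrom L R π x s m).Valid L R ∧ Consistent x (runFrom L R π x s m) := by
  induction m with
  | zero => exact ⟨hs, hx⟩
  | succ m ih =>
    rw [runFrom_succ']
    exact ⟨ih.1.step hR ih.2, ih.2.step hR ih.1⟩

theorem runFrom_now_mono (hR : Repetition L R) (hs : s.Valid L R) (hx : Consistent x s) :
    Monotone fun m => (runFrom L R π x s m).now := by
  refine monotone_nat_of_le_succ fun m => ?_
  have := runFrom_inv (π := π) hR hs hx m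
  simp only [runFrom_succ']
  exact now_le_step hR this.1 this.2

theorem runFrom_fin_mono (hR : Repetition L R) (hs : s.Valid L R) (hx : Consistent x s)
    {m n : ℕ} (hmn : m ≤ n) {c : Chunk} (hc : (runFrom L R π x s m).fin c ≠ ⊤) :
    (runFrom L R π x s n).fin c ≠ ⊤ := by
  induction n, hmn using Nat.le_induction with
  | base => exact hc
  | succ n _ ih =>
    rw [runFrom_succ']
    exact fin_step_ne_top hR (runFrom_inv hR hs hx n).1 ih

/-- The time of the `(j + 1)`-st departure, if one starts from the record `s`, in which at most `j`
chunks are downloaded. -/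
noncomputable def depFrom (L : ℕ) (R : Arrivals) (π : OnlinePolicy) (x : Chunk → ℝ≥0) (s : Record)
    (j : ℕ) : ℝ≥0∞ :=
  ⨅ m : ℕ, ⨅ _ : ((j + 1 : ℕ) : ℕ∞) ≤ count (runFrom L R π x s m),
    ((runFrom L R π x s m).now : ℝ≥0∞)

theorem departure_eq (j : ℕ) : departure L R π x j = depFrom L R π x Record.init j := rfl

theorem not_succ_le_count {i j : ℕ} (hj : count s = j) (hi : j ≤ i) :
    ¬ ((i + 1 : ℕ) : ℕ∞) ≤ count s := by
  rw [hj, Nat.cast_le]; omega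

/-- The present record shows only `j` downloads, so it does not contribute to the infimum. -/
theorem depFrom_step {i j : ℕ} (hj : count s = j) (hi : j ≤ i) :
    depFrom L R π x s i = depFrom L R π x (step L R π x s) i := by
  refine le_antisymm (le_iInf₂ fun m hm => iInf₂_le (m + 1) hm) (le_iInf₂ fun m hm => ?_)
  cases m with
  | zero => exact absurd hm (not_succ_le_count hj hi)
  | succ m => exact iInf₂_le m hm

theorem now_le_depFrom (hR : Repetition L R) (hs : s.Valid L R) (hx : Consistent x s) (i : ℕ) :
    (s.now : ℝ≥0∞) ≤ depFrom L R π x s i :=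
  le_iInf₂ fun m _ => ENNReal.coe_le_coe.2 (runFrom_now_mono hR hs hx (Nat.zero_le m))

theorem depFrom_of_le_count (hR : Repetition L R) (hs : s.Valid L R) (hx : Consistent x s) {i : ℕ}
    (hi : ((i + 1 : ℕ) : ℕ∞) ≤ count s) : depFrom L R π x s i = s.now :=
  le_antisymm (iInf₂_le 0 hi) (now_le_depFrom hR hs hx i)

theorem depFrom_of_first (hR : Repetition L R) (hs : s.Valid L R) (hx : Consistent x s) {j : ℕ}
    (hj : count s = j) {c : Chunk} (hc : First x s c) (hle : s.start c + x c ≤ idleTime L R π s) :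
    depFrom L R π x s j = s.start c + x c := by
  rw [depFrom_step hj le_rfl, step_of_first hR hs hc hle,
    depFrom_of_le_count hR (hs.done hc.1 (hc.now_le hx)) (Consistent.done hc)]
  · exact hc.coe_toNNReal
  · rw [count_done hc.1, hj]; simp

theorem depFrom_of_idle (hR : Repetition L R) (hs : s.Valid L R) {i j : ℕ} (hj : count s = j)
    (hi : j ≤ i) (h : ∀ c, busy s c → idleTime L R π s < s.start c + x c) :
    depFrom L R π x s i = depFrom L R π x (idle L R π s) i := by
  rw [depFrom_step hj hi, step_of_idle hR hs h]

end Step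

/-! ### The events before the next departure. -/

section Potential

variable {L : ℕ} {R : Arrivals} {π : OnlinePolicy} {s : Record} {x : Chunk → ℝ≥0}

/-- A bound on the number of events until time `u`, if no download is accomplished. -/
noncomputable def potential (L : ℕ) (R : Arrivals) (u : ℝ≥0) (s : Record) : ℕ :=
  {i : ℕ | (i : ℕ∞) < R.N ∧ s.now < (R.req i).a ∧ (R.req i).a ≤ u}.ncard +
    (L - {c | busy s c}.ncard)

/-- An arrival removes a request from the window up to `u`, and a start occupies one more of the `L`
threads; without an accomplishment no thread is released. -/
theorem potential_idle_lt (hR : Repetition L R) (hs : s.Valid L R) {u : ℝ≥0}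
    (hu : idleTime L R π s ≤ u) : potential L R u (idle L R π s) < potential L R u s := by
  have hne : idleTime L R π s ≠ ⊤ := (hu.trans_lt ENNReal.coe_lt_top).ne
  have hnow := now_le_idle_now (L := L) (π := π) (s := s) hR.valid
  have hsub : {i : ℕ | (i : ℕ∞) < R.N ∧ (idle L R π s).now < (R.req i).a ∧ (R.req i).a ≤ u} ⊆
      {i : ℕ | (i : ℕ∞) < R.N ∧ s.now < (R.req i).a ∧ (R.req i).a ≤ u} :=
    fun i hi => ⟨hi.1, hnow.trans_lt hi.2.1, hi.2.2⟩
  have hfin := hR.valid.finite_window s.now u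
  unfold potential
  rcases idle_start (L := L) (R := R) (π := π) (s := s) with ⟨h, hE⟩ | ⟨c₀, -, hc₀, -, -, h⟩
  · have hb : {c | busy (idle L R π s) c} = {c | busy s c} := by
      ext c; simp only [mem_ofPred_eq, busy, h, idle_fin]
    rw [hb]
    refine Nat.add_lt_add_right (ncard_lt_ncard (ssubset_iff_subset_ne.2 ⟨hsub, fun he => ?_⟩) hfin) _
    rw [hE] at hne hu
    obtain ⟨i, hi, hi', hi''⟩ := hR.valid.nextArrival_spec s hne
    have hmem : i ∈ {i : ℕ | (i : ℕ∞) < R.N ∧ s.now < (R.req i).a ∧ (R.req i).a ≤ u} :=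
      ⟨hi, hi', by rw [hi''] at hu; exact ENNReal.coe_le_coe.1 hu⟩
    rw [← he] at hmem
    have h1 := hmem.2.1
    have h2 := idle_now (L := L) (R := R) (π := π) (s := s) (by rw [hE]; exact hne)
    rw [hE, hi'', ENNReal.coe_inj] at h2
    exact h1.ne h2
  · have hst := (startable_iff hR hs).1 hc₀
    have hb : {c | busy (idle L R π s) c} = insert c₀ {c | busy s c} := by
      ext c
      simp only [mem_ofPred_eq, busy_idle_iff hR hs, mem_insert_iff, h]
      by_cases hc : c = c₀
      · subst hc; simp [hst.2.2.2.2.2, hne]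
      · simp only [update_of_ne hc, hc, false_or]
        exact ⟨fun h => h.elim id fun h => absurd h.1 h.2, Or.inl⟩
    have hnb : c₀ ∉ {c | busy s c} := fun hc => hc.1 hst.2.2.2.2.2
    have h1 := ncard_le_ncard hsub hfin
    rw [hb, ncard_insert_of_notMem hnb hs.finite_busy]
    have h2 := hst.1
    rw [← hs.finite_busy.cast_ncard_eq, Nat.cast_lt] at h2
    omega

/-- A download under service bounds the time of the next departure. -/
theorem depFrom_le_of_busy (hR : Repetition L R) {j : ℕ} {c : Chunk} {u : ℝ≥0} (n : ℕ) :
    ∀ s : Record, potential L R u s = n → s.Valid L R → Consistent x s → count s = j → busy s c →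
      s.start c + x c = u → depFrom L R π x s j ≤ u := by
  induction n using Nat.strong_induction_on with
  | _ n ih =>
    intro s hn hs hx hj hc hu
    rcases step_cases (π := π) hR hs x with ⟨c', hc', hle, -⟩ | ⟨h, -⟩
    · rw [depFrom_of_first hR hs hx hj hc' hle, ← hu]
      exact hc'.le hc
    · rw [depFrom_of_idle hR hs hj le_rfl h]
      have hlt : idleTime L R π s ≤ u := by rw [← hu]; exact (h c hc).le
      refine ih _ (hn ▸ potential_idle_lt hR hs hlt) _ rfl (hs.idle hR) (hx.idle hR hs h)
        (by rw [count_idle, hj]) ?_ ?_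
      · exact (busy_idle_iff hR hs c).2 (Or.inl hc)
      · rw [idle_start_of_ne_top hR hs hc.1, hu]

theorem runFrom_of_fixed (h : step L R π x s = s) (m : ℕ) : runFrom L R π x s m = s := by
  induction m with
  | zero => rfl
  | succ m ih => rw [runFrom_succ, h, ih]

/-- At most `L` chunks, namely those under service, and others that will be started at times not
before the arrival of the next request, can cause the next departure until time `u`. -/
theorem exists_cover (hR : Repetition L R) {j : ℕ} {u : ℝ≥0} (n : ℕ) :
    ∀ s : Record, potential L R u s = n → s.Valid L R → count s = j →
      ∃ (C : Finset Chunk) (θ : Chunk → ℝ≥0∞), C.card ≤ L ∧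
        (∀ c, busy s c → c ∈ C ∧ θ c = s.start c) ∧
        (∀ c ∈ C, ¬ busy s c → s.start c = ⊤ ∧ s.now ≤ θ c ∧ (R.req j).a ≤ θ c) ∧
        ∀ x, Consistent x s → (∀ c ∈ C, (u : ℝ≥0∞) < θ c + x c) →
          (u : ℝ≥0∞) < depFrom L R π x s j := by
  induction n using Nat.strong_induction_on with
  | _ n ih =>
    intro s hn hs hj
    -- As long as nothing is accomplished, the evolution does not depend on `x`. It can therefore be
    -- followed up to time `u` once and for all, and `C`, `θ` are fixed before `x`. If the next
    -- event comes after `u`, the chunks now under service suffice.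
    rcases le_or_gt (idleTime L R π s) u with hu | hu
    · have hne : idleTime L R π s ≠ ⊤ := (hu.trans_lt ENNReal.coe_lt_top).ne
      obtain ⟨C, θ, hC, hb, hnb, hx⟩ := ih _ (hn ▸ potential_idle_lt hR hs hu) (idle L R π s) rfl
        (hs.idle hR) (by rw [count_idle, hj])
      refine ⟨C, θ, hC, fun c hc => ?_, fun c hcC hc => ?_, fun x hxs h => ?_⟩
      · have := hb c ((busy_idle_iff hR hs c).2 (Or.inl hc))
        rwa [idle_start_of_ne_top hR hs hc.1] at this
      -- Here `c` is the chunk just started: `θ c` is the time of the event, and its request is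
      -- unfinished and has arrived, so the request `j` has arrived too.
      · by_cases hbi : busy (idle L R π s) c
        · have h1 : s.start c = ⊤ := by
            rcases (busy_idle_iff hR hs c).1 hbi with h | h
            · exact absurd h hc
            · exact h.1
          have h2 := idle_start_of_new h1 hbi.1
          have h3 := (startable_iff hR hs).1 h2.2.2.2
          rw [(hb c hbi).2, h2.1]
          have h4 := hs.arrived_of_unfinished hR hj h3.2.1 h3.2.2.1 h3.2.2.2.1
          have h5 := now_le_idleTime (L := L) (π := π) (s := s) hR.valid
          exact ⟨h1, h5, (ENNReal.coe_le_coe.2 h4).trans h5⟩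
        · have := hnb c hcC hbi
          refine ⟨?_, ?_, this.2.2⟩
          · by_contra h1
            rw [idle_start_of_ne_top hR hs h1] at this
            exact h1 this.1
          · exact (ENNReal.coe_le_coe.2 (now_le_idle_now (L := L) (π := π) (s := s) hR.valid)).trans
              this.2.1
      · have hidle : ∀ c, busy s c → idleTime L R π s < s.start c + x c := by
          intro c hc
          have h1 := hb c ((busy_idle_iff hR hs c).2 (Or.inl hc))
          rw [idle_start_of_ne_top hR hs hc.1] at h1
          have h2 := h c h1.1
          rw [h1.2] at h2
          exact hu.trans_lt h2
        rw [depFrom_of_idle hR hs hj le_rfl hidle]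
        exact hx x (hxs.idle hR hs hidle) h
    · refine ⟨hs.finite_busy.toFinset, s.start, ?_, fun c hc => ⟨by simpa using hc, rfl⟩,
        fun c hcC hc => absurd (by simpa using hcC) hc, fun x hxs h => ?_⟩
      · have := hs.cap
        rw [hs.finite_busy.encard_eq_coe_toFinset_card] at this
        exact Nat.cast_le.1 this
      · have h' : ∀ c, busy s c → (u : ℝ≥0∞) < s.start c + x c := fun c hc => h c (by simpa using hc)
        rcases step_cases (π := π) hR hs x with ⟨c', hc', hle, -⟩ | ⟨hi, hstep⟩
        · rw [depFrom_of_first hR hs hxs hj hc' hle]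
          exact h' c' hc'.1
        -- With an infinite idle time the record is a fixed point of the step, and no departure ever
        -- happens.
        · by_cases hne : idleTime L R π s = ⊤
          · rw [idle_of_top hne] at hstep
            have : depFrom L R π x s j = ⊤ := by
              refine iInf₂_eq_top.2 fun m hm => ?_
              rw [runFrom_of_fixed hstep] at hm
              exact absurd hm (not_succ_le_count hj le_rfl)
            rw [this]; exact ENNReal.coe_lt_top
          · rw [depFrom_of_idle hR hs hj le_rfl hi]
            refine lt_of_lt_of_le ?_ (now_le_depFrom hR (hs.idle hR) (hxs.idle hR hs hi) j)
            rwa [idle_now hne]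

end Potential

/-! ### SEDPT-R assigns all threads to a single request. -/

section Greedy

variable {L : ℕ} {R : Arrivals} {σ : OnlinePolicy} {s : Record} {x : Chunk → ℝ≥0}

/-- `IsSEDPTR` constrains the policy only on views with finitely many known requests. -/
theorem finite_view (hR : R.Valid) (t : ℝ≥0) : {i | R.view t i ≠ none}.Finite := by
  refine (hR.finite_arrived t).subset fun i hi => ?_
  by_contra hc
  exact hi (if_neg hc)

/-- Otherwise the first `L` replicas of request `i` would all be under service, and no thread would
be idle. This is where the minimum distance enters. -/
theorem exists_startable (hR : Repetition L R) (hs : s.Valid L R)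
    (hb : {c | busy s c}.encard < L) {i : ℕ} (hi : (i : ℕ∞) < R.N) (ha : (R.req i).a ≤ s.now)
    (hf : ∀ q, s.fin (i, q) = ⊤) : ∃ q, Startable L (R.view s.now) s (i, q) := by
  by_contra! hc
  have hall : ∀ q, q < L → busy s (i, q) := by
    intro q hq
    refine ⟨fun htop => hc q ?_, hf⟩
    exact (startable_iff hR hs).2 ⟨hb, hi, ha, hf, hq.trans_le (hR.le_n i hi), htop⟩
  have hsub : Prod.mk i '' (Finset.range L : Set ℕ) ⊆ {c | busy s c} := by
    rintro _ ⟨q, hq, rfl⟩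
    exact hall q (by simpa using hq)
  have h1 := encard_le_encard hsub
  rw [(Prod.mk_right_injective i).encard_image, encard_coe_eq_coe_finsetCard,
    Finset.card_range] at h1
  exact absurd (h1.trans_lt hb) (lt_irrefl _)

/-- The value `1` here, against at most `0` in the next lemma, is all that the selection rule of
SEDPT-R contributes. -/
theorem differential_of_not_busy (hR : Repetition L R) (hs : s.Valid L R) {i : ℕ}
    (hi : (i : ℕ∞) < R.N) (ha : (R.req i).a ≤ s.now) (hf : ∀ q, s.fin (i, q) = ⊤)
    (hb : ∀ q, ¬ busy s (i, q)) : differential (R.view s.now) s i = 1 := by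
  have hv : R.view s.now i = some (R.req i) := if_pos ⟨hi, ha⟩
  have hd : downloaded s i (R.req i) = 0 := by simp [downloaded, hf]
  unfold differential
  simp [hv, hd, hR.k_eq i hi, inService_iff hR hs, hb]

theorem differential_of_busy (hR : Repetition L R) (hs : s.Valid L R) {c : Chunk}
    (hb : busy s c) : differential (R.view s.now) s c.1 ≤ 0 := by
  have h1 := hs.started c hb.1
  have hv : R.view s.now c.1 = some (R.req c.1) := if_pos ⟨h1.2.1, h1.2.2.1⟩
  have hd : downloaded s c.1 (R.req c.1) = 0 := by simp [downloaded, hb.2]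
  unfold differential
  simp only [hv, hd, hR.k_eq _ h1.2.1, Nat.cast_one, Nat.cast_zero, sub_zero, sub_nonpos,
    Nat.one_le_cast]
  refine Finset.card_pos.2 ⟨c.2, ?_⟩
  simp only [Finset.mem_filter, Finset.mem_range]
  exact ⟨h1.2.2.2, (inService_iff hR hs).2 hb⟩

/-- All chunks under service are replicas of the same file. -/
def OneRequest (s : Record) : Prop := ∀ c c', busy s c → busy s c' → c.1 = c'.1

/-- While a thread is idle, the request under service still has a startable replica, and its `α - δ
≤ 0` beats the `1` of every other request. -/
theorem sedptr_plan_eq (hR : Repetition L R) (hσ : IsSEDPTR L σ) (hs : s.Valid L R)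
    (h1 : OneRequest s) {c : Chunk} (hc : busy s c)
    (hst : Startable L (R.view s.now) s (σ.plan (R.view s.now) s).2) :
    (σ.plan (R.view s.now) s).2.1 = c.1 := by
  have hst' := (startable_iff hR hs).1 hst
  have hsc := hs.started c hc.1
  obtain ⟨q, hq⟩ := exists_startable hR hs hst'.1 hsc.2.1 hsc.2.2.1 hc.2
  by_contra hne
  have h2 := (hσ (R.view s.now) s (finite_view hR.valid _) ⟨_, hst⟩).2.2 _ hq
  have h3 := differential_of_busy hR hs hc
  rw [differential_of_not_busy hR hs hst'.2.1 hst'.2.2.1 hst'.2.2.2.1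
    (fun q' hq' => hne (h1 (_, q') c hq' hc))] at h2
  exact absurd (h2.trans h3) (by norm_num)

theorem OneRequest.idle (hR : Repetition L R) (hσ : IsSEDPTR L σ) (hs : s.Valid L R)
    (h1 : OneRequest s) : OneRequest (idle L R σ s) := by
  have key : ∀ c c', busy s c → busy (StorageCloud.idle L R σ s) c' → c.1 = c'.1 := by
    intro c c' hc hc'
    rcases (busy_idle_iff hR hs c').1 hc' with h | h
    · exact h1 c c' hc h
    · obtain ⟨-, -, h2, h3⟩ := idle_start_of_new h.1 h.2
      have := sedptr_plan_eq hR hσ hs h1 hc (h2 ▸ h3)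
      rw [h2, this]
  intro c c' hc hc'
  rcases (busy_idle_iff hR hs c).1 hc with h | h
  · exact key c c' h hc'
  · rcases (busy_idle_iff hR hs c').1 hc' with h' | h'
    · exact (key c' c h' hc).symm
    · rw [(idle_start_of_new h.1 h.2).2.2.1, (idle_start_of_new h'.1 h'.2).2.2.1]

/-- All threads are free after a departure, so no partially served download is carried over. -/
theorem OneRequest.not_busy_done (h1 : OneRequest s) {c : Chunk} (hc : busy s c) (t : ℝ≥0)
    (c' : Chunk) : ¬ busy (done s c t) c' := by
  rw [busy_done_iff]
  exact fun h => h.2 (h1 _ _ h.1 hc)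

/-- Once an arrived request is unfinished, SEDPT-R assigns all threads to one request, at once. -/
theorem sedptr_cover_of_arrived (hR : Repetition L R) (hσ : IsSEDPTR L σ) {j i : ℕ} (n : ℕ) :
    ∀ s : Record, L - {c | busy s c}.ncard = n → s.Valid L R → OneRequest s → count s = j →
      (∀ c, busy s c → s.start c = s.now) → (i : ℕ∞) < R.N → (R.req i).a ≤ s.now →
      (∀ q, s.fin (i, q) = ⊤) →
      ∃ C : Finset Chunk, C.card = L ∧ (∀ c, busy s c → c ∈ C) ∧
        (∀ c ∈ C, ¬ busy s c → s.start c = ⊤) ∧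
        ∀ x, Consistent x s → ∀ c ∈ C, depFrom L R σ x s j ≤ s.now + x c := by
  induction n with
  | zero =>
    -- The induction runs over the number of idle threads. If there is none, the `L` chunks under
    -- service, all started at the present moment, form the cover.
    intro s hn hs h1 hj hb _ _ _
    have hcap := hs.cap
    rw [← hs.finite_busy.cast_ncard_eq, Nat.cast_le] at hcap
    refine ⟨hs.finite_busy.toFinset, ?_, fun c hc => by simpa using hc,
      fun c hcC hc => absurd (by simpa using hcC) hc, fun x hx c hc => ?_⟩
    · rw [← ncard_eq_toFinset_card _ hs.finite_busy]; omega
    · have hc' : busy s c := by simpa using hc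
      have := depFrom_le_of_busy (π := σ) (x := x) (u := s.now + x c) hR _ s rfl hs hx hj hc'
        (by rw [hb c hc']; push_cast; rfl)
      simpa using this
  | succ n ih =>
    intro s hn hs h1 hj hb hi ha hf
    have hlt : {c | busy s c}.encard < L := by
      rw [← hs.finite_busy.cast_ncard_eq, Nat.cast_lt]; omega
    obtain ⟨q, hq⟩ := exists_startable hR hs hlt hi ha hf
    obtain ⟨hz, hst, -⟩ := hσ (R.view s.now) s (finite_view hR.valid _) ⟨_, hq⟩
    -- The start takes no time, so the clock stands still while the threads are being assigned.
    have hS : startTime L R σ s = s.now := by rw [startTime, if_pos hst, hz, add_zero]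
    have hA := hR.valid.now_lt_nextArrival s
    have hE : idleTime L R σ s = s.now := by
      rw [idleTime, hS]; exact min_eq_right hA.le
    have hEt : idleTime L R σ s ≠ ⊤ := by rw [hE]; exact ENNReal.coe_ne_top
    have hnow : (StorageCloud.idle L R σ s).now = s.now := by
      have := idle_now hEt
      rwa [hE, ENNReal.coe_inj] at this
    set c₀ := (σ.plan (R.view s.now) s).2 with hc₀
    have hstart : (StorageCloud.idle L R σ s).start = update s.start c₀ s.now := by
      unfold StorageCloud.idle
      rw [if_neg (by rw [hS]; exact hA.not_ge), hS]
    have hst' := (startable_iff hR hs).1 hst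
    have hbusy : {c | busy (StorageCloud.idle L R σ s) c} = insert c₀ {c | busy s c} := by
      ext c
      simp only [mem_ofPred_eq, busy_idle_iff hR hs, mem_insert_iff, hstart]
      by_cases hc : c = c₀
      · subst hc; simp [hst'.2.2.2.2.2]
      · simp only [update_of_ne hc, hc, false_or]
        exact ⟨fun h => h.elim id fun h => absurd h.1 h.2, Or.inl⟩
    have hnb : c₀ ∉ {c | busy s c} := fun hc => hc.1 hst'.2.2.2.2.2
    obtain ⟨C, hC, hCb, hCn, hx⟩ := ih (StorageCloud.idle L R σ s) (by
        rw [hbusy, ncard_insert_of_notMem hnb hs.finite_busy]; omega)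
      (hs.idle hR) (h1.idle hR hσ hs) (by rw [count_idle, hj]) (fun c hc => by
        rw [hnow]
        rcases (busy_idle_iff hR hs c).1 hc with h | h
        · rw [idle_start_of_ne_top hR hs h.1, hb c h]
        · rw [(idle_start_of_new h.1 h.2).1, hE]) hi (by rwa [hnow]) (by rwa [idle_fin])
    refine ⟨C, hC, fun c hc => hCb c ((busy_idle_iff hR hs c).2 (Or.inl hc)),
      fun c hcC hc => ?_, fun x hxs c hcC => ?_⟩
    · by_cases hc0 : c = c₀
      · rw [hc0]; exact hst'.2.2.2.2.2
      · have hc' : ¬ busy (StorageCloud.idle L R σ s) c := by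
          intro h
          have : c ∈ insert c₀ {c | busy s c} := hbusy ▸ h
          exact this.elim hc0 hc
        have := hCn c hcC hc'
        rwa [hstart, update_of_ne hc0] at this
    -- A download of length `0` may be accomplished before all threads are assigned; the departure
    -- then takes place at the present moment, within the bound.
    · rcases step_cases (π := σ) hR hs x with ⟨c', hc', hle, -⟩ | ⟨h, -⟩
      · rw [depFrom_of_first hR hs hxs hj hc' hle]
        rw [hE] at hle
        exact hle.trans le_self_add
      · rw [depFrom_of_idle hR hs hj le_rfl h]
        have := hx x (hxs.idle hR hs h) c hcC
        rwa [hnow] at this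

/-- Under SEDPT-R with no download under service, the next departure takes place as soon as the
first of `L` new downloads, all started when the next request has arrived, is accomplished. -/
theorem sedptr_cover (hR : Repetition L R) (hσ : IsSEDPTR L σ) (hs : s.Valid L R)
    (hb : ∀ c, ¬ busy s c) {j : ℕ} (hj : count s = j) (hjN : (j : ℕ∞) < R.N) :
    ∃ C : Finset Chunk, C.card = L ∧ (∀ c ∈ C, s.start c = ⊤) ∧
      ∀ x, ∀ c ∈ C, depFrom L R σ x s j ≤ max (s.now : ℝ≥0∞) (R.req j).a + x c := by
  have h1 : OneRequest s := fun c c' hc => absurd hc (hb c)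
  have hx : ∀ x, Consistent x s := fun x c hc => absurd hc (hb c)
  rcases le_or_gt (R.req j).a s.now with ha | ha
  · obtain ⟨i, hi, hia, hf⟩ := Record.Valid.exists_unfinished hR hj hjN ha
    obtain ⟨C, hC, -, hCn, hCx⟩ := sedptr_cover_of_arrived hR hσ _ s rfl hs h1 hj
      (fun c hc => absurd hc (hb c)) hi hia hf
    refine ⟨C, hC, fun c hc => hCn c hc (hb c), fun x c hc => ?_⟩
    rw [max_eq_left (ENNReal.coe_le_coe.2 ha)]
    exact hCx x (hx x) c hc
  -- Every arrived request is finished, since an unfinished one would force request `j` to have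
  -- arrived. The system thus waits for the next arrival, which has to be that of request `j`.
  · have hns : ¬ Startable L (R.view s.now) s (σ.plan (R.view s.now) s).2 := by
      intro h
      have h' := (startable_iff hR hs).1 h
      exact absurd (hs.arrived_of_unfinished hR hj h'.2.1 h'.2.2.1 h'.2.2.2.1) ha.not_ge
    have hE : idleTime L R σ s = nextArrival R s := by
      rw [idleTime, startTime, if_neg hns, min_top_right]
    have hEt : nextArrival R s ≠ ⊤ :=
      ((iInf₂_le j ⟨hjN, ha⟩ : nextArrival R s ≤ _).trans_lt ENNReal.coe_lt_top).ne
    have hEj : nextArrival R s = (R.req j).a := by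
      refine le_antisymm (iInf₂_le j ⟨hjN, ha⟩) ?_
      obtain ⟨i, hi, hia, he⟩ := hR.valid.nextArrival_spec s hEt
      rw [he, ENNReal.coe_le_coe]
      by_contra hlt
      rw [not_le] at hlt
      -- If an earlier arrival `i` were still to come, the `j` finished requests would all have
      -- indices below `i`, whence `j ≤ i`.
      have hij : i < j := by
        by_contra hc
        exact absurd (hR.valid.mono j i (not_lt.1 hc) hi) hlt.not_ge
      have hsub : Prod.fst '' {c | s.fin c ≠ ⊤} ⊆ (Finset.range i : Set ℕ) := by
        rintro _ ⟨c, hc, rfl⟩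
        have h2 := hs.started c (hs.finished c hc)
        simp only [Finset.coe_range, mem_Iio]
        by_contra hc'
        exact absurd ((hR.valid.mono i c.1 (not_lt.1 hc') h2.2.1).trans h2.2.2.1) hia.not_ge
      have hinj : InjOn Prod.fst {c | s.fin c ≠ ⊤} := by
        rintro ⟨a, b⟩ hab ⟨a', b'⟩ hab' h
        obtain rfl : a = a' := h
        rw [hs.unique a b b' hab hab']
      have h3 := encard_le_encard hsub
      rw [hinj.encard_image, encard_coe_eq_coe_finsetCard, Finset.card_range] at h3
      change count s ≤ _ at h3
      rw [hj, Nat.cast_le] at h3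
      omega
    have hnow : (StorageCloud.idle L R σ s).now = (R.req j).a := by
      have := idle_now (L := L) (R := R) (π := σ) (s := s) (by rwa [hE])
      rwa [hE, hEj, ENNReal.coe_inj] at this
    have hnb : ∀ c, ¬ busy (StorageCloud.idle L R σ s) c := by
      intro c hc
      rcases (busy_idle_iff hR hs c).1 hc with h | h
      · exact hb c h
      · have := idle_start_of_new h.1 h.2
        exact hns (this.2.2.1 ▸ this.2.2.2)
    have hs' := hs.idle (π := σ) hR
    have hj' : count (StorageCloud.idle L R σ s) = j := by rw [count_idle, hj]
    obtain ⟨i, hi, hia, hf⟩ := Record.Valid.exists_unfinished hR hj' hjN hnow.ge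
    obtain ⟨C, hC, -, hCn, hCx⟩ := sedptr_cover_of_arrived hR hσ _ _ rfl hs'
      (h1.idle hR hσ hs) hj' (fun c hc => absurd hc (hnb c)) hi hia hf
    refine ⟨C, hC, fun c hc => ?_, fun x c hc => ?_⟩
    · by_contra h
      have := hCn c hc (hnb c)
      rw [idle_start_of_ne_top hR hs h] at this
      exact h this
    · rw [depFrom_of_idle hR hs hj le_rfl fun c hc => absurd hc (hb c),
        max_eq_right (ENNReal.coe_le_coe.2 ha.le)]
      have := hCx x (fun c hc => absurd hc (hnb c)) c hc
      rwa [hnow] at this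

end Greedy

/-! ### Measurability of runs, departures and completions. -/

section Measurability

theorem Record.measurable_iff {α : Type*} [MeasurableSpace α] {f : α → Record} :
    Measurable f ↔ Measurable (fun a => (f a).now) ∧ (∀ c, Measurable fun a => (f a).start c) ∧
      ∀ c, Measurable fun a => (f a).fin c := by
  rw [show Measurable f ↔ Measurable ((fun s : Record => (s.now, s.start, s.fin)) ∘ f) from
    measurable_comap_iff]
  exact ⟨fun h => ⟨h.fst, measurable_pi_iff.1 h.snd.fst, measurable_pi_iff.1 h.snd.snd⟩,
    fun h => h.1.prodMk ((measurable_pi_iff.2 h.2.1).prodMk (measurable_pi_iff.2 h.2.2))⟩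

variable {L : ℕ} {R : Arrivals} {π : OnlinePolicy}

theorem Record.measurable_now : Measurable fun s : Record => s.now :=
  (Record.measurable_iff.1 measurable_id).1

theorem Record.measurable_start (c : Chunk) : Measurable fun s : Record => s.start c :=
  (Record.measurable_iff.1 measurable_id).2.1 c

theorem Record.measurable_fin (c : Chunk) : Measurable fun s : Record => s.fin c :=
  (Record.measurable_iff.1 measurable_id).2.2 c

theorem measurableSet_start_ne_top (c : Chunk) : MeasurableSet {s : Record | s.start c ≠ ⊤} :=
  (Record.measurable_start c) (measurableSet_singleton _).compl

theorem measurableSet_fin_ne_top (c : Chunk) : MeasurableSet {s : Record | s.fin c ≠ ⊤} :=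
  (Record.measurable_fin c) (measurableSet_singleton _).compl

theorem measurable_downloaded (i : ℕ) (r : Request) :
    Measurable fun s : Record => downloaded s i r := by
  classical
  have : (fun s : Record => downloaded s i r)
      = fun s => ∑ q ∈ Finset.range r.n, if s.fin (i, q) ≠ ⊤ then 1 else 0 := by
    ext s
    unfold downloaded
    rw [Finset.card_filter]
  rw [this]
  refine Finset.measurable_sum _ fun q _ => ?_
  exact Measurable.ite (measurableSet_fin_ne_top _) measurable_const measurable_const

theorem measurableSet_unfinished (v : View) (i : ℕ) : MeasurableSet {s | Unfinished v s i} := by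
  cases h : v i with
  | none => simp [Unfinished, h]
  | some r =>
    simp only [Unfinished, h, Option.some.injEq, exists_eq_left']
    exact measurableSet_lt (measurable_downloaded i r) measurable_const

theorem measurableSet_inService (v : View) (c : Chunk) : MeasurableSet {s | InService v s c} :=
  (measurableSet_unfinished v c.1).inter
    ((measurableSet_start_ne_top c).inter ((Record.measurable_fin c) (measurableSet_singleton _)))

theorem measurableSet_le_encard {α ι : Type*} [MeasurableSpace α] [Countable ι]
    {p : α → ι → Prop} (hp : ∀ c, MeasurableSet {a | p a c}) (n : ℕ) :
    MeasurableSet {a | (n : ℕ∞) ≤ {c | p a c}.encard} := by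
  have : {a | (n : ℕ∞) ≤ {c | p a c}.encard}
      = ⋃ F : {F : Finset ι // F.card = n}, ⋂ c : F.1, {a | p a c} := by
    ext a
    simp only [mem_ofPred_eq, mem_iUnion, mem_iInter]
    constructor
    · intro h
      obtain ⟨t, ht, hc⟩ := exists_subset_encard_eq h
      have htf : t.Finite := finite_of_encard_eq_coe hc
      rw [htf.encard_eq_coe_toFinset_card] at hc
      exact ⟨⟨htf.toFinset, Nat.cast_injective hc⟩, fun c => ht (htf.mem_toFinset.1 c.2)⟩
    · rintro ⟨⟨F, hF⟩, h⟩
      have : (F : Set ι) ⊆ {c | p a c} := fun c hc => h ⟨c, hc⟩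
      have := encard_le_encard this
      rwa [encard_coe_eq_coe_finsetCard, hF] at this
  rw [this]
  exact MeasurableSet.iUnion fun F => MeasurableSet.iInter fun c => hp _

theorem measurableSet_startable (v : View) (c : Chunk) :
    MeasurableSet {s | Startable L v s c} := by
  have h1 : MeasurableSet {s : Record | {c' | InService v s c'}.encard < L} := by
    have := (measurableSet_le_encard (measurableSet_inService v) L).compl
    convert this using 1
    ext s
    simp
  have h2 : MeasurableSet {s : Record | ∃ r, v c.1 = some r ∧ c.2 < r.n} := .const _
  exact h1.inter ((measurableSet_unfinished v c.1).inter
    (h2.inter ((Record.measurable_start c) (measurableSet_singleton _))))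

theorem measurableSet_startable_plan (v : View) :
    MeasurableSet {s | Startable L v s (π.plan v s).2} := by
  have : {s | Startable L v s (π.plan v s).2}
      = ⋃ c : Chunk, {s | (π.plan v s).2 = c} ∩ {s | Startable L v s c} := by
    ext s; simp
  rw [this]
  exact MeasurableSet.iUnion fun c => (measurableSet_eq_fun
    (measurable_snd.comp (π.measurable_plan v)) measurable_const).inter
    (measurableSet_startable v c)

theorem measurable_iInf_prop {α : Type*} [MeasurableSpace α] {p : α → Prop}
    (hp : MeasurableSet {a | p a}) {f : α → ℝ≥0∞} (hf : Measurable f) :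
    Measurable fun a => ⨅ _ : p a, f a := by
  classical
  have : (fun a => ⨅ _ : p a, f a) = fun a => if p a then f a else ⊤ := by
    ext a
    split_ifs with h <;> simp [h]
  rw [this]
  exact Measurable.ite hp hf measurable_const

theorem measurable_nextArrival : Measurable (nextArrival R) := by
  refine Measurable.iInf fun i => measurable_iInf_prop ?_ measurable_const
  exact (MeasurableSet.const _).inter (measurableSet_lt (f := fun s : Record => s.now)
    (g := fun _ => (R.req i).a) Record.measurable_now measurable_const)

theorem measurable_finish (c : Chunk) :
    Measurable fun p : (Chunk → ℝ≥0) × Record => p.2.start c + p.1 c :=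
  ((Record.measurable_start c).comp measurable_snd).add
    (((measurable_pi_apply c).comp measurable_fst).coe_nnreal_ennreal)

theorem measurable_nextDone (v : View) :
    Measurable fun p : (Chunk → ℝ≥0) × Record => nextDone p.1 v p.2 :=
  Measurable.iInf fun c => measurable_iInf_prop
    (measurable_snd (measurableSet_inService v c)) (measurable_finish c)

theorem measurableSet_isNextDone (v : View) (c : Chunk) :
    MeasurableSet {p : (Chunk → ℝ≥0) × Record | IsNextDone p.1 v p.2 c} := by
  refine (measurable_snd (measurableSet_inService v c)).inter ?_
  have : {p : (Chunk → ℝ≥0) × Record | ∀ c', InService v p.2 c' →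
      p.2.start c + p.1 c < p.2.start c' + p.1 c' ∨ (p.2.start c + p.1 c = p.2.start c' + p.1 c' ∧
        Encodable.encode c ≤ Encodable.encode c')}
      = ⋂ c', ({p | InService v p.2 c'}ᶜ ∪ ({p | p.2.start c + (p.1 c : ℝ≥0∞) < p.2.start c' + (p.1 c' : ℝ≥0∞)} ∪
        ({p | p.2.start c + (p.1 c : ℝ≥0∞) = p.2.start c' + (p.1 c' : ℝ≥0∞)} ∩
          {_p | Encodable.encode c ≤ Encodable.encode c'}))) := by
    ext p
    simp only [mem_ofPred_eq, mem_iInter, mem_union, mem_inter_iff, mem_compl_iff,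
      imp_iff_not_or]
  refine MeasurableSet.congr ?_ this.symm
  exact MeasurableSet.iInter fun c' => (measurable_snd (measurableSet_inService v c')).compl.union
    ((measurableSet_lt (measurable_finish c) (measurable_finish c')).union
      ((measurableSet_eq_fun (measurable_finish c) (measurable_finish c')).inter (.const _)))

open Classical in
/-- A step, when the known requests are `v`. -/
noncomputable def stepWith (L : ℕ) (R : Arrivals) (π : OnlinePolicy) (v : View)
    (p : (Chunk → ℝ≥0) × Record) : Record :=
  let c₀ := (π.plan v p.2).2
  let S : ℝ≥0∞ := if Startable L v p.2 c₀ then p.2.now + (π.plan v p.2).1 else ⊤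
  let T : ℝ≥0∞ := min (nextArrival R p.2) (nextDone p.1 v p.2)
  if T ≤ S then
    if T = ⊤ then p.2
    else ⟨T.toNNReal, p.2.start,
      fun c => if IsNextDone p.1 v p.2 c ∧ p.2.start c + p.1 c = T then T else p.2.fin c⟩
  else ⟨S.toNNReal, Function.update p.2.start c₀ S, p.2.fin⟩

theorem measurable_stepWith (v : View) : Measurable (stepWith L R π v) := by
  classical
  have hplan := (π.measurable_plan v).comp
    (measurable_snd : Measurable (Prod.snd : (Chunk → ℝ≥0) × Record → Record))
  have hS : Measurable fun p : (Chunk → ℝ≥0) × Record =>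
      (if Startable L v p.2 (π.plan v p.2).2 then (p.2.now : ℝ≥0∞) + (π.plan v p.2).1 else ⊤) := by
    refine Measurable.ite (measurable_snd (measurableSet_startable_plan v)) ?_ measurable_const
    exact ((Record.measurable_now.comp measurable_snd).coe_nnreal_ennreal).add
      (measurable_fst.comp hplan)
  have hT : Measurable fun p : (Chunk → ℝ≥0) × Record =>
      min (nextArrival R p.2) (nextDone p.1 v p.2) :=
    (measurable_nextArrival.comp measurable_snd).min (measurable_nextDone v)
  have hs : ∀ c, Measurable fun p : (Chunk → ℝ≥0) × Record => p.2.start c :=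
    fun c => (Record.measurable_start c).comp measurable_snd
  have hf : ∀ c, Measurable fun p : (Chunk → ℝ≥0) × Record => p.2.fin c :=
    fun c => (Record.measurable_fin c).comp measurable_snd
  unfold stepWith
  refine Measurable.ite (by convert measurableSet_le hT hS) (Measurable.ite
    (measurableSet_eq_fun hT measurable_const) measurable_snd ?_) ?_
  · refine Record.measurable_iff.2 ⟨hT.ennreal_toNNReal, hs, fun c => ?_⟩
    exact Measurable.ite ((measurableSet_isNextDone v c).inter
      (measurableSet_eq_fun (measurable_finish c) hT)) hT (hf c)
  · refine Record.measurable_iff.2 ⟨?_, fun c => ?_, hf⟩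
    · convert hS.ennreal_toNNReal
    · simp only [Function.update_apply]
      refine Measurable.ite (measurableSet_eq_fun measurable_const (measurable_snd.comp hplan)) ?_ (hs c)
      convert hS

/-- The first `K` requests. -/
noncomputable def viewOfFirst (R : Arrivals) (K : ℕ) : View :=
  open Classical in fun i => if (i : ℕ∞) < R.N ∧ i < K then some (R.req i) else none

/-- The number of requests that have arrived at time `t`. -/
noncomputable def arrived (R : Arrivals) (t : ℝ≥0) : ℕ :=
  {i : ℕ | (i : ℕ∞) < R.N ∧ (R.req i).a ≤ t}.ncard

theorem Arrivals.Valid.arrived_mono (hR : R.Valid) : Monotone (arrived R) := fun _ u htu =>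
  ncard_le_ncard (fun _ hi => ⟨hi.1, hi.2.trans htu⟩) (hR.finite_arrived u)

/-- Arrivals are ordered, so a view is determined by the number of arrived requests. Only countably
many views occur, and measurability of the plan for each fixed view is enough for `measurable_step`.
-/
theorem Arrivals.Valid.view_eq (hR : R.Valid) (t : ℝ≥0) :
    R.view t = viewOfFirst R (arrived R t) := by
  have hfin := hR.finite_arrived t
  have key : ∀ i : ℕ, (i : ℕ∞) < R.N → ((R.req i).a ≤ t ↔ i < arrived R t) := by
    intro i hi
    constructor
    · intro ha
      have hsub : (Finset.range (i + 1) : Set ℕ) ⊆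
          {i : ℕ | (i : ℕ∞) < R.N ∧ (R.req i).a ≤ t} := by
        intro l hl
        have hli : l ≤ i := by simpa [Nat.lt_succ_iff] using hl
        exact ⟨(Nat.cast_le.2 hli).trans_lt hi, (hR.mono l i hli hi).trans ha⟩
      have := ncard_le_ncard hsub hfin
      rw [ncard_coe_finset, Finset.card_range] at this
      exact this
    · intro hlt
      by_contra ha
      have hsub : {i : ℕ | (i : ℕ∞) < R.N ∧ (R.req i).a ≤ t} ⊆ (Finset.range i : Set ℕ) := by
        intro l hl
        simp only [Finset.coe_range, mem_Iio]
        by_contra hc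
        exact ha ((hR.mono i l (not_lt.1 hc) hl.1).trans hl.2)
      have := ncard_le_ncard hsub
      rw [ncard_coe_finset, Finset.card_range] at this
      exact absurd hlt (not_lt.2 this)
  funext i
  unfold Arrivals.view viewOfFirst
  by_cases hi : (i : ℕ∞) < R.N
  · simp only [hi, true_and, key i hi]
  · simp [hi]

theorem measurable_step (hR : R.Valid) :
    Measurable fun p : (Chunk → ℝ≥0) × Record => step L R π p.1 p.2 := by
  have h1 : Measurable fun q : ℕ × ((Chunk → ℝ≥0) × Record) =>
      stepWith L R π (viewOfFirst R q.1) q.2 :=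
    measurable_from_prod_countable_right fun K => measurable_stepWith (viewOfFirst R K)
  have h2 : (fun p : (Chunk → ℝ≥0) × Record => step L R π p.1 p.2)
      = (fun q : ℕ × ((Chunk → ℝ≥0) × Record) => stepWith L R π (viewOfFirst R q.1) q.2) ∘
        fun p => (arrived R p.2.now, p) := by
    funext p
    simp only [comp_apply, ← hR.view_eq]
    rfl
  rw [h2]
  exact h1.comp ((hR.arrived_mono.measurable.comp
    (Record.measurable_now.comp measurable_snd)).prodMk measurable_id')

theorem measurable_runFrom (hR : R.Valid) (s : Record) (m : ℕ) :
    Measurable fun x => runFrom L R π x s m := by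
  induction m with
  | zero => exact measurable_const
  | succ m ih =>
    simp only [runFrom_succ']
    have h : Measurable fun x : Chunk → ℝ≥0 => (x, runFrom L R π x s m) := measurable_id'.prodMk ih
    have h' := (measurable_step (L := L) (π := π) hR).comp h
    simpa only [comp_def] using h'

theorem measurableSet_le_count (hR : R.Valid) (s : Record) (m n : ℕ) :
    MeasurableSet {x | (n : ℕ∞) ≤ count (runFrom L R π x s m)} :=
  (measurable_runFrom hR s m) (measurableSet_le_encard measurableSet_fin_ne_top n)

theorem measurable_depFrom (hR : R.Valid) (s : Record) (j : ℕ) :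
    Measurable fun x => depFrom L R π x s j :=
  Measurable.iInf fun m => measurable_iInf_prop (measurableSet_le_count hR s m (j + 1))
    (Record.measurable_now.comp (measurable_runFrom hR s m)).coe_nnreal_ennreal

theorem measurable_departure (hR : R.Valid) (j : ℕ) :
    Measurable fun x => departure L R π x j := measurable_depFrom hR _ j

theorem measurable_completion (hR : R.Valid) (i : ℕ) :
    Measurable fun x => completion L R π x i :=
  Measurable.iInf fun m => measurable_iInf_prop
    (measurableSet_le measurable_const
      ((measurable_downloaded i (R.req i)).comp (measurable_runFrom hR Record.init m)))
    (Record.measurable_now.comp (measurable_runFrom hR Record.init m)).coe_nnreal_ennreal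

end Measurability

/-! ### The value function of the single-server queue. -/

section Value

/-- The expectation of `φ` at the departure times of a single server with service times of law `κ`,
when `j` requests have departed at the times `h`, the present time is `t`, and `r` more departures
are considered. -/
noncomputable def value (κ : Measure ℝ≥0) (R : Arrivals) (φ : (ℕ → ℝ≥0∞) → ℝ≥0∞) :
    ℕ → ℕ → ℝ≥0∞ → (ℕ → ℝ≥0∞) → ℝ≥0∞
  | 0, _, _, h => φ h
  | r + 1, j, t, h => ∫⁻ y : ℝ≥0, value κ R φ r (j + 1) (max t (R.req j).a + y)
      (update h j (max t (R.req j).a + y)) ∂κ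

variable {κ : Measure ℝ≥0} {R : Arrivals} {φ : (ℕ → ℝ≥0∞) → ℝ≥0∞}

theorem measurable_update_pair {α : Type*} [MeasurableSpace α] {h : α → ℕ → ℝ≥0∞} {t : α → ℝ≥0∞}
    (hh : Measurable h) (ht : Measurable t) (j : ℕ) : Measurable fun a => update (h a) j (t a) := by
  refine measurable_pi_iff.2 fun i => ?_
  by_cases hi : i = j
  · subst hi; simpa using ht
  · simp only [update_of_ne hi]
    exact (measurable_pi_apply i).comp hh

theorem measurable_value [SFinite κ] (hφ : Measurable φ) (r : ℕ) :
    ∀ j, Measurable fun p : ℝ≥0∞ × (ℕ → ℝ≥0∞) => value κ R φ r j p.1 p.2 := by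
  induction r with
  | zero => exact fun j => hφ.comp measurable_snd
  | succ r ih =>
    intro j
    simp only [value]
    refine Measurable.lintegral_prod_right' (f := fun q : (ℝ≥0∞ × (ℕ → ℝ≥0∞)) × ℝ≥0 =>
      value κ R φ r (j + 1) (max q.1.1 (R.req j).a + q.2)
        (update q.1.2 j (max q.1.1 (R.req j).a + q.2))) ?_
    have ht : Measurable fun q : (ℝ≥0∞ × (ℕ → ℝ≥0∞)) × ℝ≥0 =>
        max q.1.1 ((R.req j).a : ℝ≥0∞) + (q.2 : ℝ≥0∞) :=
      ((measurable_fst.comp measurable_fst).max measurable_const).add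
        measurable_snd.coe_nnreal_ennreal
    exact (ih (j + 1)).comp (ht.prodMk
      (measurable_update_pair (measurable_snd.comp measurable_fst) ht j))

theorem measurable_value_update [SFinite κ] (hφ : Measurable φ) (r j : ℕ) (h : ℕ → ℝ≥0∞) :
    Measurable fun t => value κ R φ r (j + 1) t (update h j t) :=
  (measurable_value hφ r (j + 1)).comp
    (measurable_id'.prodMk (measurable_update_pair measurable_const measurable_id' j))

theorem update_mono_pair {h h' : ℕ → ℝ≥0∞} {t t' : ℝ≥0∞} (hh : h ≤ h') (ht : t ≤ t') (j : ℕ) :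
    update h j t ≤ update h' j t' :=
  update_le_update_iff.2 ⟨ht, fun i _ => hh i⟩

theorem value_mono (hφ : Monotone φ) (r : ℕ) : ∀ j t t' h h', t ≤ t' → h ≤ h' →
    value κ R φ r j t h ≤ value κ R φ r j t' h' := by
  induction r with
  | zero => exact fun j t t' h h' _ hh => hφ hh
  | succ r ih =>
    intro j t t' h h' ht hh
    refine lintegral_mono fun y => ?_
    have : max t ((R.req j).a : ℝ≥0∞) + (y : ℝ≥0∞) ≤ max t' ((R.req j).a : ℝ≥0∞) + y := by gcongr
    exact ih _ _ _ _ _ this (update_mono_pair hh this j)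

theorem value_anti (hφ : Antitone φ) (r : ℕ) : ∀ j t t' h h', t ≤ t' → h ≤ h' →
    value κ R φ r j t' h' ≤ value κ R φ r j t h := by
  induction r with
  | zero => exact fun j t t' h h' _ hh => hφ hh
  | succ r ih =>
    intro j t t' h h' ht hh
    refine lintegral_mono fun y => ?_
    have : max t ((R.req j).a : ℝ≥0∞) + (y : ℝ≥0∞) ≤ max t' ((R.req j).a : ℝ≥0∞) + y := by gcongr
    exact ih _ _ _ _ _ this (update_mono_pair hh this j)

/-- After an infinite departure time all later ones are infinite as well, and these are the entries
that `h` already has. -/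
theorem value_top [IsProbabilityMeasure κ] (r : ℕ) : ∀ j (h : ℕ → ℝ≥0∞), (∀ i, j ≤ i → h i = ⊤) →
    value κ R φ r j ⊤ h = φ h := by
  induction r with
  | zero => exact fun j h _ => rfl
  | succ r ih =>
    intro j h hh
    have : update h j ⊤ = h := by
      rw [← hh j le_rfl, update_eq_self]
    simp only [value, max_eq_left (le_top : ((R.req j).a : ℝ≥0∞) ≤ ⊤), top_add, this]
    rw [ih (j + 1) h fun i hi => hh i (by omega)]
    simp

/-- Both values are expectations for the same queue. This turns a lower bound for the complementary
function into an upper bound for `φ`. -/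
theorem value_add_value [IsProbabilityMeasure κ] {ψ : (ℕ → ℝ≥0∞) → ℝ≥0∞} (hφ : Measurable φ)
    (h1 : ∀ h, φ h + ψ h = 1) (r : ℕ) : ∀ j t h,
    value κ R φ r j t h + value κ R ψ r j t h = 1 := by
  induction r with
  | zero => exact fun j t h => h1 h
  | succ r ih =>
    intro j t h
    simp only [value]
    rw [← lintegral_add_left]
    · simp [ih]
    · exact (measurable_value_update hφ r j h).comp
        (measurable_const.add measurable_id'.coe_nnreal_ennreal)

end Value

/-! ### The future does not depend on accomplished downloads. -/

section Locality

variable {L : ℕ} {R : Arrivals} {π : OnlinePolicy} {s : Record} {x x' : Chunk → ℝ≥0}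

-- A step reads downloading times only of chunks under service. Hence the coordinate of an
-- accomplished chunk can be resampled without changing the future.
open Classical in
theorem step_congr (h : ∀ c, s.fin c = ⊤ → x c = x' c) : step L R π x s = step L R π x' s := by
  have h1 : ∀ v c, InService v s c → x c = x' c := fun v c hc => h c hc.2.2
  have h2 : ∀ v, nextDone x v s = nextDone x' v s := fun v =>
    iInf_congr fun c => iInf_congr fun hc => by rw [h1 v c hc]
  have h3 : ∀ v c, IsNextDone x v s c ↔ IsNextDone x' v s c := by
    intro v c
    refine and_congr_right fun hc => forall_congr' fun c' => ?_
    refine imp_congr_right fun hc' => ?_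
    rw [h1 v c hc, h1 v c' hc']
  have h4 : ∀ v c T, (IsNextDone x v s c ∧ s.start c + x c = T) ↔
      (IsNextDone x' v s c ∧ s.start c + x' c = T) := by
    intro v c T
    rw [h3]
    refine and_congr_right fun hc => ?_
    rw [h1 v c hc.1]
  unfold step
  simp only [h2]
  split_ifs
  all_goals first
    | rfl
    | (congr 1
       funext c
       exact if_congr (h4 _ c _) rfl rfl)

theorem fin_step_eq_top {c : Chunk} (h : (step L R π x s).fin c = ⊤) : s.fin c = ⊤ := by
  unfold step at h
  simp only at h
  split_ifs at h
  all_goals first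
    | exact h
    | (simp only at h
       split_ifs at h
       · contradiction
       · exact h)

theorem runFrom_congr (m : ℕ) : ∀ s : Record, (∀ c, s.fin c = ⊤ → x c = x' c) →
    runFrom L R π x s m = runFrom L R π x' s m := by
  induction m with
  | zero => exact fun s _ => rfl
  | succ m ih =>
    intro s h
    rw [runFrom_succ, runFrom_succ, ← step_congr h]
    exact ih _ fun c hc => h c (fin_step_eq_top hc)

theorem depFrom_congr (h : ∀ c, s.fin c = ⊤ → x c = x' c) (i : ℕ) :
    depFrom L R π x s i = depFrom L R π x' s i := by
  unfold depFrom
  simp only [runFrom_congr _ s h]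

end Locality

/-! ### The future departures as seen from a record. -/

section Future

variable (φ : (ℕ → ℝ≥0∞) → ℝ≥0∞) (L : ℕ) (R : Arrivals) (π : OnlinePolicy)

/-- The value of `φ` at the departure times, when `j` chunks have departed at the times `h`, and
the present record is `s`. -/
noncomputable def future (j : ℕ) (h : ℕ → ℝ≥0∞) (s : Record) (x : Chunk → ℝ≥0) : ℝ≥0∞ :=
  φ fun i => if i < j then h i else depFrom L R π x s i

variable {φ L R π} {s : Record} {x : Chunk → ℝ≥0} {j : ℕ} {h : ℕ → ℝ≥0∞}

theorem measurable_future (hφ : Measurable φ) (hR : R.Valid) :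
    Measurable fun x => future φ L R π j h s x := by
  refine hφ.comp (measurable_pi_iff.2 fun i => ?_)
  by_cases hi : i < j
  · simp [hi]
  · simpa [hi] using measurable_depFrom hR s i

theorem future_of_idle (hR : Repetition L R) (hs : s.Valid L R) (hj : count s = j)
    (hi : ∀ c, busy s c → idleTime L R π s < s.start c + x c) :
    future φ L R π j h s x = future φ L R π j h (idle L R π s) x := by
  unfold future
  congr 1
  funext i
  split_ifs with hij
  · rfl
  · exact depFrom_of_idle hR hs hj (not_lt.1 hij) hi

/-- The departure that takes place moves from the simulated part of the sequence to the history `h`.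
-/
theorem future_of_first (hR : Repetition L R) (hs : s.Valid L R) (hx : Consistent x s)
    (hj : count s = j) {c : Chunk} (hc : First x s c) (hle : s.start c + x c ≤ idleTime L R π s) :
    future φ L R π j h s x = future φ L R π (j + 1) (update h j (s.start c + x c))
      (done s c (s.start c + x c).toNNReal) x := by
  unfold future
  congr 1
  funext i
  rcases lt_trichotomy i j with hij | rfl | hij
  · rw [if_pos hij, if_pos (by omega), update_of_ne hij.ne]
  · rw [if_neg (lt_irrefl _), if_pos (by omega), update_self,
      depFrom_of_first hR hs hx hj hc hle]
  · rw [if_neg (by omega), if_neg (by omega), depFrom_step hj hij.le, step_of_first hR hs hc hle]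

theorem future_update {c : Chunk} (hc : s.fin c ≠ ⊤) (y : ℝ≥0) :
    future φ L R π j h s (update x c y) = future φ L R π j h s x := by
  unfold future
  congr 1
  funext i
  split_ifs
  · rfl
  · refine depFrom_congr (fun c' hc' => ?_) i
    rw [update_of_ne]
    rintro rfl
    exact hc hc'

end Future

/-! ### Conditioning on the past as restriction to boxes. -/

section Box

/-- The sets `A c` describe what is known of the downloading times at the record `s`: nothing for
chunks not yet started, and a lower bound, strict or not, for chunks under service. -/
structure Fits (A : Chunk → Set ℝ≥0) (s : Record) : Prop where
  measurable : ∀ c, MeasurableSet (A c)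
  finite : {c | A c ≠ univ}.Finite
  fresh : ∀ c, s.start c = ⊤ → A c = univ
  tail : ∀ c, busy s c → ∃ τ : ℝ≥0, s.start c + τ = s.now ∧ (A c = Ici τ ∨ A c = Ioi τ)

variable {A : Chunk → Set ℝ≥0} {L : ℕ} {R : Arrivals} {π : OnlinePolicy} {s : Record}
  {x : Chunk → ℝ≥0}

theorem Fits.measurableSet (hA : Fits A s) : MeasurableSet (univ.pi A) :=
  MeasurableSet.univ_pi hA.measurable

theorem Fits.now_le (hA : Fits A s) {c : Chunk} (hc : busy s c) {y : ℝ≥0} (hy : y ∈ A c) :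
    (s.now : ℝ≥0∞) ≤ s.start c + y := by
  obtain ⟨τ, hτ, h⟩ := hA.tail c hc
  rw [← hτ]
  have : τ ≤ y := by
    rcases h with h | h
    · rw [h] at hy; exact hy
    · rw [h] at hy; exact (mem_Ioi.1 hy).le
  gcongr

theorem Fits.consistent (hA : Fits A s) (hx : x ∈ univ.pi A) : Consistent x s :=
  fun c hc => hA.now_le hc (hx c (mem_univ c))

open Classical in
/-- What is known after an event that is no accomplishment. -/
def idleBox (A : Chunk → Set ℝ≥0) (s : Record) (E : ℝ≥0∞) (c : Chunk) : Set ℝ≥0 :=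
  if busy s c then A c ∩ {y | E < s.start c + (y : ℝ≥0∞)} else A c

open Classical in
/-- What is known of the other chunks after `c` is the first to be accomplished, at time `T`. -/
def doneBox (A : Chunk → Set ℝ≥0) (s : Record) (c : Chunk) (T : ℝ≥0∞) (c' : Chunk) : Set ℝ≥0 :=
  if c' = c then univ else if busy s c' then A c' ∩ {y | T < s.start c' + (y : ℝ≥0∞) ∨
    (T = s.start c' + (y : ℝ≥0∞) ∧ Encodable.encode c ≤ Encodable.encode c')} else A c'

theorem mem_idleBox {E : ℝ≥0∞} : x ∈ univ.pi (idleBox A s E) ↔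
    x ∈ univ.pi A ∧ ∀ c, busy s c → E < s.start c + x c := by
  classical
  simp only [Set.mem_pi, mem_univ, true_imp_iff, idleBox]
  rw [← forall_and]
  refine forall_congr' fun c => ?_
  by_cases hc : busy s c
  · simp [hc]
  · simp [hc]

theorem measurable_add_coe (a : ℝ≥0∞) : Measurable fun y : ℝ≥0 => a + (y : ℝ≥0∞) :=
  measurable_const.add measurable_id'.coe_nnreal_ennreal

/-- Surviving up to the event raises the lower bound on each running download to its new age. The
case excluded by `hE`, an infinite wait during a download, has an empty box because downloading
times are finite. -/
theorem Fits.idle (hR : Repetition L R) (hs : s.Valid L R) (hA : Fits A s)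
    (hE : idleTime L R π s ≠ ⊤ ∨ ∀ c, ¬ busy s c) :
    Fits (idleBox A s (idleTime L R π s)) (idle L R π s) := by
  classical
  refine ⟨fun c => ?_, ?_, fun c hc => ?_, fun c hc => ?_⟩
  · unfold idleBox
    split_ifs
    · exact (hA.measurable c).inter (measurableSet_lt measurable_const (measurable_add_coe _))
    · exact hA.measurable c
  · refine (hA.finite.union hs.finite_busy).subset fun c hc => ?_
    by_cases hb : busy s c
    · exact Or.inr hb
    · left
      simpa [idleBox, hb] using hc
  · have hsc : s.start c = ⊤ := by
      by_contra h
      rw [idle_start_of_ne_top hR hs h] at hc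
      exact h hc
    have hb : ¬ busy s c := fun h => h.1 hsc
    simp only [idleBox, hb, if_false]
    exact hA.fresh c hsc
  · rcases hE with hE | hE
    · rw [idle_now hE]
      rcases (busy_idle_iff hR hs c).1 hc with hb | hb
      · rw [idle_start_of_ne_top hR hs hb.1]
        obtain ⟨τ, hτ, h⟩ := hA.tail c hb
        have hnow := now_le_idleTime (L := L) (π := π) (s := s) hR.valid
        lift s.start c to ℝ≥0 using hb.1 with a ha
        lift idleTime L R π s to ℝ≥0 using hE with E
        have hτ' : a + τ = s.now := by exact_mod_cast hτ
        have hEn : s.now ≤ E := by exact_mod_cast hnow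
        have haE : a ≤ E := le_self_add.trans (hτ'.le.trans hEn)
        -- The age at time `E` is `E - a`; the tail is open because accomplishments at time `E`
        -- precede the event.
        refine ⟨E - a, ?_, Or.inr ?_⟩
        · rw [← ENNReal.coe_add, add_tsub_cancel_of_le haE]
        · simp only [idleBox, hb, if_true]
          rw [← ha]
          have hτE : τ ≤ E - a := by
            rw [← hτ', add_comm] at hEn
            exact le_tsub_of_add_le_right hEn
          have hsub : {y : ℝ≥0 | (E : ℝ≥0∞) < (a : ℝ≥0∞) + (y : ℝ≥0∞)} = Ioi (E - a) := by
            ext y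
            simp only [mem_ofPred_eq, mem_Ioi, ← ENNReal.coe_add, ENNReal.coe_lt_coe]
            rw [tsub_lt_iff_left haE]
          rw [hsub, inter_eq_right]
          rcases h with h | h
          · rw [h]; exact (Ioi_subset_Ioi hτE).trans Ioi_subset_Ici_self
          · rw [h]; exact Ioi_subset_Ioi hτE
      · have h1 := idle_start_of_new hb.1 hb.2
        refine ⟨0, by rw [h1.1]; simp, Or.inl ?_⟩
        have hb' : ¬ busy s c := fun h => h.1 hb.1
        simp only [idleBox, hb', if_false]
        rw [hA.fresh c hb.1]
        ext; simp
    · rcases (busy_idle_iff hR hs c).1 hc with hb | hb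
      · exact absurd hb (hE c)
      · have h1 := idle_start_of_new hb.1 hb.2
        refine ⟨0, by rw [h1.1, idle_now h1.2.1]; simp, Or.inl ?_⟩
        have hb' : ¬ busy s c := fun h => h.1 hb.1
        simp only [idleBox, hb', if_false]
        rw [hA.fresh c hb.1]
        ext; simp

/-- Once the accomplishment time of `c` is fixed, being the first is a condition on each other
coordinate separately, and coordinate `c` becomes free. So the knowledge after a departure is again
a box. -/
theorem mem_doneBox {c : Chunk} (hc : busy s c) (y : ℝ≥0) :
    (update x c y ∈ univ.pi A ∧ First (update x c y) s c) ↔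
      y ∈ A c ∧ x ∈ univ.pi (doneBox A s c (s.start c + y)) := by
  classical
  simp only [Set.mem_pi, mem_univ, true_imp_iff, First, hc, true_and, update_self]
  rw [← forall_and]
  constructor
  · intro h
    refine ⟨by simpa using (h c).1, fun c' => ?_⟩
    unfold doneBox
    by_cases hcc : c' = c
    · simp [hcc]
    · have h' := h c'
      rw [update_of_ne hcc] at h'
      by_cases hb : busy s c'
      · rw [if_neg hcc, if_pos hb]
        exact ⟨h'.1, h'.2 hb⟩
      · rw [if_neg hcc, if_neg hb]
        exact h'.1
  · rintro ⟨h1, h2⟩ c'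
    by_cases hcc : c' = c
    · subst hcc
      simp [h1]
    · have h' := h2 c'
      unfold doneBox at h'
      rw [update_of_ne hcc]
      by_cases hb : busy s c'
      · rw [if_neg hcc, if_pos hb] at h'
        exact ⟨h'.1, fun _ => h'.2⟩
      · rw [if_neg hcc, if_neg hb] at h'
        exact ⟨h', fun h => absurd h hb⟩

theorem Fits.done (hs : s.Valid L R) (hA : Fits A s) {c : Chunk}
    (hc : busy s c) {T : ℝ≥0} (hT : s.now ≤ T) :
    Fits (doneBox A s c T) (done s c T) := by
  classical
  refine ⟨fun c' => ?_, ?_, fun c' hc' => ?_, fun c' hc' => ?_⟩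
  · unfold doneBox
    split_ifs
    · exact MeasurableSet.univ
    · exact (hA.measurable c').inter ((measurableSet_lt measurable_const (measurable_add_coe _)).union
        ((measurableSet_eq_fun measurable_const (measurable_add_coe _)).inter (.const _)))
    · exact hA.measurable c'
  · refine (hA.finite.union hs.finite_busy).subset fun c' hc' => ?_
    by_cases hb : busy s c'
    · exact Or.inr hb
    · left
      intro h
      refine hc' ?_
      unfold doneBox
      rw [if_neg hb, h, ite_self]
  · have hne : c' ≠ c := by rintro rfl; exact hc.1 hc'
    have hb : ¬ busy s c' := fun h => h.1 hc'
    unfold doneBox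
    rw [if_neg hne, if_neg hb]
    exact hA.fresh c' hc'
  · rw [busy_done_iff] at hc'
    obtain ⟨hb, hne1⟩ := hc'
    have hne : c' ≠ c := by rintro rfl; exact hne1 rfl
    obtain ⟨τ, hτ, h⟩ := hA.tail c' hb
    change ∃ τ' : ℝ≥0, s.start c' + τ' = (T : ℝ≥0∞) ∧ _
    unfold doneBox
    rw [if_neg hne, if_pos hb]
    lift s.start c' to ℝ≥0 using hb.1 with a
    have hτ' : a + τ = s.now := by exact_mod_cast hτ
    have haT : a ≤ T := le_self_add.trans (hτ'.le.trans hT)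
    have hτT : τ ≤ T - a := by
      rw [← hτ', add_comm] at hT
      exact le_tsub_of_add_le_right hT
    refine ⟨T - a, by rw [← ENNReal.coe_add, add_tsub_cancel_of_le haT], ?_⟩
    have hlt : ∀ y : ℝ≥0, (T : ℝ≥0∞) < (a : ℝ≥0∞) + (y : ℝ≥0∞) ↔ T - a < y := fun y => by
      rw [← ENNReal.coe_add, ENNReal.coe_lt_coe, tsub_lt_iff_left haT]
    have heq : ∀ y : ℝ≥0, (T : ℝ≥0∞) = (a : ℝ≥0∞) + (y : ℝ≥0∞) ↔ T - a = y := fun y => by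
      rw [← ENNReal.coe_add, ENNReal.coe_inj, tsub_eq_iff_eq_add_of_le haT, add_comm]
    simp only [hlt, heq]
    -- Ties decide the kind of the tail: a chunk later in the enumeration may be due at the same
    -- time `T`, an earlier one must be due strictly later.
    by_cases he : Encodable.encode c ≤ Encodable.encode c'
    · have hset : {y : ℝ≥0 | T - a < y ∨ (T - a = y ∧ Encodable.encode c ≤ Encodable.encode c')}
          = Ici (T - a) := by
        ext y; simp [he, le_iff_lt_or_eq]
      rw [hset]
      rcases h with h | h
      · left; rw [h, inter_eq_right]; exact Ici_subset_Ici.2 hτT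
      · rcases hτT.lt_or_eq with hlt' | heq'
        · left; rw [h, inter_eq_right]; exact Ici_subset_Ioi.2 hlt'
        · right; rw [h, ← heq', inter_eq_left]; exact Ioi_subset_Ici_self
    · have hset : {y : ℝ≥0 | T - a < y ∨ (T - a = y ∧ Encodable.encode c ≤ Encodable.encode c')}
          = Ioi (T - a) := by
        ext y; simp [he]
      rw [hset]
      right
      rw [inter_eq_right]
      rcases h with h | h
      · rw [h]; exact (Ioi_subset_Ioi hτT).trans Ioi_subset_Ici_self
      · rw [h]; exact Ioi_subset_Ioi hτT

theorem measurableSet_first (s : Record) (c : Chunk) :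
    MeasurableSet {x : Chunk → ℝ≥0 | First x s c} := by
  have hf : ∀ c : Chunk, Measurable fun x : Chunk → ℝ≥0 => s.start c + (x c : ℝ≥0∞) :=
    fun c => measurable_const.add (measurable_pi_apply c).coe_nnreal_ennreal
  have : {x : Chunk → ℝ≥0 | First x s c} = {_x | busy s c} ∩ ⋂ c', ({_x | busy s c'}ᶜ ∪
      ({x | s.start c + (x c : ℝ≥0∞) < s.start c' + (x c' : ℝ≥0∞)} ∪
        ({x | s.start c + (x c : ℝ≥0∞) = s.start c' + (x c' : ℝ≥0∞)} ∩
          {_x | Encodable.encode c ≤ Encodable.encode c'}))) := by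
    ext x
    simp only [First, mem_ofPred_eq, mem_iInter, mem_union, mem_inter_iff, mem_compl_iff,
      imp_iff_not_or]
  rw [this]
  exact (MeasurableSet.const _).inter (MeasurableSet.iInter fun c' =>
    (MeasurableSet.const _).compl.union ((measurableSet_lt (hf c) (hf c')).union
      ((measurableSet_eq_fun (hf c) (hf c')).inter (.const _))))

/-- The event that `c` is accomplished in the next step. -/
def firstSet (A : Chunk → Set ℝ≥0) (s : Record) (E : ℝ≥0∞) (c : Chunk) : Set (Chunk → ℝ≥0) :=
  {x | x ∈ univ.pi A ∧ First x s c ∧ s.start c + (x c : ℝ≥0∞) ≤ E}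

theorem Fits.measurableSet_firstSet (hA : Fits A s) (E : ℝ≥0∞) (c : Chunk) :
    MeasurableSet (firstSet A s E c) :=
  hA.measurableSet.inter ((measurableSet_first s c).inter (measurableSet_le
    (measurable_const.add (measurable_pi_apply c).coe_nnreal_ennreal) measurable_const))

theorem measurableSet_idleBox (hA : Fits A s) (E : ℝ≥0∞) :
    MeasurableSet (univ.pi (idleBox A s E)) := by
  classical
  refine MeasurableSet.univ_pi fun c => ?_
  unfold idleBox
  split_ifs
  · exact (hA.measurable c).inter (measurableSet_lt measurable_const (measurable_add_coe _))
  · exact hA.measurable c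

/-- Comparison of integrals by the outcome of the next step. -/
theorem lintegral_box_le (hs : s.Valid L R) (hA : Fits A s) (ν : Measure (Chunk → ℝ≥0)) (E : ℝ≥0∞)
    {f g : (Chunk → ℝ≥0) → ℝ≥0∞}
    (hfirst : ∀ c, busy s c → ∫⁻ x in firstSet A s E c, f x ∂ν ≤ ∫⁻ x in firstSet A s E c, g x ∂ν)
    (hidle : ∫⁻ x in univ.pi (idleBox A s E), f x ∂ν ≤ ∫⁻ x in univ.pi (idleBox A s E), g x ∂ν) :
    ∫⁻ x in univ.pi A, f x ∂ν ≤ ∫⁻ x in univ.pi A, g x ∂ν := by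
  -- Either all running downloads outlast `E`, or exactly one chunk is the first to be accomplished
  -- by then.
  have hU : univ.pi A = univ.pi (idleBox A s E) ∪ ⋃ c, firstSet A s E c := by
    ext x
    rw [mem_union, mem_idleBox, mem_iUnion]
    constructor
    · intro hx
      by_cases h : ∀ c, busy s c → E < s.start c + x c
      · exact Or.inl ⟨hx, h⟩
      · push Not at h
        obtain ⟨c₁, hc₁, hle⟩ := h
        obtain ⟨c, hc⟩ := hs.exists_first x hc₁
        exact Or.inr ⟨c, hx, hc, (hc.le hc₁).trans hle⟩
    · rintro (h | ⟨c, h⟩)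
      · exact h.1
      · exact h.1
  have hd : Disjoint (univ.pi (idleBox A s E)) (⋃ c, firstSet A s E c) := by
    rw [Set.disjoint_left]
    intro x hx hx'
    rw [mem_idleBox] at hx
    obtain ⟨c, hc⟩ := mem_iUnion.1 hx'
    exact absurd (hx.2 c hc.2.1.1) hc.2.2.not_gt
  have hd' : Pairwise (Disjoint on fun c => firstSet A s E c) := by
    intro c c' hcc
    rw [onFun, Set.disjoint_left]
    intro x hx hx'
    exact hcc (hx.2.1.unique hx'.2.1)
  have hm := hA.measurableSet_firstSet E
  rw [hU, lintegral_union (MeasurableSet.iUnion hm) hd, lintegral_union (MeasurableSet.iUnion hm) hd,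
    lintegral_iUnion hm hd', lintegral_iUnion hm hd']
  refine add_le_add hidle (ENNReal.tsum_le_tsum fun c => ?_)
  by_cases hc : busy s c
  · exact hfirst c hc
  · have : firstSet A s E c = ∅ := by
      ext x
      simp only [mem_empty_iff_false, iff_false]
      exact fun h => hc h.2.1.1
    simp [this]

/-- Conditioning on the downloading time of `c` becomes Fubini's theorem with an independent copy of
that coordinate. -/
theorem lintegral_resample (μ : Measure ℝ≥0) [IsProbabilityMeasure μ] (c : Chunk)
    {S : Set (Chunk → ℝ≥0)} (hS : MeasurableSet S) {f : (Chunk → ℝ≥0) → ℝ≥0∞} (hf : Measurable f) :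
    ∫⁻ x in S, f x ∂(Measure.infinitePi fun _ : Chunk => μ) =
      ∫⁻ y, ∫⁻ x, S.indicator f (update x c y) ∂(Measure.infinitePi fun _ : Chunk => μ) ∂μ := by
  have hm := measurePreserving_update μ c
  rw [← lintegral_indicator hS, ← hm.lintegral_comp (hf.indicator hS)]
  rw [lintegral_prod_symm]
  exact ((hf.indicator hS).comp hm.measurable).aemeasurable

/-- If `c` is accomplished first, the conditional expectation of the future given the time of the
departure is bounded by means of the bound for the record after the departure. -/
theorem lintegral_firstSet_le (hR : Repetition L R) (hs : s.Valid L R) (hA : Fits A s)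
    {μ : Measure ℝ≥0} [IsProbabilityMeasure μ] {φ : (ℕ → ℝ≥0∞) → ℝ≥0∞} (hφ : Measurable φ) {j : ℕ}
    (hj : count s = j) {h : ℕ → ℝ≥0∞} {c : Chunk} (hc : busy s c) {g : ℝ≥0∞ → ℝ≥0∞}
    (hg : Measurable g)
    (hnext : ∀ T : ℝ≥0, s.now ≤ T → ∀ A', Fits A' (done s c T) →
      g T * (Measure.infinitePi fun _ : Chunk => μ) (univ.pi A') ≤
        ∫⁻ x in univ.pi A', future φ L R π (j + 1) (update h j T) (done s c T) x
          ∂(Measure.infinitePi fun _ : Chunk => μ)) :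
    ∫⁻ x in firstSet A s (idleTime L R π s) c, g (s.start c + x c)
      ∂(Measure.infinitePi fun _ : Chunk => μ) ≤
    ∫⁻ x in firstSet A s (idleTime L R π s) c, future φ L R π j h s x
      ∂(Measure.infinitePi fun _ : Chunk => μ) := by
  have hm := hA.measurableSet_firstSet (idleTime L R π s) c
  have hgm : Measurable fun x : Chunk → ℝ≥0 => g (s.start c + x c) :=
    hg.comp (measurable_const.add (measurable_pi_apply c).coe_nnreal_ennreal)
  rw [lintegral_resample μ c hm hgm,
    lintegral_resample μ c hm (measurable_future hφ hR.valid)]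
  refine lintegral_mono fun y => ?_
  have hmem : ∀ x : Chunk → ℝ≥0, update x c y ∈ firstSet A s (idleTime L R π s) c ↔
      (y ∈ A c ∧ s.start c + (y : ℝ≥0∞) ≤ idleTime L R π s) ∧
        x ∈ univ.pi (doneBox A s c (s.start c + y)) := by
    intro x
    have := mem_doneBox (A := A) (x := x) hc y
    constructor
    · rintro ⟨h1, h2, h3⟩
      rw [update_self] at h3
      have := this.1 ⟨h1, h2⟩
      exact ⟨⟨this.1, h3⟩, this.2⟩
    · rintro ⟨⟨h1, h3⟩, h2⟩
      have := this.2 ⟨h1, h2⟩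
      exact ⟨this.1, this.2, by rwa [update_self]⟩
  by_cases hy : y ∈ A c ∧ s.start c + (y : ℝ≥0∞) ≤ idleTime L R π s
  · have hfin : s.start c + (y : ℝ≥0∞) ≠ ⊤ := ENNReal.add_ne_top.2 ⟨hc.1, ENNReal.coe_ne_top⟩
    obtain ⟨T, hT⟩ : ∃ T : ℝ≥0, (T : ℝ≥0∞) = s.start c + y := ⟨_, ENNReal.coe_toNNReal hfin⟩
    have hnow : s.now ≤ T := by
      rw [← ENNReal.coe_le_coe, hT]; exact hA.now_le hc hy.1
    have hA' := hA.done hs hc hnow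
    have hle := hnext T hnow _ hA'
    have h1 : ∀ x : Chunk → ℝ≥0, (firstSet A s (idleTime L R π s) c).indicator
        (fun x => g (s.start c + x c)) (update x c y) =
        (univ.pi (doneBox A s c T)).indicator (fun _ => g T) x := by
      intro x
      by_cases hx : x ∈ univ.pi (doneBox A s c T)
      · rw [indicator_of_mem hx, indicator_of_mem]
        · rw [update_self, ← hT]
        · rw [hmem, ← hT]; exact ⟨by rw [hT]; exact hy, hx⟩
      · rw [indicator_of_notMem hx, indicator_of_notMem]
        rw [hmem, ← hT]; exact fun h => hx h.2
    -- After the departure of `c` its coordinate is no longer read, so the value `y` survives only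
    -- in `T`.
    have h2 : ∀ x : Chunk → ℝ≥0, (firstSet A s (idleTime L R π s) c).indicator
        (fun x => future φ L R π j h s x) (update x c y) =
        (univ.pi (doneBox A s c T)).indicator
          (fun x => future φ L R π (j + 1) (update h j T) (done s c T) x) x := by
      intro x
      by_cases hx : x ∈ univ.pi (doneBox A s c T)
      · have hx' : update x c y ∈ firstSet A s (idleTime L R π s) c := by
          rw [hmem, ← hT]; exact ⟨by rw [hT]; exact hy, hx⟩
        rw [indicator_of_mem hx, indicator_of_mem hx',
          future_of_first hR hs (hA.consistent hx'.1) hj hx'.2.1 hx'.2.2, update_self, ← hT,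
          ENNReal.toNNReal_coe, future_update (by simp [done])]
      · rw [indicator_of_notMem hx, indicator_of_notMem]
        rw [hmem, ← hT]; exact fun h => hx h.2
    simp_rw [h1, h2]
    rw [lintegral_indicator hA'.measurableSet, lintegral_indicator hA'.measurableSet,
      setLIntegral_const]
    exact hle
  · have : ∀ x : Chunk → ℝ≥0, update x c y ∉ firstSet A s (idleTime L R π s) c :=
      fun x hx => hy ((hmem x).1 hx).1
    simp [indicator_of_notMem (this _)]

end Box

/-! ### Backward induction over the departures. -/

section Verification

variable {L : ℕ} {R : Arrivals} {π : OnlinePolicy}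

/-- There is a departure within `n` steps. -/
def DepartsWithin (L : ℕ) (R : Arrivals) (π : OnlinePolicy) (j : ℕ) (s : Record) (n : ℕ)
    (x : Chunk → ℝ≥0) : Prop :=
  ∃ k ≤ n, ((j + 1 : ℕ) : ℕ∞) ≤ count (runFrom L R π x s k)

theorem measurableSet_departsWithin (hR : R.Valid) (j : ℕ) (s : Record) (n : ℕ) :
    MeasurableSet {x | DepartsWithin L R π j s n x} := by
  have : {x | DepartsWithin L R π j s n x} =
      ⋃ k : ℕ, ⋃ _ : k ≤ n, {x | ((j + 1 : ℕ) : ℕ∞) ≤ count (runFrom L R π x s k)} := by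
    ext x; simp [DepartsWithin]
  rw [this]
  exact MeasurableSet.iUnion fun k => MeasurableSet.iUnion fun _ => measurableSet_le_count hR s k _

theorem departsWithin_succ {j : ℕ} {s : Record} (hj : count s = j) (n : ℕ) (x : Chunk → ℝ≥0) :
    DepartsWithin L R π j s (n + 1) x ↔ DepartsWithin L R π j (step L R π x s) n x := by
  constructor
  · rintro ⟨k, hk, h⟩
    cases k with
    | zero => exact absurd h (not_succ_le_count hj le_rfl)
    | succ k => exact ⟨k, by omega, h⟩
  · rintro ⟨k, hk, h⟩
    exact ⟨k + 1, by omega, h⟩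

theorem depFrom_ne_top_iff {j : ℕ} {s : Record} {x : Chunk → ℝ≥0} :
    depFrom L R π x s j ≠ ⊤ ↔ ∃ n, DepartsWithin L R π j s n x := by
  constructor
  · intro h
    by_contra! hc
    exact h (iInf₂_eq_top.2 fun m hm => absurd ⟨m, le_rfl, hm⟩ (hc m))
  · rintro ⟨n, k, -, h⟩
    exact ((iInf₂_le k h : depFrom L R π x s j ≤ _).trans_lt ENNReal.coe_lt_top).ne

open Classical in
/-- A lower bound for the future, with the bound `g` from the next departure on, if it takes place
within `n` steps. -/
noncomputable def truncated (φ : (ℕ → ℝ≥0∞) → ℝ≥0∞) (g : ℝ≥0∞ → ℝ≥0∞) (L : ℕ) (R : Arrivals)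
    (π : OnlinePolicy) (j : ℕ) (h : ℕ → ℝ≥0∞) (s : Record) (n : ℕ) (x : Chunk → ℝ≥0) : ℝ≥0∞ :=
  if DepartsWithin L R π j s n x then g (depFrom L R π x s j)
  else if depFrom L R π x s j = ⊤ then future φ L R π j h s x else 0

variable {μ : Measure ℝ≥0} [IsProbabilityMeasure μ] {φ : (ℕ → ℝ≥0∞) → ℝ≥0∞} {g : ℝ≥0∞ → ℝ≥0∞}
  {Inv : Record → Prop} {j : ℕ} {h : ℕ → ℝ≥0∞}

/-- The box is split step by step, and no number of steps until the next departure is uniform over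
the box. The induction is therefore on a step budget `n`, with integrand `0` where the departure
occurs but exceeds the budget. -/
theorem lintegral_truncated_le (hR : Repetition L R) (hφ : Measurable φ) (hg : Measurable g)
    (hValid : ∀ s, Inv s → s.Valid L R) (hIdle : ∀ s, Inv s → Inv (idle L R π s))
    (hnext : ∀ s, Inv s → count s = j → ∀ c, busy s c → ∀ T : ℝ≥0, s.now ≤ T → ∀ A',
      Fits A' (done s c T) → g T * (Measure.infinitePi fun _ : Chunk => μ) (univ.pi A') ≤
        ∫⁻ x in univ.pi A', future φ L R π (j + 1) (update h j T) (done s c T) x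
          ∂(Measure.infinitePi fun _ : Chunk => μ)) (n : ℕ) :
    ∀ s, Inv s → count s = j → ∀ A, Fits A s →
      ∫⁻ x in univ.pi A, truncated φ g L R π j h s n x ∂(Measure.infinitePi fun _ : Chunk => μ) ≤
      ∫⁻ x in univ.pi A, future φ L R π j h s x ∂(Measure.infinitePi fun _ : Chunk => μ) := by
  classical
  induction n with
  | zero =>
    intro s hI hj A hA
    refine lintegral_mono fun x => ?_
    have h0 : ¬ DepartsWithin L R π j s 0 x := by
      rintro ⟨k, hk, hc⟩
      obtain rfl : k = 0 := by omega
      exact not_succ_le_count hj le_rfl hc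
    unfold truncated
    rw [if_neg h0]
    split_ifs
    · exact le_rfl
    · exact zero_le
  | succ n ih =>
    intro s hI hj A hA
    have hs := hValid s hI
    refine lintegral_box_le hs hA _ (idleTime L R π s) (fun c hc => ?_) ?_
    · refine le_trans (le_of_eq ?_) (lintegral_firstSet_le hR hs hA hφ hj hc hg (hnext s hI hj c hc))
      refine setLIntegral_congr_fun (hA.measurableSet_firstSet _ c) fun x hx => ?_
      have hw : DepartsWithin L R π j s (n + 1) x := by
        rw [departsWithin_succ hj, step_of_first hR hs hx.2.1 hx.2.2]
        refine ⟨0, Nat.zero_le n, ?_⟩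
        change _ ≤ count (done s c _)
        rw [count_done hc, hj]; simp
      change truncated φ g L R π j h s (n + 1) x = _
      unfold truncated
      rw [if_pos hw, depFrom_of_first hR hs (hA.consistent hx.1) hj hx.2.1 hx.2.2]
    · by_cases hE : idleTime L R π s ≠ ⊤ ∨ ∀ c, ¬ busy s c
      · have hm := measurableSet_idleBox hA (idleTime L R π s)
        have h1 : ∀ x ∈ univ.pi (idleBox A s (idleTime L R π s)),
            truncated φ g L R π j h s (n + 1) x = truncated φ g L R π j h (idle L R π s) n x := by
          intro x hx
          rw [mem_idleBox] at hx
          unfold truncated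
          rw [depFrom_of_idle hR hs hj le_rfl hx.2, future_of_idle hR hs hj hx.2]
          simp only [departsWithin_succ hj, step_of_idle hR hs hx.2]
        have h2 : ∀ x ∈ univ.pi (idleBox A s (idleTime L R π s)),
            future φ L R π j h s x = future φ L R π j h (idle L R π s) x := by
          intro x hx
          rw [mem_idleBox] at hx
          exact future_of_idle hR hs hj hx.2
        rw [setLIntegral_congr_fun hm h1, setLIntegral_congr_fun hm h2]
        exact ih _ (hIdle s hI) (by rw [count_idle, hj]) _ (hA.idle hR hs hE)
      · push Not at hE
        obtain ⟨hE, c, hc⟩ := hE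
        have : univ.pi (idleBox A s (idleTime L R π s)) = ∅ := by
          ext x
          rw [mem_idleBox, hE]
          simp only [mem_empty_iff_false, iff_false]
          exact fun hx => not_top_lt (hx.2 c hc)
        simp [this]

/-- A bound that holds from the next departure on gives a bound from the present on. -/
theorem lintegral_depFrom_le (hR : Repetition L R) (hφ : Measurable φ) (hg : Measurable g)
    (hValid : ∀ s, Inv s → s.Valid L R) (hIdle : ∀ s, Inv s → Inv (idle L R π s))
    (hnext : ∀ s, Inv s → count s = j → ∀ c, busy s c → ∀ T : ℝ≥0, s.now ≤ T → ∀ A',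
      Fits A' (done s c T) → g T * (Measure.infinitePi fun _ : Chunk => μ) (univ.pi A') ≤
        ∫⁻ x in univ.pi A', future φ L R π (j + 1) (update h j T) (done s c T) x
          ∂(Measure.infinitePi fun _ : Chunk => μ))
    (hh : ∀ i, j ≤ i → h i = ⊤) (hgt : g ⊤ = φ h)
    {s : Record} (hI : Inv s) (hj : count s = j) {A : Chunk → Set ℝ≥0} (hA : Fits A s) :
      ∫⁻ x in univ.pi A, g (depFrom L R π x s j) ∂(Measure.infinitePi fun _ : Chunk => μ) ≤
      ∫⁻ x in univ.pi A, future φ L R π j h s x ∂(Measure.infinitePi fun _ : Chunk => μ) := by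
  classical
  have hs := hValid s hI
  -- The budget tends to infinity by monotone convergence.
  have hmono : Monotone fun n => truncated φ g L R π j h s n := by
    intro m n hmn x
    simp only [truncated]
    by_cases hm : DepartsWithin L R π j s m x
    · have hn : DepartsWithin L R π j s n x := by
        obtain ⟨k, hk, hc⟩ := hm
        exact ⟨k, hk.trans hmn, hc⟩
      rw [if_pos hm, if_pos hn]
    · rw [if_neg hm]
      by_cases ht : depFrom L R π x s j = ⊤
      · have hn : ¬ DepartsWithin L R π j s n x := fun hn => depFrom_ne_top_iff.2 ⟨n, hn⟩ ht
        rw [if_neg hn]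
      · rw [if_neg ht]
        exact zero_le
  have hmeas : ∀ n, Measurable fun x => truncated φ g L R π j h s n x := by
    intro n
    have hd := measurable_depFrom (L := L) (π := π) hR.valid s j
    exact Measurable.ite (measurableSet_departsWithin hR.valid j s n) (hg.comp hd)
      (Measurable.ite (measurableSet_eq_fun hd measurable_const)
        (measurable_future hφ hR.valid) measurable_const)
  have hsup : ∀ x ∈ univ.pi A, g (depFrom L R π x s j) = ⨆ n, truncated φ g L R π j h s n x := by
    intro x hx
    by_cases ht : depFrom L R π x s j = ⊤
    · have hn : ∀ n, ¬ DepartsWithin L R π j s n x := fun n hn => depFrom_ne_top_iff.2 ⟨n, hn⟩ ht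
      have : ∀ n, truncated φ g L R π j h s n x = future φ L R π j h s x := by
        intro n
        unfold truncated
        rw [if_neg (hn n), if_pos ht]
      -- Without a next departure there is no later one either, and the departure sequence is `h`
      -- itself, whose remaining entries are `⊤`.
      simp only [this, ciSup_const]
      rw [ht, hgt, future]
      congr 1
      funext i
      split_ifs with hi
      · rfl
      · rw [hh i (not_lt.1 hi)]
        refine (top_le_iff.1 ?_).symm
        rw [← ht]
        refine le_iInf₂ fun m hm => ?_
        have hji : ((j + 1 : ℕ) : ℕ∞) ≤ ((i + 1 : ℕ) : ℕ∞) := Nat.cast_le.2 (by omega)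
        exact (iInf₂_le m (hji.trans hm) : depFrom L R π x s j ≤ _)
    · obtain ⟨n, hn⟩ := depFrom_ne_top_iff.1 ht
      refine le_antisymm (le_iSup_of_le n ?_) (iSup_le fun m => ?_)
      · unfold truncated; rw [if_pos hn]
      · unfold truncated
        rw [if_neg ht]
        split_ifs
        · exact le_rfl
        · exact zero_le
  rw [setLIntegral_congr_fun hA.measurableSet hsup, lintegral_iSup hmeas hmono]
  exact iSup_le fun n => lintegral_truncated_le hR hφ hg hValid hIdle hnext n s hI hj A hA

/-- If after each departure the conditional law of the time of the next one is good enough, then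
the expectation of `φ` at the departure times is at least its expectation for the single server
with service times of law `κ`. -/
theorem value_le_lintegral_future (hR : Repetition L R) (κ : Measure ℝ≥0) [IsProbabilityMeasure κ]
    (hφ : Measurable φ) {m : ℕ} (hφm : ∀ h h' : ℕ → ℝ≥0∞, (∀ i < m, h i = h' i) → φ h = φ h')
    {Start : Record → Prop}
    (hValid : ∀ s, Inv s → s.Valid L R) (hIdle : ∀ s, Inv s → Inv (idle L R π s))
    (hDone : ∀ s c (t : ℝ≥0), Inv s → busy s c → s.now ≤ t → Inv (done s c t) ∧ Start (done s c t))
    (hQ : ∀ r j s h A, j < m → Inv s → Start s → count s = j → Fits A s →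
      (∫⁻ y : ℝ≥0, value κ R φ r (j + 1) (max (s.now : ℝ≥0∞) (R.req j).a + y)
        (update h j (max (s.now : ℝ≥0∞) (R.req j).a + y)) ∂κ) *
          (Measure.infinitePi fun _ : Chunk => μ) (univ.pi A) ≤
      ∫⁻ x in univ.pi A, value κ R φ r (j + 1) (depFrom L R π x s j)
        (update h j (depFrom L R π x s j)) ∂(Measure.infinitePi fun _ : Chunk => μ)) (r : ℕ) :
    ∀ j s h A, j + r = m → Inv s → Start s → count s = j → (∀ i, j ≤ i → h i = ⊤) → Fits A s →
      value κ R φ r j s.now h * (Measure.infinitePi fun _ : Chunk => μ) (univ.pi A) ≤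
      ∫⁻ x in univ.pi A, future φ L R π j h s x ∂(Measure.infinitePi fun _ : Chunk => μ) := by
  induction r with
  | zero =>
    intro j s h A hjm hI hS hj hh hA
    have : ∀ x, future φ L R π j h s x = φ h := by
      intro x
      refine hφm _ _ fun i hi => ?_
      rw [if_pos (by omega)]
    simp only [this, value, setLIntegral_const]
    exact le_rfl
  | succ r ih =>
    intro j s h A hjm hI hS hj hh hA
    -- `hQ` handles the time of the next departure, starting right after a departure (`Start`); the
    -- induction hypothesis handles the departures after it. `Inv` is preserved throughout in
    -- between.
    refine (hQ r j s h A (by omega) hI hS hj hA).trans ?_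
    refine lintegral_depFrom_le (g := fun t => value κ R φ r (j + 1) t (update h j t)) hR hφ
      (measurable_value_update hφ r j h) hValid hIdle ?_ hh ?_ hI hj hA
    · intro s' hI' hj' c hc T hT A' hA'
      have := hDone s' c T hI' hc hT
      refine ih (j + 1) (done s' c T) (update h j T) A' (by omega) this.1 this.2 ?_ ?_ hA'
      · rw [count_done hc, hj']; simp
      · intro i hi
        rw [update_of_ne (by omega)]
        exact hh i (by omega)
    · have : update h j ⊤ = h := by rw [← hh j le_rfl, update_eq_self]
      simp only [this]
      exact value_top r (j + 1) h fun i hi => hh i (by omega)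

end Verification

/-! ### The minimum of `L` independent downloading times. -/

section MinLaw

/-- `L` chunks of one file. -/
def firstChunks (L : ℕ) : Finset Chunk :=
  (Finset.range L).map ⟨Prod.mk 0, Prod.mk_right_injective 0⟩

theorem card_firstChunks (L : ℕ) : (firstChunks L).card = L := by simp [firstChunks]

theorem nonempty_of_card {L : ℕ} (hL : 1 ≤ L) {C : Finset Chunk} (hC : C.card = L) : C.Nonempty :=
  Finset.card_pos.1 (by omega)

/-- The law of the minimum of `L` independent downloading times. -/
noncomputable def minLaw (μ : Measure ℝ≥0) [IsProbabilityMeasure μ] (L : ℕ) (hL : 1 ≤ L) :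
    Measure ℝ≥0 :=
  (Measure.infinitePi fun _ : Chunk => μ).map fun x =>
    (firstChunks L).inf' (nonempty_of_card hL (card_firstChunks L)) x

theorem measurable_inf' {C : Finset Chunk} (hC : C.Nonempty) :
    Measurable fun x : Chunk → ℝ≥0 => C.inf' hC x := by
  refine measurable_of_Ici fun a => ?_
  have : (fun x : Chunk → ℝ≥0 => C.inf' hC x) ⁻¹' Ici a = ⋂ c ∈ C, (fun x => x c) ⁻¹' Ici a := by
    ext x
    simp [Finset.le_inf'_iff]
  rw [this]
  exact C.measurableSet_biInter fun c _ => measurable_pi_apply c measurableSet_Ici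

variable (μ : Measure ℝ≥0) [IsProbabilityMeasure μ] {A : Chunk → Set ℝ≥0}

instance (L : ℕ) (hL : 1 ≤ L) : IsProbabilityMeasure (minLaw μ L hL) :=
  Measure.isProbabilityMeasure_map (measurable_inf' _).aemeasurable

/-- The measure of a box is a finite product, so the comparison is made side by side: each
coordinate in `C` costs a factor `p`, and the others are unchanged. -/
theorem box_mul_le (hA : ∀ c, MeasurableSet (A c)) (hAf : {c | A c ≠ univ}.Finite)
    {B : Chunk → Set ℝ≥0} (hB : ∀ c, MeasurableSet (B c)) {C : Finset Chunk}
    (hBA : ∀ c, c ∉ C → B c = A c) {p : ℝ≥0∞} (hp : ∀ c ∈ C, μ (A c) * p ≤ μ (B c)) :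
    (Measure.infinitePi fun _ : Chunk => μ) (univ.pi A) * p ^ C.card ≤
      (Measure.infinitePi fun _ : Chunk => μ) (univ.pi B) := by
  have hAs : ∀ c, c ∉ hAf.toFinset ∪ C → A c = univ := by
    intro c hc
    by_contra h
    exact hc (Finset.mem_union_left _ (by simpa using h))
  rw [infinitePi_box μ hA (hAf.toFinset ∪ C) hAs, infinitePi_box μ hB (hAf.toFinset ∪ C) fun c hc => by
    rw [hBA c fun h => hc (Finset.mem_union_right _ h), hAs c hc]]
  have : p ^ C.card = ∏ c ∈ hAf.toFinset ∪ C, if c ∈ C then p else 1 := by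
    rw [Finset.prod_ite_mem, Finset.inter_eq_right.2 Finset.subset_union_right, Finset.prod_const]
  rw [this, ← Finset.prod_mul_distrib]
  refine Finset.prod_le_prod' fun c _ => ?_
  split_ifs with hc
  · exact hp c hc
  · rw [mul_one, hBA c hc]

open Classical in
theorem box_inter_eq (hA : ∀ c, MeasurableSet (A c)) (hAf : {c | A c ≠ univ}.Finite)
    {C : Finset Chunk} (hC : ∀ c ∈ C, A c = univ) {I : Set ℝ≥0} (hI : MeasurableSet I) :
    (Measure.infinitePi fun _ : Chunk => μ) (univ.pi A ∩ {x | ∀ c ∈ C, x c ∈ I}) =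
      (Measure.infinitePi fun _ : Chunk => μ) (univ.pi A) * μ I ^ C.card := by
  have hset : univ.pi A ∩ {x | ∀ c ∈ C, x c ∈ I} = univ.pi fun c => if c ∈ C then I else A c := by
    ext x
    simp only [mem_inter_iff, Set.mem_pi, mem_univ, true_imp_iff, mem_ofPred_eq]
    rw [forall_and.symm]
    refine forall_congr' fun c => ?_
    by_cases hc : c ∈ C
    · simp [hc, hC c hc]
    · simp [hc]
  have hAs : ∀ c, c ∉ hAf.toFinset ∪ C → A c = univ := by
    intro c hc
    by_contra h
    exact hc (Finset.mem_union_left _ (by simpa using h))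
  rw [hset, infinitePi_box μ hA (hAf.toFinset ∪ C) hAs,
    infinitePi_box μ (fun c => by split_ifs <;> [exact hI; exact hA c]) (hAf.toFinset ∪ C)
      fun c hc => by rw [if_neg fun h => hc (Finset.mem_union_right _ h), hAs c hc]]
  have : μ I ^ C.card = ∏ c ∈ hAf.toFinset ∪ C, if c ∈ C then μ I else 1 := by
    rw [Finset.prod_ite_mem, Finset.inter_eq_right.2 Finset.subset_union_right, Finset.prod_const]
  rw [this, ← Finset.prod_mul_distrib]
  refine Finset.prod_congr rfl fun c _ => ?_
  by_cases hc : c ∈ C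
  · simp [hc, hC c hc]
  · simp [hc]

/-- For a tail `I`, open or closed, the minimum lies in `I` exactly if all coordinates do; by
independence the probabilities multiply. -/
theorem minLaw_of_tail {L : ℕ} (hL : 1 ≤ L) {I : Set ℝ≥0} (hI : MeasurableSet I)
    (hmin : ∀ x : Chunk → ℝ≥0, (firstChunks L).inf' (nonempty_of_card hL (card_firstChunks L)) x ∈ I ↔
      ∀ c ∈ firstChunks L, x c ∈ I) : minLaw μ L hL I = μ I ^ L := by
  have h := box_inter_eq μ (A := fun _ : Chunk => univ) (fun _ => MeasurableSet.univ) (by simp)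
    (C := firstChunks L) (fun _ _ => rfl) hI
  rw [minLaw, Measure.map_apply (measurable_inf' _) hI]
  simp only [pi_univ, univ_inter, measure_univ, one_mul, card_firstChunks] at h
  rw [← h]
  congr 1
  ext x
  exact hmin x

theorem minLaw_Ioi {L : ℕ} (hL : 1 ≤ L) (u : ℝ≥0) : minLaw μ L hL (Ioi u) = μ (Ioi u) ^ L :=
  minLaw_of_tail μ hL measurableSet_Ioi fun x => by simp [Finset.lt_inf'_iff]

theorem minLaw_Ici {L : ℕ} (hL : 1 ≤ L) (u : ℝ≥0) : minLaw μ L hL (Ici u) = μ (Ici u) ^ L :=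
  minLaw_of_tail μ hL measurableSet_Ici fun x => by simp [Finset.le_inf'_iff]

/-- The minimum of `L` unrestricted coordinates is independent of the others. -/
theorem map_inf'_restrict (hA : ∀ c, MeasurableSet (A c)) (hAf : {c | A c ≠ univ}.Finite)
    {L : ℕ} (hL : 1 ≤ L) {C : Finset Chunk} (hCL : C.card = L) (hC : ∀ c ∈ C, A c = univ) :
    ((Measure.infinitePi fun _ : Chunk => μ).restrict (univ.pi A)).map
      (fun x => C.inf' (nonempty_of_card hL hCL) x) =
    (Measure.infinitePi fun _ : Chunk => μ) (univ.pi A) • minLaw μ L hL := by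
  subst hCL
  refine Measure.ext_of_Ici _ _ fun u => ?_
  rw [Measure.map_apply (measurable_inf' _) measurableSet_Ici, Measure.smul_apply, minLaw_Ici,
    Measure.restrict_apply (measurable_inf' _ measurableSet_Ici), smul_eq_mul,
    ← box_inter_eq μ hA hAf hC measurableSet_Ici, inter_comm]
  congr 2
  ext x
  simp [Finset.le_inf'_iff]

end MinLaw

/-! ### One departure, compared with the queue. -/

section Bounds

variable {L : ℕ} {R : Arrivals} {μ : Measure ℝ≥0} [IsProbabilityMeasure μ] {s : Record} {j : ℕ}
  {A : Chunk → Set ℝ≥0} {G : ℝ≥0∞ → ℝ≥0∞}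

/-- The `L` chunks of the cover are not yet started, so the box does not restrict them: their
minimum has law `minLaw` and is independent of the box. -/
theorem sedptr_next_departure (hR : Repetition L R) (hL : 1 ≤ L) {σ : OnlinePolicy}
    (hσ : IsSEDPTR L σ) (hs : s.Valid L R) (hb : ∀ c, ¬ busy s c) (hj : count s = j)
    (hjN : (j : ℕ∞) < R.N) (hA : Fits A s) (hGm : Measurable G) (hG : Antitone G) :
    (∫⁻ y : ℝ≥0, G (max (s.now : ℝ≥0∞) (R.req j).a + y) ∂(minLaw μ L hL)) *
        (Measure.infinitePi fun _ : Chunk => μ) (univ.pi A) ≤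
      ∫⁻ x in univ.pi A, G (depFrom L R σ x s j) ∂(Measure.infinitePi fun _ : Chunk => μ) := by
  obtain ⟨C, hCL, hC, hx⟩ := sedptr_cover hR hσ hs hb hj hjN
  have hCA : ∀ c ∈ C, A c = univ := fun c hc => hA.fresh c (hC c hc)
  have hne := nonempty_of_card hL hCL
  have hGm' : Measurable fun y : ℝ≥0 => G (max (s.now : ℝ≥0∞) (R.req j).a + y) :=
    hGm.comp (measurable_add_coe _)
  calc (∫⁻ y : ℝ≥0, G (max (s.now : ℝ≥0∞) (R.req j).a + y) ∂(minLaw μ L hL)) *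
        (Measure.infinitePi fun _ : Chunk => μ) (univ.pi A)
      = ∫⁻ y : ℝ≥0, G (max (s.now : ℝ≥0∞) (R.req j).a + y)
          ∂((Measure.infinitePi fun _ : Chunk => μ) (univ.pi A) • minLaw μ L hL) := by
        rw [lintegral_smul_measure, smul_eq_mul, mul_comm]
    _ = ∫⁻ x in univ.pi A, G (max (s.now : ℝ≥0∞) (R.req j).a + (C.inf' hne x : ℝ≥0))
          ∂(Measure.infinitePi fun _ : Chunk => μ) := by
        rw [← map_inf'_restrict μ hA.measurable hA.finite hL hCL hCA,
          lintegral_map hGm' (measurable_inf' _)]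
    _ ≤ _ := by
        refine lintegral_mono fun x => hG ?_
        obtain ⟨c, hc, he⟩ := Finset.exists_mem_eq_inf' hne x
        rw [he]
        exact hx x c hc

/-- It suffices to compare tails. The departure exceeds `u` if all chunks of the cover do. This cuts
the box down to a smaller one, and NSU bounds the loss in each coordinate by the factor `μ (Ioi (u -
τ))`. -/
theorem policy_next_departure (hR : Repetition L R) (hL : 1 ≤ L) (hμ : IsNSU μ) {π : OnlinePolicy}
    (hs : s.Valid L R) (hj : count s = j) (hA : Fits A s) (hG : Monotone G) :
    (∫⁻ y : ℝ≥0, G (max (s.now : ℝ≥0∞) (R.req j).a + y) ∂(minLaw μ L hL)) *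
        (Measure.infinitePi fun _ : Chunk => μ) (univ.pi A) ≤
      ∫⁻ x in univ.pi A, G (depFrom L R π x s j) ∂(Measure.infinitePi fun _ : Chunk => μ) := by
  classical
  set ν := Measure.infinitePi fun _ : Chunk => μ
  set τ : ℝ≥0 := max s.now (R.req j).a with hτ
  have hτ' : max (s.now : ℝ≥0∞) (R.req j).a = τ := by rw [hτ]; simp
  have hdep := measurable_depFrom (L := L) (π := π) hR.valid s j
  have hadd : Measurable fun y : ℝ≥0 => (τ : ℝ≥0∞) + y := measurable_add_coe _
  rw [hτ', mul_comm, ← smul_eq_mul, ← lintegral_smul_measure,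
    ← lintegral_map (g := fun y : ℝ≥0 => (τ : ℝ≥0∞) + y) (f := G) hG.measurable hadd,
    ← lintegral_map (g := fun x => depFrom L R π x s j) (f := G) hG.measurable hdep]
  have : IsFiniteMeasure (ν (univ.pi A) • minLaw μ L hL) :=
    ⟨by rw [Measure.smul_apply, measure_univ, smul_eq_mul, mul_one]; exact measure_lt_top _ _⟩
  refine lintegral_monotone_le_of_tails (fun u => ?_) ?_ hG
  · rw [Measure.map_apply hadd measurableSet_Ioi, Measure.map_apply hdep measurableSet_Ioi,
      Measure.smul_apply, Measure.restrict_apply (hdep measurableSet_Ioi), smul_eq_mul]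
    obtain ⟨C, θ, hC, hb, hnb, hx⟩ := exists_cover (π := π) (u := u) hR _ s rfl hs hj
    -- If something is under service, request `j` has arrived, so for running chunks `τ` is the
    -- present.
    have hbτ : ∀ c, busy s c → τ = s.now := fun c hc =>
      max_eq_left (hs.arrived_of_busy hR hj hc)
    have hnbτ : ∀ c ∈ C, ¬ busy s c → (τ : ℝ≥0∞) ≤ θ c := by
      intro c hcC hc
      have := hnb c hcC hc
      rw [← hτ']
      exact max_le this.2.1 this.2.2
    -- No departure is possible before `τ`, so for `u < τ` the tail event is the whole box.
    rcases lt_or_ge u τ with hu | hu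
    · calc _ ≤ ν (univ.pi A) * 1 := by gcongr; exact prob_le_one
        _ ≤ _ := by
          rw [mul_one]
          refine measure_mono fun x hxA => ⟨hx x (hA.consistent hxA) fun c hcC => ?_, hxA⟩
          by_cases hc : busy s c
          · rw [(hb c hc).2]
            refine lt_of_lt_of_le ?_ (hA.consistent hxA c hc)
            rw [← hbτ c hc]
            exact ENNReal.coe_lt_coe.2 hu
          · exact (ENNReal.coe_lt_coe.2 hu).trans_le ((hnbτ c hcC hc).trans le_self_add)
    · have hpre : (fun y : ℝ≥0 => (τ : ℝ≥0∞) + y) ⁻¹' Ioi (u : ℝ≥0∞) = Ioi (u - τ) := by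
        ext y
        simp only [mem_preimage, mem_Ioi, ← ENNReal.coe_add, ENNReal.coe_lt_coe]
        rw [tsub_lt_iff_left hu]
      rw [hpre, minLaw_Ioi]
      calc ν (univ.pi A) * μ (Ioi (u - τ)) ^ L
          ≤ ν (univ.pi A) * μ (Ioi (u - τ)) ^ C.card := by
            -- A policy may use fewer than `L` threads; missing factors are at most `1`.
            refine mul_le_mul' le_rfl ?_
            exact pow_le_pow_right_of_le_one' (prob_le_one (μ := μ) (s := Ioi (u - τ))) hC
        _ ≤ ν (univ.pi fun c => if c ∈ C then A c ∩ {y | (u : ℝ≥0∞) < θ c + (y : ℝ≥0∞)} else A c) := by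
            have hm : ∀ c, MeasurableSet {y : ℝ≥0 | (u : ℝ≥0∞) < θ c + (y : ℝ≥0∞)} := fun c =>
              measurableSet_lt measurable_const (measurable_add_coe _)
            refine box_mul_le μ hA.measurable hA.finite (fun c => ?_) (fun c hc => if_neg hc)
              fun c hcC => ?_
            · split_ifs
              · exact (hA.measurable c).inter (hm c)
              · exact hA.measurable c
            · rw [if_pos hcC]
              by_cases hc : busy s c
              · rw [(hb c hc).2]
                obtain ⟨τc, hτc, hAc⟩ := hA.tail c hc
                have hAci : A c ⊆ Ici τc := by
                  rcases hAc with h | h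
                  · rw [h]
                  · rw [h]; exact Ioi_subset_Ici_self
                -- A running chunk of age `τc` has to last `u - τ` beyond its age, exactly the
                -- situation of `IsNSU.mul_le`.
                have hAcs : Ioi (u - τ + τc) ⊆ A c ∩ {y | (u : ℝ≥0∞) < s.start c + (y : ℝ≥0∞)} := by
                  intro y hy
                  have hy' : u - τ + τc < y := hy
                  refine ⟨?_, ?_⟩
                  · have hlt : τc < y := lt_of_le_of_lt le_add_self hy'
                    rcases hAc with h | h
                    · rw [h]; exact hlt.le
                    · rw [h]; exact hlt
                  · change (u : ℝ≥0∞) < s.start c + (y : ℝ≥0∞)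
                    have h1 : (u : ℝ≥0∞) = s.start c + ((u - τ + τc : ℝ≥0) : ℝ≥0∞) := by
                      rw [ENNReal.coe_add, add_comm ((u - τ : ℝ≥0) : ℝ≥0∞), ← add_assoc, hτc,
                        ← hbτ c hc, ← ENNReal.coe_add, add_tsub_cancel_of_le hu]
                    rw [h1]
                    exact ENNReal.add_lt_add_left hc.1 (ENNReal.coe_lt_coe.2 hy')
                calc μ (A c) * μ (Ioi (u - τ)) ≤ μ (Ici τc) * μ (Ioi (u - τ)) := by gcongr
                  _ ≤ μ (Ioi (u - τ + τc)) := hμ.mul_le _ _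
                  _ ≤ _ := measure_mono hAcs
              · rw [hA.fresh c (hnb c hcC hc).1, measure_univ, one_mul, univ_inter]
                refine measure_mono fun y hy => ?_
                have h1 : u < τ + y := (tsub_lt_iff_left hu).1 hy
                refine lt_of_lt_of_le (ENNReal.coe_lt_coe.2 h1) ?_
                rw [ENNReal.coe_add]
                exact add_le_add_left (hnbτ c hcC hc) _
        _ ≤ _ := by
            refine measure_mono fun x hxB => ?_
            have hxA : x ∈ univ.pi A := by
              intro c _
              have := hxB c (mem_univ c)
              dsimp only at this
              split_ifs at this
              · exact this.1
              · exact this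
            refine ⟨hx x (hA.consistent hxA) fun c hcC => ?_, hxA⟩
            have := hxB c (mem_univ c)
            dsimp only at this
            rw [if_pos hcC] at this
            exact this.2
  · rw [Measure.map_apply hadd MeasurableSet.univ, Measure.map_apply hdep MeasurableSet.univ]
    simp

end Bounds

/-! ### Stochastic order of the departure times. -/

section Departures

variable {L : ℕ} {R : Arrivals} {μ : Measure ℝ≥0} [IsProbabilityMeasure μ] {m : ℕ}
  {φ : (ℕ → ℝ≥0∞) → ℝ≥0∞}

theorem future_init (π : OnlinePolicy) (x : Chunk → ℝ≥0) :
    future φ L R π 0 (fun _ => ⊤) Record.init x = φ fun i => departure L R π x i := by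
  simp [future, departure_eq]

theorem fits_init : Fits (fun _ => univ) Record.init where
  measurable _ := MeasurableSet.univ
  finite := by simp
  fresh _ _ := rfl
  tail _ hc := absurd rfl hc.1

theorem count_init : count Record.init = (0 : ℕ) := by simp [count, Record.init]

/-- Monotone functions of the departure times of any policy. -/
theorem value_le_policy (hR : Repetition L R) (hL : 1 ≤ L) (hμ : IsNSU μ) (π : OnlinePolicy)
    (hφ : Measurable φ) (hφ' : Monotone φ)
    (hφm : ∀ h h' : ℕ → ℝ≥0∞, (∀ i < m, h i = h' i) → φ h = φ h') :
    value (minLaw μ L hL) R φ m 0 0 (fun _ => ⊤) ≤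
      ∫⁻ x, φ (fun i => departure L R π x i) ∂(Measure.infinitePi fun _ : Chunk => μ) := by
  have := value_le_lintegral_future (μ := μ) (π := π) (Inv := Record.Valid L R)
    (Start := fun _ => True) hR (minLaw μ L hL) hφ hφm (fun s hs => hs) (fun s hs => hs.idle hR)
    (fun s c t hs hc ht => ⟨hs.done hc ht, trivial⟩)
    (fun r j s h A _ hs _ hj hA => policy_next_departure
      (G := fun t => value (minLaw μ L hL) R φ r (j + 1) t (update h j t)) hR hL hμ hs hj hA
      fun t t' ht => value_mono hφ' r _ _ _ _ _ ht (update_mono_pair le_rfl ht j))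
    m 0 Record.init (fun _ => ⊤) (fun _ => univ) (by simp) Record.valid_init trivial count_init
    (fun _ _ => rfl) fits_init
  simp only [future_init, pi_univ, measure_univ, mul_one, Measure.restrict_univ] at this
  exact this

/-- Antitone functions of the departure times of SEDPT-R. -/
theorem value_le_sedptr (hR : Repetition L R) (hL : 1 ≤ L) {σ : OnlinePolicy} (hσ : IsSEDPTR L σ)
    (hm : (m : ℕ∞) ≤ R.N) (hφ : Measurable φ) (hφ' : Antitone φ)
    (hφm : ∀ h h' : ℕ → ℝ≥0∞, (∀ i < m, h i = h' i) → φ h = φ h') :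
    value (minLaw μ L hL) R φ m 0 0 (fun _ => ⊤) ≤
      ∫⁻ x, φ (fun i => departure L R σ x i) ∂(Measure.infinitePi fun _ : Chunk => μ) := by
  have := value_le_lintegral_future (μ := μ) (π := σ)
    (Inv := fun s => s.Valid L R ∧ OneRequest s)
    (Start := fun s => ∀ c, ¬ busy s c) hR (minLaw μ L hL) hφ hφm (fun s hs => hs.1)
    (fun s hs => ⟨hs.1.idle hR, hs.2.idle hR hσ hs.1⟩)
    (fun s c t hs hc ht => ⟨⟨hs.1.done hc ht, fun c' _ hc' => absurd hc' (hs.2.not_busy_done hc t c')⟩,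
      hs.2.not_busy_done hc t⟩)
    (fun r j s h A hjm hs hb hj hA => sedptr_next_departure
      (G := fun t => value (minLaw μ L hL) R φ r (j + 1) t (update h j t)) hR hL hσ hs.1 hb hj
      ((Nat.cast_lt.2 hjm).trans_le hm) hA (measurable_value_update hφ r j h)
      fun t t' ht => value_anti hφ' r _ _ _ _ _ ht (update_mono_pair le_rfl ht j))
    m 0 Record.init (fun _ => ⊤) (fun _ => univ) (by simp)
    ⟨Record.valid_init, fun c _ hc => absurd rfl hc.1⟩ (fun c hc => absurd rfl hc.1) count_init
    (fun _ _ => rfl) fits_init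
  simp only [future_init, pi_univ, measure_univ, mul_one, Measure.restrict_univ] at this
  exact this

/-- The departure times of SEDPT-R are stochastically smallest. -/
theorem departures_upperSet_le (hR : Repetition L R) (hL : 1 ≤ L) (hμ : IsNSU μ) {σ : OnlinePolicy}
    (hσ : IsSEDPTR L σ) (π : OnlinePolicy) (hm : (m : ℕ∞) ≤ R.N) {U : Set (Fin m → ℝ≥0∞)}
    (hU : IsUpperSet U) (hUm : MeasurableSet U) :
    (Measure.infinitePi fun _ : Chunk => μ) {x | (fun j : Fin m => departure L R σ x j) ∈ U} ≤
      (Measure.infinitePi fun _ : Chunk => μ) {x | (fun j : Fin m => departure L R π x j) ∈ U} := by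
  classical
  set V : Set (ℕ → ℝ≥0∞) := {h | (fun j : Fin m => h j) ∈ U} with hV
  have hVm : MeasurableSet V :=
    (measurable_pi_iff.2 fun j : Fin m => measurable_pi_apply (j : ℕ)) hUm
  have hVu : ∀ h h' : ℕ → ℝ≥0∞, h ≤ h' → h ∈ V → h' ∈ V := fun h h' hh hh' =>
    hU (fun j => hh j) hh'
  have hVc : ∀ h h' : ℕ → ℝ≥0∞, (∀ i < m, h i = h' i) → (h ∈ V ↔ h' ∈ V) := by
    intro h h' hh
    have : (fun j : Fin m => h j) = fun j : Fin m => h' j := funext fun j => hh j j.2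
    simp only [hV, mem_ofPred_eq, this]
  have h1 := value_le_policy (μ := μ) (m := m) (φ := V.indicator 1) hR hL hμ π
    (measurable_one.indicator hVm)
    (fun h h' hh => by
      by_cases hh' : h ∈ V
      · rw [indicator_of_mem hh', indicator_of_mem (hVu h h' hh hh')]; rfl
      · rw [indicator_of_notMem hh']; exact zero_le)
    (fun h h' hh => by simp only [indicator, hVc h h' hh]; rfl)
  -- The estimate for SEDPT-R is a lower bound for antitone functions, hence the complement;
  -- together with `h3` it bounds the probability of `V` from above.
  have h2 := value_le_sedptr (μ := μ) (m := m) (φ := Vᶜ.indicator 1) hR hL hσ hm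
    (measurable_one.indicator hVm.compl)
    (fun h h' hh => by
      by_cases hh' : h' ∈ Vᶜ
      · have hh'' : h ∈ Vᶜ := fun hc => hh' (hVu h h' hh hc)
        rw [indicator_of_mem hh', indicator_of_mem hh'']; rfl
      · rw [indicator_of_notMem hh']; exact zero_le)
    (fun h h' hh => by simp only [indicator, mem_compl_iff, hVc h h' hh]; rfl)
  have h3 := value_add_value (κ := minLaw μ L hL) (R := R) (φ := V.indicator 1)
    (ψ := Vᶜ.indicator 1) (measurable_one.indicator hVm)
    (fun h => by by_cases hh : h ∈ V <;> simp [hh]) m 0 0 fun _ => ⊤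
  have hdep : ∀ π : OnlinePolicy, Measurable fun x : Chunk → ℝ≥0 => fun i => departure L R π x i :=
    fun π => measurable_pi_iff.2 fun i => measurable_departure hR.valid i
  have hint : ∀ (π : OnlinePolicy) (W : Set (ℕ → ℝ≥0∞)), MeasurableSet W →
      ∫⁻ x, W.indicator 1 (fun i => departure L R π x i) ∂(Measure.infinitePi fun _ : Chunk => μ) =
      (Measure.infinitePi fun _ : Chunk => μ) {x | (fun i => departure L R π x i) ∈ W} := by
    intro π W hW
    exact (lintegral_congr fun x => rfl).trans (lintegral_indicator_one (hdep π hW))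
  rw [hint π V hVm] at h1
  rw [hint σ Vᶜ hVm.compl] at h2
  have h4 : (Measure.infinitePi fun _ : Chunk => μ) {x | (fun i => departure L R σ x i) ∈ V} +
      (Measure.infinitePi fun _ : Chunk => μ) {x | (fun i => departure L R σ x i) ∈ Vᶜ} = 1 := by
    have := measure_add_measure_compl (μ := Measure.infinitePi fun _ : Chunk => μ) (hdep σ hVm)
    rwa [measure_univ] at this
  refine le_trans ?_ h1
  have h5 : value (minLaw μ L hL) R (Vᶜ.indicator 1) m 0 0 (fun _ => ⊤) ≠ ⊤ := by
    refine ne_top_of_le_ne_top ENNReal.one_ne_top (h3 ▸ le_add_self)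
  refine (ENNReal.add_le_add_iff_right h5).1 ?_
  calc _ ≤ (Measure.infinitePi fun _ : Chunk => μ) {x | (fun i => departure L R σ x i) ∈ V} +
      (Measure.infinitePi fun _ : Chunk => μ) {x | (fun i => departure L R σ x i) ∈ Vᶜ} :=
        add_le_add le_rfl h2
    _ = _ := by rw [h4, h3]

end Departures

/-! ### Rearrangement inequalities for sums. -/

section Sums

/-- The largest of the `c i` is paired with the last `t`, and its index is removed. -/
theorem sum_le_sum_of_le_sup {c : ℕ → ℝ≥0∞} {t : ℕ → ℝ≥0∞} (m : ℕ) : ∀ I : Finset ℕ, I.card = m →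
    (∀ k, ∀ J ⊆ I, J.card = k + 1 → ∃ i ∈ J, t k ≤ c i) →
    ∑ j ∈ Finset.range m, t j ≤ ∑ i ∈ I, c i := by
  induction m with
  | zero => intro I _ _; simp
  | succ m ih =>
    intro I hI h
    have hne : I.Nonempty := Finset.card_pos.1 (by omega)
    obtain ⟨i, hi, hmax⟩ := I.exists_max_image c hne
    obtain ⟨i', hi', hle⟩ := h m I subset_rfl hI
    rw [Finset.sum_range_succ, ← Finset.sum_erase_add _ _ hi]
    refine add_le_add (ih (I.erase i) (by rw [Finset.card_erase_of_mem hi]; omega) ?_)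
      (hle.trans (hmax i' hi'))
    exact fun k J hJ => h k J (hJ.trans (Finset.erase_subset _ _))

/-- Some index with `c i ≤ t 0` is paired with `t 0`. Removing it lowers every count by at most one,
which matches the shift of `t`. -/
theorem sum_le_sum_of_card {c : ℕ → ℝ≥0∞} (m : ℕ) : ∀ (I : Finset ℕ) (t : ℕ → ℝ≥0∞), I.card = m →
    (∀ j < m, j + 1 ≤ (I.filter fun i => c i ≤ t j).card) →
    ∑ i ∈ I, c i ≤ ∑ j ∈ Finset.range m, t j := by
  induction m with
  | zero =>
    intro I t hI _
    rw [Finset.card_eq_zero.1 hI]; simp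
  | succ m ih =>
    intro I t hI h
    have h0 := h 0 (by omega)
    obtain ⟨i, hi⟩ := Finset.card_pos.1 (by omega : 0 < (I.filter fun i => c i ≤ t 0).card)
    rw [Finset.mem_filter] at hi
    rw [Finset.sum_range_succ', ← Finset.sum_erase_add _ _ hi.1]
    refine add_le_add (ih (I.erase i) (fun j => t (j + 1))
      (by rw [Finset.card_erase_of_mem hi.1]; omega) fun j hj => ?_) hi.2
    have h1 := h (j + 1) (by omega)
    rw [Finset.filter_erase]
    have h2 := Finset.pred_card_le_card_erase (s := I.filter fun i => c i ≤ t (j + 1)) (a := i)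
    omega

end Sums

/-! ### Completion times against departure times. -/

section Completion

variable {L : ℕ} {R : Arrivals} {π : OnlinePolicy} {s : Record} {x : Chunk → ℝ≥0}

theorem k_le_downloaded_iff (hR : Repetition L R) (hs : s.Valid L R) {i : ℕ}
    (hi : (i : ℕ∞) < R.N) :
    (R.req i).k ≤ downloaded s i (R.req i) ↔ ∃ q, s.fin (i, q) ≠ ⊤ := by
  rw [hR.k_eq i hi, Nat.one_le_iff_ne_zero, ← Nat.pos_iff_ne_zero]
  unfold downloaded
  rw [Finset.card_pos]
  constructor
  · rintro ⟨q, hq⟩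
    simp only [Finset.mem_filter] at hq
    exact ⟨q, hq.2⟩
  · rintro ⟨q, hq⟩
    refine ⟨q, ?_⟩
    simp only [Finset.mem_filter, Finset.mem_range]
    exact ⟨(hs.started _ (hs.finished _ hq)).2.2.2, hq⟩

theorem consistent_init : Consistent x Record.init := fun _ hc => absurd rfl hc.1

theorem run_valid (hR : Repetition L R) (m : ℕ) : (run L R π x m).Valid L R :=
  (runFrom_inv hR Record.valid_init consistent_init m).1

theorem run_now_mono (hR : Repetition L R) : Monotone fun m => (run L R π x m).now :=
  runFrom_now_mono hR Record.valid_init consistent_init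

theorem completion_le (hR : Repetition L R) {i m q : ℕ} (hi : (i : ℕ∞) < R.N)
    (hq : (run L R π x m).fin (i, q) ≠ ⊤) : completion L R π x i ≤ (run L R π x m).now :=
  iInf₂_le m ((k_le_downloaded_iff hR (run_valid hR m) hi).2 ⟨q, hq⟩)

theorem arrival_le_completion (hR : Repetition L R) {i : ℕ} (hi : (i : ℕ∞) < R.N) :
    ((R.req i).a : ℝ≥0∞) ≤ completion L R π x i := by
  refine le_iInf₂ fun m hm => ?_
  have hs := run_valid (π := π) (x := x) hR m
  obtain ⟨q, hq⟩ := (k_le_downloaded_iff hR hs hi).1 hm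
  exact ENNReal.coe_le_coe.2 (hs.started _ (hs.finished _ hq)).2.2.1

/-- Among `k + 1` requests, one is completed not before the `(k + 1)`-st departure. -/
theorem exists_departure_le (hR : Repetition L R) {J : Finset ℕ} {k : ℕ} (hJ : J.card = k + 1)
    (hJN : ∀ i ∈ J, (i : ℕ∞) < R.N) : ∃ i ∈ J, departure L R π x k ≤ completion L R π x i := by
  by_contra! hc
  have h1 : ∀ i : J, ∃ M, (∃ q, (run L R π x M).fin (i.1, q) ≠ ⊤) ∧
      ((run L R π x M).now : ℝ≥0∞) < departure L R π x k := by
    intro i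
    have := hc i.1 i.2
    unfold completion at this
    simp only [iInf_lt_iff] at this
    obtain ⟨M, hM, hlt⟩ := this
    exact ⟨M, (k_le_downloaded_iff hR (run_valid hR M) (hJN i.1 i.2)).1 hM, hlt⟩
  choose M hM hlt using h1
  have hne : J.Nonempty := Finset.card_pos.1 (by omega)
  have : Nonempty J := hne.to_subtype
  -- Downloads stay recorded, so the last of these finitely many records shows all `k + 1` requests
  -- completed, before the departure that should precede it.
  obtain ⟨i₀, -, hmax⟩ := Finset.exists_max_image Finset.univ M Finset.univ_nonempty
  have hcount : ((k + 1 : ℕ) : ℕ∞) ≤ count (run L R π x (M i₀)) := by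
    have h2 : ∀ i : J, ∃ q, (run L R π x (M i₀)).fin (i.1, q) ≠ ⊤ := by
      intro i
      obtain ⟨q, hq⟩ := hM i
      exact ⟨q, runFrom_fin_mono hR Record.valid_init consistent_init
        (hmax i (Finset.mem_univ i)) hq⟩
    have hsub : (J : Set ℕ) ⊆ Prod.fst '' {c | (run L R π x (M i₀)).fin c ≠ ⊤} := by
      intro i hi
      obtain ⟨q, hq⟩ := h2 ⟨i, hi⟩
      exact ⟨(i, q), hq, rfl⟩
    have := (encard_le_encard hsub).trans (encard_image_le _ _)
    rwa [encard_coe_eq_coe_finsetCard, hJ] at this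
  exact absurd (hlt i₀) (not_lt.2 (iInf₂_le (M i₀) hcount))

theorem sum_departure_le (hR : Repetition L R) {m : ℕ} (hm : (m : ℕ∞) ≤ R.N) :
    ∑ j ∈ Finset.range m, departure L R π x j ≤ ∑ i ∈ Finset.range m, completion L R π x i := by
  refine sum_le_sum_of_le_sup m (Finset.range m) (Finset.card_range m) fun k J hJ hJk => ?_
  exact exists_departure_le hR hJk fun i hi =>
    (Nat.cast_lt.2 (Finset.mem_range.1 (hJ hi))).trans_le hm

/-- A departure that takes place is visible in some record. -/
theorem exists_run_departure (hR : Repetition L R) {j : ℕ} (h : departure L R π x j ≠ ⊤) :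
    ∃ M, ((j + 1 : ℕ) : ℕ∞) ≤ count (run L R π x M) ∧
      ((run L R π x M).now : ℝ≥0∞) ≤ departure L R π x j := by
  classical
  have hex : ∃ M, ((j + 1 : ℕ) : ℕ∞) ≤ count (run L R π x M) := by
    by_contra! hc
    exact h (iInf₂_eq_top.2 fun m hm => absurd hm (hc m).not_ge)
  -- The clock is monotone, so the first record with enough downloads attains the infimum.
  refine ⟨Nat.find hex, Nat.find_spec hex, le_iInf₂ fun m hm => ?_⟩
  exact ENNReal.coe_le_coe.2 (run_now_mono hR (Nat.find_min' hex hm))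

/-- When `m` is the total number of requests, the first `j + 1` departures complete `j + 1`
different ones among the first `m`, in whatever order. For `m < N` a departure may belong to a later
request, hence the need for `Fifo` when `N` is infinite. -/
theorem sum_completion_le (hR : Repetition L R) {m : ℕ} (hm : R.N = m) :
    ∑ i ∈ Finset.range m, completion L R π x i ≤ ∑ j ∈ Finset.range m, departure L R π x j := by
  classical
  refine sum_le_sum_of_card m _ _ (Finset.card_range m) fun j hj => ?_
  by_cases ht : departure L R π x j = ⊤
  · rw [ht]
    simp only [le_top, Finset.filter_true, Finset.card_range]
    exact hj
  · obtain ⟨M, hM, hnow⟩ := exists_run_departure hR ht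
    have hs := run_valid (π := π) (x := x) hR M
    have hinj : InjOn Prod.fst {c | (run L R π x M).fin c ≠ ⊤} := by
      rintro ⟨a, b⟩ hab ⟨a', b'⟩ hab' h
      obtain rfl : a = a' := h
      rw [hs.unique a b b' hab hab']
    have hsub : Prod.fst '' {c | (run L R π x M).fin c ≠ ⊤} ⊆
        (((Finset.range m).filter fun i => completion L R π x i ≤ departure L R π x j :
          Finset ℕ) : Set ℕ) := by
      rintro _ ⟨⟨i, q⟩, hc, rfl⟩
      have hi := (hs.started _ (hs.finished _ hc)).2.1
      rw [Finset.coe_filter]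
      refine ⟨Finset.mem_range.2 ?_, (completion_le hR hi hc).trans hnow⟩
      rw [hm] at hi
      exact Nat.cast_lt.1 hi
    have h1 := encard_le_encard hsub
    rw [hinj.encard_image, encard_coe_eq_coe_finsetCard] at h1
    exact Nat.cast_le.1 (hM.trans h1)

/-- Requests are served in the order of arrival. -/
def Fifo (s : Record) : Prop :=
  ∀ c, s.fin c ≠ ⊤ ∨ busy s c → ∀ i < c.1, ∃ q, s.fin (i, q) ≠ ⊤

theorem Fifo.oneRequest (h : Fifo s) : OneRequest s := by
  intro c c' hc hc'
  rcases lt_trichotomy c.1 c'.1 with hlt | he | hlt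
  · obtain ⟨q, hq⟩ := h c' (Or.inr hc') _ hlt
    exact absurd (hc.2 q) hq
  · exact he
  · obtain ⟨q, hq⟩ := h c (Or.inr hc) _ hlt
    exact absurd (hc'.2 q) hq

/-- A new start either joins the request under service, or finds nothing under service. In the
latter case all candidates have `α - δ = 1`, and the tie goes to the first arrival. -/
theorem Fifo.idle (hR : Repetition L R) {σ : OnlinePolicy} (hσ : IsSEDPTR L σ)
    (ht : BreaksTiesByArrival L σ) (hs : s.Valid L R) (h : Fifo s) : Fifo (idle L R σ s) := by
  intro c hc i hi
  rw [idle_fin] at hc ⊢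
  rcases hc with hc | hc
  · exact h c (Or.inl hc) i hi
  rcases (busy_idle_iff hR hs c).1 hc with hb | hb
  · exact h c (Or.inr hb) i hi
  obtain ⟨-, -, hcp, hst⟩ := idle_start_of_new hb.1 hb.2
  have hst' := (startable_iff hR hs).1 hst
  by_cases hb' : ∃ c', busy s c'
  · obtain ⟨c', hc'⟩ := hb'
    have := sedptr_plan_eq hR hσ hs h.oneRequest hc' (hcp ▸ hst)
    rw [← hcp] at this
    exact h c' (Or.inr hc') i (this ▸ hi)
  · push Not at hb'
    by_contra! hf
    have hiN : (i : ℕ∞) < R.N := (Nat.cast_lt.2 hi).trans hst'.2.1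
    have hia : (R.req i).a ≤ s.now := (hR.valid.mono i c.1 hi.le hst'.2.1).trans hst'.2.2.1
    obtain ⟨q, hq⟩ := exists_startable hR hs hst'.1 hiN hia hf
    have := ht (R.view s.now) s (finite_view hR.valid _) ⟨_, hq⟩ _ hq (by
      rw [← hcp, differential_of_not_busy hR hs hiN hia hf fun q' => hb' _,
        differential_of_not_busy hR hs hst'.2.1 hst'.2.2.1 hst'.2.2.2.1 fun q' => hb' _])
    rw [← hcp] at this
    exact absurd hi (not_lt.2 this)

theorem Fifo.done (h : Fifo s) {c : Chunk} (hc : busy s c) (t : ℝ≥0) : Fifo (done s c t) := by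
  have key : ∀ c', s.fin c' ≠ ⊤ → (StorageCloud.done s c t).fin c' ≠ ⊤ := by
    intro c' hc'
    by_cases hcc : c' = c
    · subst hcc; simp [StorageCloud.done]
    · simpa [StorageCloud.done, update_of_ne hcc] using hc'
  intro c' hc' i hi
  have : s.fin c' ≠ ⊤ ∨ busy s c' := by
    rcases hc' with hc' | hc'
    · by_cases hcc : c' = c
      · subst hcc; exact Or.inr hc
      · left; simpa [StorageCloud.done, update_of_ne hcc] using hc'
    · exact Or.inr ((busy_done_iff _ _ _).1 hc').1
  obtain ⟨q, hq⟩ := h c' this i hi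
  exact ⟨q, key _ hq⟩

theorem fifo_run (hR : Repetition L R) {σ : OnlinePolicy} (hσ : IsSEDPTR L σ)
    (ht : BreaksTiesByArrival L σ) (m : ℕ) : Fifo (run L R σ x m) := by
  induction m with
  | zero =>
    rintro c (hc | hc)
    · exact absurd rfl hc
    · exact absurd rfl hc.1
  | succ m ih =>
    have hs := run_valid (π := σ) (x := x) hR m
    have : run L R σ x (m + 1) = step L R σ x (run L R σ x m) := iterate_succ_apply' _ _ _
    rw [this]
    rcases step_cases (π := σ) hR hs x with ⟨c, hc, -, h⟩ | ⟨-, h⟩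
    · rw [h]; exact ih.done hc.1 _
    · rw [h]; exact ih.idle hR hσ ht hs

/-- In order of arrival, as long as request `i` is unfinished only requests below `i` can be
finished, which allows at most `i` departures. -/
theorem completion_le_departure (hR : Repetition L R) {σ : OnlinePolicy} (hσ : IsSEDPTR L σ)
    (ht : BreaksTiesByArrival L σ) {i : ℕ} (hi : (i : ℕ∞) < R.N) :
    completion L R σ x i ≤ departure L R σ x i := by
  by_cases htop : departure L R σ x i = ⊤
  · rw [htop]; exact le_top
  obtain ⟨M, hM, hnow⟩ := exists_run_departure hR htop
  have hs := run_valid (π := σ) (x := x) hR M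
  have hF := fifo_run (x := x) hR hσ ht M
  have hex : ∃ q, (run L R σ x M).fin (i, q) ≠ ⊤ := by
    by_contra! hc
    have hinj : InjOn Prod.fst {c | (run L R σ x M).fin c ≠ ⊤} := by
      rintro ⟨a, b⟩ hab ⟨a', b'⟩ hab' h
      obtain rfl : a = a' := h
      rw [hs.unique a b b' hab hab']
    have hsub : Prod.fst '' {c | (run L R σ x M).fin c ≠ ⊤} ⊆ (Finset.range i : Set ℕ) := by
      rintro _ ⟨⟨l, q⟩, hl, rfl⟩
      simp only [Finset.coe_range, mem_Iio]
      rcases lt_trichotomy l i with h | rfl | h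
      · exact h
      · exact absurd (hc q) hl
      · obtain ⟨q', hq'⟩ := hF (l, q) (Or.inl hl) i h
        exact absurd (hc q') hq'
    have h1 := encard_le_encard hsub
    rw [hinj.encard_image, encard_coe_eq_coe_finsetCard, Finset.card_range] at h1
    have := Nat.cast_le.1 (hM.trans h1)
    omega
  obtain ⟨q, hq⟩ := hex
  exact (completion_le hR hi hq).trans hnow

end Completion

/-! ### From departure times to average flow time. -/

section FlowTime

variable {L : ℕ} {R : Arrivals} {Ω : Type*} [MeasurableSpace Ω] {P : Measure Ω}
  [IsProbabilityMeasure P] {X : Chunk → Ω → ℝ≥0} {σ π : OnlinePolicy}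

/-- Expected sums are chained: completions of `σ`, departures of `σ`, departures of `π`, completions
of `π`. The middle link uses the stochastic order one coordinate at a time. -/
theorem avgFlowOfFirst_le (hR : Repetition L R) (hX : ∀ c, Measurable (X c)) {m : ℕ}
    (hm : (m : ℕ∞) ≤ R.N)
    (hst : StochLE P (fun ω (j : Fin m) => departure L R σ (fun c => X c ω) j)
        (fun ω (j : Fin m) => departure L R π (fun c => X c ω) j))
    (hσ : ∀ x, ∑ i ∈ Finset.range m, completion L R σ x i ≤
      ∑ j ∈ Finset.range m, departure L R σ x j) :
    avgFlowOfFirst P X L R σ m ≤ avgFlowOfFirst P X L R π m := by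
  have hXm : Measurable fun ω c => X c ω := measurable_pi_iff.2 hX
  have hdep : ∀ (ρ : OnlinePolicy) j, Measurable fun ω => departure L R ρ (fun c => X c ω) j :=
    fun ρ j => (measurable_departure hR.valid j).comp hXm
  have hcomp : ∀ (ρ : OnlinePolicy) i, Measurable fun ω => completion L R ρ (fun c => X c ω) i :=
    fun ρ i => (measurable_completion hR.valid i).comp hXm
  have hiN : ∀ i ∈ Finset.range m, (i : ℕ∞) < R.N := fun i hi =>
    (Nat.cast_lt.2 (Finset.mem_range.1 hi)).trans_le hm
  have hle : ∀ j ∈ Finset.range m, ∫⁻ ω, departure L R σ (fun c => X c ω) j ∂P ≤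
      ∫⁻ ω, departure L R π (fun c => X c ω) j ∂P := by
    intro j hj
    refine lintegral_le_of_tails (hdep σ j) (hdep π j) fun v => ?_
    have hj' := Finset.mem_range.1 hj
    exact hst {t | (v : ℝ≥0∞) < t ⟨j, hj'⟩} (fun t t' htt ht => lt_of_lt_of_le ht (htt _))
      (measurableSet_lt measurable_const (measurable_pi_apply _))
  have hsum : ∑ i ∈ Finset.range m, ∫⁻ ω, completion L R σ (fun c => X c ω) i ∂P ≤
      ∑ i ∈ Finset.range m, ∫⁻ ω, completion L R π (fun c => X c ω) i ∂P := by
    calc _ = ∫⁻ ω, ∑ i ∈ Finset.range m, completion L R σ (fun c => X c ω) i ∂P :=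
          (lintegral_finsetSum _ fun i _ => hcomp σ i).symm
      _ ≤ ∫⁻ ω, ∑ j ∈ Finset.range m, departure L R σ (fun c => X c ω) j ∂P :=
          lintegral_mono fun ω => hσ _
      _ = ∑ j ∈ Finset.range m, ∫⁻ ω, departure L R σ (fun c => X c ω) j ∂P :=
          lintegral_finsetSum _ fun j _ => hdep σ j
      _ ≤ ∑ j ∈ Finset.range m, ∫⁻ ω, departure L R π (fun c => X c ω) j ∂P :=
          Finset.sum_le_sum hle
      _ = ∫⁻ ω, ∑ j ∈ Finset.range m, departure L R π (fun c => X c ω) j ∂P :=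
          (lintegral_finsetSum _ fun j _ => hdep π j).symm
      _ ≤ ∫⁻ ω, ∑ i ∈ Finset.range m, completion L R π (fun c => X c ω) i ∂P :=
          lintegral_mono fun ω => sum_departure_le hR hm
      _ = _ := lintegral_finsetSum _ fun i _ => hcomp π i
  -- Truncated subtraction loses nothing, as no request is completed before it arrives; the finite
  -- sum of arrival times can then be cancelled.
  have hsub : ∀ ρ : OnlinePolicy, ∑ i ∈ Finset.range m,
      ((∫⁻ ω, completion L R ρ (fun c => X c ω) i ∂P) - ((R.req i).a : ℝ≥0∞)) +
      ∑ i ∈ Finset.range m, ((R.req i).a : ℝ≥0∞) =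
      ∑ i ∈ Finset.range m, ∫⁻ ω, completion L R ρ (fun c => X c ω) i ∂P := by
    intro ρ
    rw [← Finset.sum_add_distrib]
    refine Finset.sum_congr rfl fun i hi => tsub_add_cancel_of_le ?_
    calc ((R.req i).a : ℝ≥0∞) = ∫⁻ _, ((R.req i).a : ℝ≥0∞) ∂P := by simp
      _ ≤ _ := lintegral_mono fun ω => arrival_le_completion hR (hiN i hi)
  unfold avgFlowOfFirst
  refine ENNReal.div_le_div_right ?_ _
  have hfin : ∑ i ∈ Finset.range m, ((R.req i).a : ℝ≥0∞) ≠ ⊤ :=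
    (ENNReal.sum_lt_top.2 fun i _ => ENNReal.coe_lt_top).ne
  rw [← ENNReal.add_le_add_iff_right hfin, hsub σ, hsub π]
  exact hsum

end FlowTime

end StorageCloud


theorem theorem7 (L : ℕ) (hL : 1 ≤ L)
    (σ : OnlinePolicy) (hσ : IsSEDPTR L σ)
    (R : Arrivals) (hR : R.Valid)
    (hd : (L : ℕ∞) ≤ R.dMin)
    (hk : ∀ i : ℕ, (i : ℕ∞) < R.N → (R.req i).k = 1)
    {Ω : Type*} [MeasurableSpace Ω] (P : Measure Ω) [IsProbabilityMeasure P]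
    (X : Chunk → Ω → ℝ≥0) (hX : ∀ c, Measurable (X c)) (hindep : iIndepFun X P)
    (μ : Measure ℝ≥0) (hlaw : ∀ c, P.map (X c) = μ) (hμ : IsNSU μ)
    (π : OnlinePolicy) :
    (R.N ≠ ⊤ ∨ BreaksTiesByArrival L σ → avgFlow P X L R σ ≤ avgFlow P X L R π) ∧
    ∀ m : ℕ, (m : ℕ∞) ≤ R.N →
      StochLE P (fun ω (j : Fin m) => departure L R σ (fun c => X c ω) j)
        (fun ω (j : Fin m) => departure L R π (fun c => X c ω) j) := by
  have hRep := Repetition.of_dMin hR hd hk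
  have : IsProbabilityMeasure μ :=
    hlaw (0, 0) ▸ Measure.isProbabilityMeasure_map (hX _).aemeasurable
  have hXm : Measurable fun ω c => X c ω := measurable_pi_iff.2 hX
  -- By independence the joint law of the downloading times is the product measure, on which all
  -- estimates were made.
  have hmap : P.map (fun ω c => X c ω) = Measure.infinitePi fun _ : Chunk => μ := by
    rw [hindep.map_fun_eq_infinitePi_map hX]
    simp only [hlaw]
  have hst : ∀ m : ℕ, (m : ℕ∞) ≤ R.N →
      StochLE P (fun ω (j : Fin m) => departure L R σ (fun c => X c ω) j)
        (fun ω (j : Fin m) => departure L R π (fun c => X c ω) j) := by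
    intro m hm U hU hUm
    have key : ∀ ρ : OnlinePolicy,
        P ((fun ω (j : Fin m) => departure L R ρ (fun c => X c ω) j) ⁻¹' U) =
        (Measure.infinitePi fun _ : Chunk => μ)
          {x | (fun j : Fin m => departure L R ρ x j) ∈ U} := by
      intro ρ
      have hdep : Measurable fun (x : Chunk → ℝ≥0) (j : Fin m) => departure L R ρ x j :=
        measurable_pi_iff.2 fun j => measurable_departure hR j
      rw [← hmap]
      exact (Measure.map_apply hXm (hdep hUm)).symm
    rw [key σ, key π]
    exact departures_upperSet_le hRep hL hμ hσ π hm hU hUm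
  refine ⟨fun h => ?_, hst⟩
  unfold avgFlow
  by_cases hN : R.N = ⊤
  · rw [if_pos hN, if_pos hN]
    have ht : BreaksTiesByArrival L σ := h.resolve_left fun h => h hN
    refine limsup_le_limsup (Eventually.of_forall fun m => ?_)
    have hm : (m : ℕ∞) ≤ R.N := by rw [hN]; exact le_top
    exact avgFlowOfFirst_le hRep hX hm (hst m hm) fun x => Finset.sum_le_sum fun i hi =>
      completion_le_departure hRep hσ ht ((Nat.cast_lt.2 (Finset.mem_range.1 hi)).trans_le hm)
  · rw [if_neg hN, if_neg hN]
    have hm : ((R.N.toNat : ℕ) : ℕ∞) = R.N := ENat.natCast_toNat hN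
    exact avgFlowOfFirst_le hRep hX hm.le (hst _ hm.le) fun x => sum_completion_le hRep hm.symm
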